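/- **Setting.** Let $\mathbb X$ be a non-empty compact metric space, $\tau:\mathbb X\to[0,\infty)$ continuous, $\mathbb S=C(\mathbb X)$ with the sup norm and its Borel $\sigma$-algebra, and $\mathbb M$ the set of Gaussian measures on $\mathbb S$ (possibly degenerate), with the $\sigma$-algebra generated by the maps $\nu\mapsto\nu(A)$. Each $\nu\in\mathbb M$ is determined by its mean function $m_\nu$ and covariance function $k_\nu$, and we write $\nu=\mathrm{GP}(m_\nu,k_\nu)$; $\nu_n\to\nu$ means that $m_{\nu_n}\to m_\nu$ and $k_{\nu_n}\to k_\nu$ uniformly. For $x\in\mathbb X$, $z\in\mathbb R$ put $s_\nu^2(x)=k_\nu(x,x)+\tau^2(x)$ and $$\mathrm{Cond}_{x,z}(\nu)=\mathrm{GP}\Bigl(m_\nu+\tfrac{k_\nu(\cdot,x)}{s_\nu^2(x)}(z-m_\nu(x)),\ k_\nu-\tfrac{k_\nu(\cdot,x)\,k_\nu(x,\cdot)}{s_\nu^2(x)}\Bigr),$$ with $\mathrm{Cond}_{x,z}(\nu)=\nu$ if $s^2_\nu(x)=0$. Let $\xi$ be a Gaussian process on $\mathbb X$ with continuous sample paths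 and $(U_n)_{n\ge1}$ i.i.d. $\mathcal N(0,1)$ variables independent of $\xi$, on a probability space $(\Omega,\mathcal F,P)$. Given $\mathbb X$-valued $X_1,X_2,\dots$, put $Z_n=\xi(X_n)+\tau(X_n)U_n$, let $\mathcal F_n$ be the $\sigma$-algebra generated by $X_1,Z_1,\dots,X_n,Z_n$, and $\mathcal F_\infty=\bigvee_n\mathcal F_n$. The sequence $(X_n)$ is a *sequential design* if $X_n$ is $\mathcal F_{n-1}$-measurable for all $n\ge1$. The posterior $P_n^\xi\in\mathbb M$ (the conditional distribution of $\xi$ given $\mathcal F_n$) is given by $P_0^\xi=$ law of $\xi$ and $P_{n+1}^\xi=\mathrm{Cond}_{X_{n+1},Z_{n+1}}(P_n^\xi)$; $P_\infty^\xi$ denotes any $\mathcal F_\infty$-measurable $\mathbb M$-valued version of the conditional distribution of $\xi$ given $\mathcal F_\infty$. **Functionals.** For a Gaussian random element $\xi$ of $\mathbb S$ (on any probability space) let $\mathfrak P(\xi)$ be the set of random elements $\boldsymbol\nu$ of $\mathbb M$ that are a conditional distribution of $\xi$ given some sub-$\sigma$-algebra. A measurable $H:\mathbb M\to\mathbb R$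 is *$\mathfrak P$-uniformly integrable* if, for every $\xi$, the family $(H(\boldsymbol\nu))_{\boldsymbol\nu\in\mathfrak P(\xi)}$ is uniformly integrable; it is *$\mathfrak P$-continuous* if, for every $\xi$ and all $\boldsymbol\nu_n,\boldsymbol\nu_\infty\in\mathfrak P(\xi)$ with $\boldsymbol\nu_n\to\boldsymbol\nu_\infty$ a.s., one has $H(\boldsymbol\nu_n)\to H(\boldsymbol\nu_\infty)$ a.s.; it has the *supermartingale property* if $(H(P_n^\xi))_n$ is an $(\mathcal F_n)$-supermartingale for every Gaussian prior and every sequential design. For measurable $H\ge0$ put $$\mathcal J_x(\nu)=\int_{\mathbb S}\int_{\mathbb R}H\bigl(\mathrm{Cond}_{x,f(x)+u\tau(x)}(\nu)\bigr)\,\tfrac{e^{-u^2/2}}{\sqrt{2\pi}}\,du\,\nu(df),\quad \mathcal G(\nu)=\sup_{x\in\mathbb X}\bigl(H(\nu)-\mathcal J_x(\nu)\bigr),\quad J_n(x)=\mathcal J_x(P_n^\xi).$$ For a sequence $\varepsilon=(\varepsilon_n)$ of positive reals, a sequential design is *$\varepsilon$-quasi-SUR* for $H$ if for some $n_0$, a.s.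 $J_n(X_{n+1})\le\inf_{x}J_n(x)+\varepsilon_n$ for all $n\ge n_0$; it is *quasi-SUR* if this holds for some such $\varepsilon$ with $\varepsilon_n\to0$. **Regular losses.** Let $\mathbb D$ be a non-empty topological space, $L:\mathbb S\times\mathbb D\to[0,\infty)$, $\overline L_\nu(d)=\int L(f,d)\,\nu(df)$ and $H(\nu)=\inf_{d\in\mathbb D}\overline L_\nu(d)$. The loss $L$ is *regular* if: (i) $\mathbb D$ is separable; (ii) $L(\cdot,d)$ is measurable for every $d$; (iii) for every $\nu\in\mathbb M$, $\overline L_\nu$ is finite and continuous on $\mathbb D$; (iv) $H=H_0+H_1$ with $H_0(\nu)=\int L_0\,d\nu$ for some measurable $L_0$ that is integrable with respect to every $\nu\in\mathbb M$, and with $H_1$ $\mathfrak P$-uniformly integrable and $\mathfrak P$-continuous; (v) $\{\nu:H(\nu)=0\}=\{\nu:\mathcal G(\nu)=0\}$. **Theorem.** Let $L$ be a regular non-negative loss function and $H(\nu)=\inf_d\int L(f,d)\,\nu(df)$. Then: a) $H$ is a measurable non-negative functional, and it satisfies the assumptions of the general existence and convergence theorems, namely: $H=H_0+H_1$ with $H_0(\nu)=\int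 L_0\,d\nu$, $L_0$ measurable and integrable with respect to every $\nu\in\mathbb M$, and $H_1$ $\mathfrak P$-uniformly integrable, $\mathfrak P$-continuous and with the supermartingale property; $H$ itself has the supermartingale property; $\{H=0\}=\{\mathcal G=0\}$; and for every quasi-SUR design, $P^\xi_\infty$ exists and, for every version of it, almost surely $H(P_n^\xi)\to H(P_\infty^\xi)$, $\mathcal G(P_n^\xi)\to\mathcal G(P_\infty^\xi)$ and $\mathcal G(P_\infty^\xi)=0$. b) For every sequence $\varepsilon=(\varepsilon_n)$ of positive real numbers there exists an $\varepsilon$-quasi-SUR sequential design $(X_n)_{n\ge1}$ for $H$. c) For every quasi-SUR design for $H$, $H_n=H(P_n^\xi)\to0$ almost surely. -/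

import Mathlib

open MeasureTheory ProbabilityTheory Filter Topology
open scoped NNReal ENNReal

universe u v w

namespace SUR

/-! ### The path space `C(𝕏, ℝ)` and its Gaussian measures -/

/-- `C(𝕏, ℝ)`, with its sup-norm topology, carries its Borel σ-algebra. -/
instance instMeasurableSpaceC {𝕏 : Type*} [TopologicalSpace 𝕏] : MeasurableSpace C(𝕏, ℝ) :=
  borel _

instance instBorelSpaceC {𝕏 : Type*} [TopologicalSpace 𝕏] : BorelSpace C(𝕏, ℝ) := ⟨rfl⟩

/-- The set of all Gaussian measures on `C(𝕏, ℝ)` (Dirac masses included), with the σ-algebra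
generated by the evaluations `ν ↦ ν A`. -/
abbrev GaussMeas (𝕏 : Type u) [MetricSpace 𝕏] [CompactSpace 𝕏] : Type u :=
  {ν : Measure C(𝕏, ℝ) // IsGaussian ν}

section PathSpace

variable {𝕏 : Type u} [MetricSpace 𝕏] [CompactSpace 𝕏]

/-- The mean function `m_ν`. -/
noncomputable def mean (ν : GaussMeas 𝕏) (x : 𝕏) : ℝ := ∫ f, f x ∂ν.1

/-- The covariance function `k_ν`. -/
noncomputable def cov (ν : GaussMeas 𝕏) (x y : 𝕏) : ℝ := cov[fun f => f x, fun f => f y; ν.1]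

/-- Convergence of Gaussian measures: uniform convergence of the mean functions on `𝕏` and of the
covariance functions on `𝕏 × 𝕏`. -/
def GaussTendsto (ν : ℕ → GaussMeas 𝕏) (ν' : GaussMeas 𝕏) : Prop :=
  TendstoUniformly (fun n x => mean (ν n) x) (mean ν') atTop ∧
  TendstoUniformly (fun n (p : 𝕏 × 𝕏) => cov (ν n) p.1 p.2) (fun p => cov ν' p.1 p.2) atTop

open Classical in
/-- `GP(m, k)`: the Gaussian measure on `C(𝕏, ℝ)` with mean function `m` and covariance function
`k` (it is unique if it exists; the value is `δ₀` if there is none). -/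
noncomputable def gp (m : 𝕏 → ℝ) (k : 𝕏 → 𝕏 → ℝ) : GaussMeas 𝕏 :=
  if h : ∃ ν : GaussMeas 𝕏, mean ν = m ∧ cov ν = k then h.choose
  else ⟨Measure.dirac 0, inferInstance⟩

/-- The variance `s_ν²(x) = k_ν(x, x) + τ²(x)` of a noisy observation at `x`. -/
noncomputable def obsVar (τ : C(𝕏, ℝ≥0)) (ν : GaussMeas 𝕏) (x : 𝕏) : ℝ :=
  cov ν x x + (τ x : ℝ) ^ 2

/-- `Cond_{x,z}(ν)`: the conditional distribution of `f ∼ ν` given that the observation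
`f x + τ x * u`, `u ∼ N(0, 1)` independent of `f`, takes the value `z`. Note that division by
zero gives zero, so that nothing is changed when `s_ν²(x) = 0` (pseudo-inverse). -/
noncomputable def cond (τ : C(𝕏, ℝ≥0)) (x : 𝕏) (z : ℝ) (ν : GaussMeas 𝕏) : GaussMeas 𝕏 :=
  gp (fun y => mean ν y + cov ν y x / obsVar τ ν x * (z - mean ν x))
    (fun y y' => cov ν y y' - cov ν y x * cov ν x y' / obsVar τ ν x)

end PathSpace

/-! ### Gaussian conditional distributions and regularity of functionals -/

section Functionals

variable {𝕏 : Type u} [MetricSpace 𝕏] [CompactSpace 𝕏]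

/-- `ν` is an `m'`-measurable random element of the set of Gaussian measures which is a version of
the conditional distribution of `ξ` given the σ-algebra `m'`. -/
structure IsCondLaw {Ω : Type w} (m' : MeasurableSpace Ω) [mΩ : MeasurableSpace Ω] (P : Measure Ω)
    (ξ : Ω → C(𝕏, ℝ)) (ν : Ω → GaussMeas 𝕏) : Prop where
  le : m' ≤ mΩ
  measurable : Measurable[m'] ν
  ae_eq : ∀ A : Set C(𝕏, ℝ), MeasurableSet A →
    (fun ω => (ν ω).1.real A) =ᵐ[P] P⟦ξ ⁻¹' A | m'⟧

/-- The set `𝔓(ξ)` of all Gaussian conditional distributions of `ξ`. -/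
def gaussCondLaws {Ω : Type w} [mΩ : MeasurableSpace Ω] (P : Measure Ω) (ξ : Ω → C(𝕏, ℝ)) :
    Set (Ω → GaussMeas 𝕏) :=
  {ν | ∃ m' : MeasurableSpace Ω, IsCondLaw (mΩ := mΩ) m' P ξ ν}

/-- `𝔓`-uniform integrability of a measurable functional: for every Gaussian random element `ξ`
of `C(𝕏, ℝ)`, the family `H(ν)`, `ν ∈ 𝔓(ξ)`, is uniformly integrable. -/
def PUniformlyIntegrable (H : GaussMeas 𝕏 → ℝ) : Prop :=
  Measurable H ∧
  ∀ (Ω : Type w) [MeasurableSpace Ω] (P : Measure Ω) [IsProbabilityMeasure P]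
    (ξ : Ω → C(𝕏, ℝ)), Measurable ξ → IsGaussian (P.map ξ) →
    UniformIntegrable (fun (ν : gaussCondLaws P ξ) ω => H (ν.1 ω)) 1 P

/-- `𝔓`-continuity of a measurable functional: for every Gaussian random element `ξ` of
`C(𝕏, ℝ)` and all `ν n, ν' ∈ 𝔓(ξ)` with `ν n → ν'` a.s., also `H(ν n) → H(ν')` a.s. -/
def PContinuous (H : GaussMeas 𝕏 → ℝ) : Prop :=
  Measurable H ∧
  ∀ (Ω : Type w) [MeasurableSpace Ω] (P : Measure Ω) [IsProbabilityMeasure P]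
    (ξ : Ω → C(𝕏, ℝ)), Measurable ξ → IsGaussian (P.map ξ) →
    ∀ (ν : ℕ → Ω → GaussMeas 𝕏) (ν' : Ω → GaussMeas 𝕏),
      (∀ n, ν n ∈ gaussCondLaws P ξ) → ν' ∈ gaussCondLaws P ξ →
      (∀ᵐ ω ∂P, GaussTendsto (fun n => ν n ω) (ν' ω)) →
      ∀ᵐ ω ∂P, Tendsto (fun n => H (ν n ω)) atTop (𝓝 (H (ν' ω)))

/-- The one-step criterion `𝒥_x(ν) = ∫∫ H(Cond_{x, f(x) + u τ(x)}(ν)) ν(df) φ(u) du ∈ [0, ∞]` of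
a non-negative functional `H`. -/
noncomputable def stepCrit (τ : C(𝕏, ℝ≥0)) (H : GaussMeas 𝕏 → ℝ) (x : 𝕏) (ν : GaussMeas 𝕏) :
    ℝ≥0∞ :=
  ∫⁻ f, ∫⁻ u, ENNReal.ofReal (H (cond τ x (f x + u * τ x) ν)) ∂(gaussianReal 0 1) ∂ν.1

/-- The expected gain `𝒢_x(ν) = H(ν) - 𝒥_x(ν)`. -/
noncomputable def gain (τ : C(𝕏, ℝ≥0)) (H : GaussMeas 𝕏 → ℝ) (x : 𝕏) (ν : GaussMeas 𝕏) : EReal :=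
  (H ν : EReal) - (stepCrit τ H x ν : EReal)

/-- The maximal expected gain `𝒢(ν) = sup_x 𝒢_x(ν)`. -/
noncomputable def maxGain (τ : C(𝕏, ℝ≥0)) (H : GaussMeas 𝕏 → ℝ) (ν : GaussMeas 𝕏) : EReal :=
  ⨆ x, gain τ H x ν

end Functionals

/-! ### The law of a Gaussian process with continuous paths is a Gaussian measure -/

/-- A map into `C(𝕏, ℝ)` with measurable evaluations is Borel measurable. -/
theorem measurable_of_measurable_eval {𝕏 Ω : Type*} [MetricSpace 𝕏] [CompactSpace 𝕏]
    [MeasurableSpace Ω] {ξ : Ω → C(𝕏, ℝ)} (h : ∀ x, Measurable fun ω => ξ ω x) :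
    Measurable ξ := by
  obtain ⟨Q, hQc, hQd⟩ := TopologicalSpace.exists_countable_dense 𝕏
  have hball : ∀ (c : C(𝕏, ℝ)) (r : ℝ), 0 ≤ r → MeasurableSet (ξ ⁻¹' Metric.closedBall c r) := by
    intro c r hr
    have : ξ ⁻¹' Metric.closedBall c r = ⋂ x ∈ Q, {ω | dist (ξ ω x) (c x) ≤ r} := by
      ext ω
      simp only [Set.mem_preimage, Metric.mem_closedBall, Set.mem_iInter, Set.mem_ofPred_eq]
      rw [ContinuousMap.dist_le hr]
      refine ⟨fun h x _ => h x, fun h x => ?_⟩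
      have hcl : IsClosed {x | dist (ξ ω x) (c x) ≤ r} :=
        isClosed_le (by fun_prop) continuous_const
      have : closure Q ⊆ {x | dist (ξ ω x) (c x) ≤ r} := hcl.closure_subset_iff.2 h
      exact this (hQd x)
    rw [this]
    exact MeasurableSet.biInter hQc fun x _ =>
      measurableSet_le ((h x).dist measurable_const) measurable_const
  refine measurable_of_isOpen fun V hV => ?_
  have hV' : ∀ f : V, ∃ r > 0, Metric.closedBall (f : C(𝕏, ℝ)) r ⊆ V := fun f =>
    Metric.nhds_basis_closedBall.mem_iff.1 (hV.mem_nhds f.2)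
  choose r hr hrV using hV'
  obtain ⟨T, hTc, hT⟩ := TopologicalSpace.isOpen_iUnion_countable
    (fun f : V => Metric.ball (f : C(𝕏, ℝ)) (r f)) (fun f => Metric.isOpen_ball)
  have : V = ⋃ f ∈ T, Metric.closedBall (f : C(𝕏, ℝ)) (r f) := by
    apply Set.Subset.antisymm
    · intro g hg
      have : g ∈ ⋃ f : V, Metric.ball (f : C(𝕏, ℝ)) (r f) :=
        Set.mem_iUnion.2 ⟨⟨g, hg⟩, Metric.mem_ball_self (hr _)⟩
      rw [← hT] at this
      obtain ⟨f, hf, hgf⟩ := Set.mem_iUnion₂.1 this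
      exact Set.mem_iUnion₂.2 ⟨f, hf, Metric.ball_subset_closedBall hgf⟩
    · exact Set.iUnion₂_subset fun f _ => hrV f
  rw [this, Set.preimage_iUnion₂]
  exact MeasurableSet.biUnion hTc fun f _ => hball _ _ (hr f).le

/-- The mean of a real Gaussian law is a median. -/
theorem half_le_gaussianReal_Ici (m : ℝ) (v : ℝ≥0) :
    1 / 2 ≤ (gaussianReal m v).real (Set.Ici m) ∧ 1 / 2 ≤ (gaussianReal m v).real (Set.Iic m) := by
  have hsym : (gaussianReal m v).real (Set.Iic m) = (gaussianReal m v).real (Set.Ici m) := by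
    have h := gaussianReal_map_const_sub (μ := m) (v := v) (2 * m)
    have h2 : 2 * m - m = m := by ring
    rw [h2] at h
    conv_lhs => rw [← h]
    rw [map_measureReal_apply (by fun_prop) measurableSet_Iic]
    congr 1
    ext x
    simp only [Set.mem_preimage, Set.mem_Iic, Set.mem_Ici]
    constructor <;> intro h <;> linarith
  have hone : 1 ≤ (gaussianReal m v).real (Set.Iic m) + (gaussianReal m v).real (Set.Ici m) := by
    have h := measureReal_union_le (μ := gaussianReal m v) (Set.Iic m) (Set.Ici m)
    rw [Set.Iic_union_Ici, probReal_univ] at h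
    exact h
  constructor <;> linarith

/-- An almost sure limit of real Gaussian random variables is Gaussian. -/
theorem isGaussian_map_of_tendsto {Ω : Type*} [MeasurableSpace Ω] {P : Measure Ω}
    [IsProbabilityMeasure P] {Y : ℕ → Ω → ℝ} {Z : Ω → ℝ} (hY : ∀ n, Measurable (Y n))
    (hZ : Measurable Z) (hG : ∀ n, HasGaussianLaw (Y n) P)
    (hlim : ∀ ω, Tendsto (fun n => Y n ω) atTop (𝓝 (Z ω))) :
    ∃ m v, P.map Z = gaussianReal m v := by
  have hlaw : ∀ n, ∃ m v, P.map (Y n) = gaussianReal m v := fun n =>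
    ⟨_, _, (hG n).map_eq_gaussianReal⟩
  choose m v hmv using hlaw
  -- the means are bounded
  have htight : ∃ K : ℕ, P.real {ω | (K : ℝ) ≤ |Z ω|} < 1 / 4 := by
    have hmeas : ∀ K : ℕ, MeasurableSet {ω | (K : ℝ) ≤ |Z ω|} := fun K =>
      measurableSet_le measurable_const hZ.abs
    have h := tendsto_measure_iInter_atTop (μ := P) (s := fun K : ℕ => {ω | (K : ℝ) ≤ |Z ω|})
      (fun K => (hmeas K).nullMeasurableSet)
      (fun a b hab ω (hω : (b : ℝ) ≤ |Z ω|) =>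
        (show (a : ℝ) ≤ |Z ω| from le_trans (by exact_mod_cast hab) hω)) ⟨0, measure_ne_top _ _⟩
    have hemp : ⋂ K : ℕ, {ω | (K : ℝ) ≤ |Z ω|} = ∅ := by
      ext ω
      simp only [Set.mem_iInter, Set.mem_ofPred_eq, Set.mem_empty_iff_false, iff_false, not_forall,
        not_le]
      exact exists_nat_gt _
    rw [hemp, measure_empty] at h
    have h' := (ENNReal.tendsto_toReal ENNReal.zero_ne_top).comp h
    exact (h'.eventually (gt_mem_nhds (by simp : ((0 : ℝ≥0∞).toReal) < 1 / 4))).exists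
  obtain ⟨K, hK⟩ := htight
  have hinm := tendstoInMeasure_of_tendsto_ae (μ := P)
    (fun n => (hY n).aestronglyMeasurable) (Eventually.of_forall hlim)
  have hdist : Tendsto (fun n => P.real {ω | 1 ≤ dist (Y n ω) (Z ω)}) atTop (𝓝 0) := by
    have h := (tendstoInMeasure_iff_dist.1 hinm) 1 one_pos
    exact (ENNReal.tendsto_toReal ENNReal.zero_ne_top).comp h
  have hbound : ∀ᶠ n in atTop, m n ∈ Metric.closedBall (0 : ℝ) (K + 1) := by
    filter_upwards [hdist.eventually (gt_mem_nhds (by norm_num : (0 : ℝ) < 1 / 4))] with n hn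
    have hlt : P.real {ω | (K : ℝ) + 1 < |Y n ω|} < 1 / 2 := by
      calc P.real {ω | (K : ℝ) + 1 < |Y n ω|}
          ≤ P.real ({ω | (K : ℝ) ≤ |Z ω|} ∪ {ω | 1 ≤ dist (Y n ω) (Z ω)}) := by
            refine measureReal_mono fun ω hω => ?_
            by_contra hcon
            simp only [Set.mem_union, Set.mem_ofPred_eq, not_or, not_le] at hcon hω
            have := abs_sub_abs_le_abs_sub (Y n ω) (Z ω)
            rw [Real.dist_eq] at hcon
            linarith [hcon.1, hcon.2]
        _ ≤ _ := measureReal_union_le _ _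
        _ < 1 / 2 := by linarith
    obtain ⟨h1, h2⟩ := half_le_gaussianReal_Ici (m n) (v n)
    rw [← hmv n, map_measureReal_apply (hY n) measurableSet_Ici] at h1
    rw [← hmv n, map_measureReal_apply (hY n) measurableSet_Iic] at h2
    rw [mem_closedBall_zero_iff, Real.norm_eq_abs, abs_le]
    constructor
    · by_contra hcon
      refine absurd (h2.trans (measureReal_mono fun ω hω => ?_)) (not_le.2 hlt)
      simp only [Set.mem_preimage, Set.mem_Iic, Set.mem_ofPred_eq] at hω ⊢
      rw [lt_abs]; right; linarith
    · by_contra hcon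
      refine absurd (h1.trans (measureReal_mono fun ω hω => ?_)) (not_le.2 hlt)
      simp only [Set.mem_preimage, Set.mem_Ici, Set.mem_ofPred_eq] at hω ⊢
      rw [lt_abs]; left; linarith
  -- convergence of characteristic functions
  have : IsProbabilityMeasure (P.map Z) := Measure.isProbabilityMeasure_map hZ.aemeasurable
  have hchar : ∀ t : ℝ, Tendsto (fun n => charFun (P.map (Y n)) t) atTop
      (𝓝 (charFun (P.map Z) t)) := by
    intro t
    simp only [charFun_apply_real]
    simp_rw [integral_map (hY _).aemeasurable
      (by fun_prop : Continuous fun x : ℝ => Complex.exp (t * x * Complex.I)).aestronglyMeasurable,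
      integral_map hZ.aemeasurable
      (by fun_prop : Continuous fun x : ℝ => Complex.exp (t * x * Complex.I)).aestronglyMeasurable]
    refine tendsto_integral_of_dominated_convergence (fun _ => 1) (fun n => ?_)
      (integrable_const _) (fun n => ?_) ?_
    · exact (by fun_prop : Measurable fun ω => Complex.exp (t * (Y n ω) * Complex.I)).aestronglyMeasurable
    · refine Eventually.of_forall fun ω => ?_
      rw [← Complex.ofReal_mul, Complex.norm_exp_ofReal_mul_I]
    · refine Eventually.of_forall fun ω => ?_
      have hc : Continuous fun x : ℝ => Complex.exp (t * x * Complex.I) := by fun_prop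
      exact (hc.tendsto _).comp (hlim ω)
  -- the variances converge
  have hnorm : ∀ t n, ‖charFun (P.map (Y n)) t‖ = Real.exp (-(v n * t ^ 2 / 2)) := by
    intro t n
    rw [hmv n, charFun_gaussianReal, Complex.norm_exp]
    congr 1
    have : (t * m n * Complex.I - v n * t ^ 2 / 2 : ℂ)
        = ((t * m n : ℝ) : ℂ) * Complex.I - ((v n * t ^ 2 / 2 : ℝ) : ℂ) := by push_cast; ring
    rw [this, Complex.sub_re, Complex.re_ofReal_mul, Complex.I_re, mul_zero, Complex.ofReal_re,
      zero_sub]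
  obtain ⟨t₀, ht₀, hne⟩ : ∃ t₀ : ℝ, t₀ ≠ 0 ∧ charFun (P.map Z) t₀ ≠ 0 := by
    have hcont : ContinuousAt (charFun (P.map Z)) 0 := continuous_charFun.continuousAt
    have h0 : charFun (P.map Z) 0 ≠ 0 := by simp
    have hev : ∀ᶠ t in 𝓝[≠] (0 : ℝ), charFun (P.map Z) t ≠ 0 :=
      (hcont.eventually_ne h0).filter_mono nhdsWithin_le_nhds
    obtain ⟨t, ht, ht'⟩ := (hev.and self_mem_nhdsWithin).exists
    exact ⟨t, ht', ht⟩
  have hvlim : Tendsto (fun n => (v n : ℝ)) atTop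
      (𝓝 (-(2 * Real.log ‖charFun (P.map Z) t₀‖) / t₀ ^ 2)) := by
    have h1 := ((hchar t₀).norm).log (norm_ne_zero_iff.2 hne)
    simp_rw [hnorm, Real.log_exp] at h1
    have h2 := ((h1.const_mul 2).neg).div_const (t₀ ^ 2)
    refine h2.congr fun n => ?_
    field_simp
  set w := -(2 * Real.log ‖charFun (P.map Z) t₀‖) / t₀ ^ 2 with hw
  have hw0 : 0 ≤ w := ge_of_tendsto' hvlim fun n => (v n).2
  obtain ⟨a, -, φ, hφ, hma⟩ := tendsto_subseq_of_frequently_bounded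
    (Metric.isBounded_closedBall (x := (0 : ℝ)) (r := K + 1)) hbound.frequently
  refine ⟨a, w.toNNReal, Measure.ext_of_charFun ?_⟩
  ext t
  have hl := (hchar t).comp hφ.tendsto_atTop
  refine tendsto_nhds_unique hl ?_
  rw [charFun_gaussianReal, Real.coe_toNNReal _ hw0]
  have heq : (fun n => charFun (P.map (Y n)) t) ∘ φ
      = fun n => Complex.exp (t * (m (φ n) : ℝ) * Complex.I - ((v (φ n) : ℝ) : ℂ) * t ^ 2 / 2) := by
    ext n
    simp only [Function.comp_apply, hmv, charFun_gaussianReal]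
  rw [heq]
  have hv' : Tendsto (fun n => ((v (φ n) : ℝ) : ℂ)) atTop (𝓝 (w : ℂ)) :=
    (Complex.continuous_ofReal.tendsto _).comp (hvlim.comp hφ.tendsto_atTop)
  have hm' : Tendsto (fun n => ((m (φ n) : ℝ) : ℂ)) atTop (𝓝 (a : ℂ)) :=
    (Complex.continuous_ofReal.tendsto _).comp hma
  exact (Complex.continuous_exp.tendsto _).comp
    (((hm'.const_mul (t : ℂ)).mul_const Complex.I).sub ((hv'.mul_const _).div_const _))

/-- Finite-rank approximation of continuous functions by their values at finitely many points. -/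
theorem exists_finite_rank_approx (𝕏 : Type*) [MetricSpace 𝕏] [CompactSpace 𝕏] :
    ∃ (s : ℕ → Finset 𝕏) (ρ : ℕ → 𝕏 → C(𝕏, ℝ)), ∀ f : C(𝕏, ℝ),
      Tendsto (fun n => ∑ x ∈ s n, f x • ρ n x) atTop (𝓝 f) := by
  classical
  have key : ∀ δ : ℝ, 0 < δ → ∃ (s : Finset 𝕏) (ρ : 𝕏 → C(𝕏, ℝ)), (∀ x y, 0 ≤ ρ x y) ∧
      (∀ y, ∑ x ∈ s, ρ x y = 1) ∧ ∀ x y, ρ x y ≠ 0 → dist y x < δ := by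
    intro δ hδ
    obtain ⟨ρ, hρ⟩ := PartitionOfUnity.exists_isSubordinate (s := (Set.univ : Set 𝕏)) isClosed_univ
      (fun x : 𝕏 => Metric.ball x δ) (fun x => Metric.isOpen_ball)
      (fun y _ => Set.mem_iUnion.2 ⟨y, Metric.mem_ball_self hδ⟩)
    have hfin : {i | (Function.support (ρ i)).Nonempty}.Finite :=
      ρ.locallyFinite.finite_nonempty_of_compact
    refine ⟨hfin.toFinset, fun x => ρ x, fun x y => ρ.nonneg x y, fun y => ?_, fun x y hxy => ?_⟩
    · rw [← ρ.sum_eq_one (Set.mem_univ y)]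
      refine (finsum_eq_sum_of_support_subset _ fun i hi => ?_).symm
      simp only [Set.Finite.coe_toFinset, Set.mem_ofPred_eq]
      exact ⟨y, hi⟩
    · exact hρ x (subset_tsupport _ hxy)
  choose s ρ hnn hsum hsupp using fun n : ℕ => key (1 / ((n : ℝ) + 1)) (by positivity)
  refine ⟨s, ρ, fun f => ?_⟩
  rw [Metric.tendsto_atTop]
  intro ε hε
  obtain ⟨δ, hδ, hf⟩ := Metric.uniformContinuous_iff.1
    (CompactSpace.uniformContinuous_of_continuous f.continuous) (ε / 2) (by positivity)
  obtain ⟨N, hN⟩ := exists_nat_one_div_lt hδ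
  refine ⟨N, fun n hn => ?_⟩
  refine lt_of_le_of_lt ((ContinuousMap.dist_le (by positivity : 0 ≤ ε / 2)).2 fun y => ?_)
    (by linarith : ε / 2 < ε)
  have hval : (∑ x ∈ s n, f x • ρ n x) y = ∑ x ∈ s n, f x * ρ n x y := by
    simp [ContinuousMap.sum_apply]
  have hfy : f y = ∑ x ∈ s n, f y * ρ n x y := by rw [← Finset.mul_sum, hsum, mul_one]
  rw [hval, Real.dist_eq, hfy, ← Finset.sum_sub_distrib]
  calc |∑ x ∈ s n, (f x * ρ n x y - f y * ρ n x y)|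
      ≤ ∑ x ∈ s n, |f x * ρ n x y - f y * ρ n x y| := Finset.abs_sum_le_sum_abs _ _
    _ ≤ ∑ x ∈ s n, ε / 2 * ρ n x y := by
        refine Finset.sum_le_sum fun x _ => ?_
        rw [← sub_mul, abs_mul, abs_of_nonneg (hnn n x y)]
        by_cases h0 : ρ n x y = 0
        · simp [h0]
        · refine mul_le_mul_of_nonneg_right ?_ (hnn n x y)
          have h1 : dist y x < δ := by
            refine (hsupp n x y h0).trans (lt_of_le_of_lt ?_ hN)
            exact one_div_le_one_div_of_le (by positivity) (by exact_mod_cast Nat.succ_le_succ hn)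
          have := hf (show dist x y < δ by rwa [dist_comm])
          rw [Real.dist_eq] at this
          exact this.le
    _ = ε / 2 := by rw [← Finset.mul_sum, hsum, mul_one]

/-- The law of a Gaussian process with continuous sample paths on a compact metric space is a
Gaussian measure on `C(𝕏, ℝ)`. -/
theorem isGaussian_map_of_isGaussianProcess {𝕏 Ω : Type*} [MetricSpace 𝕏] [CompactSpace 𝕏]
    [MeasurableSpace Ω] {P : Measure Ω} [IsProbabilityMeasure P] {ξ : Ω → C(𝕏, ℝ)}
    (hm : ∀ x, Measurable fun ω => ξ ω x) (hG : IsGaussianProcess (fun x ω => ξ ω x) P) :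
    IsGaussian (P.map ξ) := by
  have hξ := measurable_of_measurable_eval hm
  obtain ⟨s, ρ, hρ⟩ := exists_finite_rank_approx 𝕏
  refine ⟨fun L => ?_⟩
  have hL : Measurable L := L.continuous.measurable
  have hY : ∀ n, (fun ω => L (∑ x ∈ s n, ξ ω x • ρ n x))
      = fun ω => ∑ x ∈ s n, ξ ω x * L (ρ n x) := fun n => by ext ω; simp
  obtain ⟨m, v, hmv⟩ := isGaussian_map_of_tendsto (P := P)
    (Y := fun n ω => L (∑ x ∈ s n, ξ ω x • ρ n x)) (Z := fun ω => L (ξ ω))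
    (fun n => by
      rw [hY n]
      exact Finset.measurable_fun_sum _ fun x _ => (hm x).mul_const _)
    (hL.comp hξ)
    (fun n => by
      rw [hY n]
      have h := (hG.smul (fun x => L (ρ n x))).hasGaussianLaw_fun_sum (I := s n)
      simpa [mul_comm] using h)
    (fun ω => (L.continuous.tendsto _).comp (hρ (ξ ω)))
  have hmap : (P.map ξ).map L = gaussianReal m v := by
    rw [Measure.map_map hL hξ]; exact hmv
  have hid : HasLaw (fun f => L f) (gaussianReal m v) (P.map ξ) := ⟨hL.aemeasurable, hmap⟩
  rw [hmap]
  have h1 : (P.map ξ)[L] = m := by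
    rw [hid.integral_eq]; exact integral_id_gaussianReal
  have h2 : Var[L; P.map ξ] = v := by
    rw [hid.variance_eq]; exact variance_id_gaussianReal
  rw [h1, h2, Real.toNNReal_coe]

/-! ### Sequential observations of a Gaussian process -/

/-- A Gaussian process `ξ` on `𝕏` with continuous sample paths, together with an independent
sequence of i.i.d. standard normal variables `U 0, U 1, …`. -/
structure ObsModel (𝕏 : Type u) [MetricSpace 𝕏] [CompactSpace 𝕏] {Ω : Type w} [MeasurableSpace Ω]
    (P : Measure Ω) where
  ξ : Ω → C(𝕏, ℝ)
  U : ℕ → Ω → ℝ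
  measurable_ξ : ∀ x, Measurable fun ω => ξ ω x
  gaussian : IsGaussianProcess (fun x ω => ξ ω x) P
  measurable_U : ∀ n, Measurable (U n)
  law_U : ∀ n, P.map (U n) = gaussianReal 0 1
  iIndep_U : iIndepFun U P
  indep : IndepFun ξ (fun ω n => U n ω) P

namespace ObsModel

variable {𝕏 : Type u} [MetricSpace 𝕏] [CompactSpace 𝕏] {Ω : Type w} [mΩ : MeasurableSpace Ω]
  {P : Measure Ω}

/-- The prior: the law of `ξ`. -/
noncomputable def prior [IsProbabilityMeasure P] (M : ObsModel 𝕏 P) : GaussMeas 𝕏 :=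
  ⟨P.map M.ξ, isGaussian_map_of_isGaussianProcess M.measurable_ξ M.gaussian⟩

/-- The observation made at the design point `X n`. Design points, observations and noise
variables are numbered from `0`: `X n`, `obs n`, `U n` are the `(n + 1)`-st ones. -/
noncomputable def obs (M : ObsModel 𝕏 P) (τ : C(𝕏, ℝ≥0)) (X : ℕ → Ω → 𝕏) (n : ℕ) (ω : Ω) : ℝ :=
  M.ξ ω (X n ω) + τ (X n ω) * M.U n ω

variable [MeasurableSpace 𝕏]

/-- `ℱ_n`, the σ-algebra generated by the first `n` design points and observations. -/
@[reducible]
noncomputable def obsSigma (M : ObsModel 𝕏 P) (τ : C(𝕏, ℝ≥0)) (X : ℕ → Ω → 𝕏) (n : ℕ) : MeasurableSpace Ω :=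
  ⨆ (i : ℕ) (_ : i < n), MeasurableSpace.comap (X i) inferInstance ⊔
    MeasurableSpace.comap (M.obs τ X i) inferInstance

/-- `ℱ_∞`, the σ-algebra generated by all the `ℱ_n`. -/
@[reducible]
noncomputable def obsSigmaInf (M : ObsModel 𝕏 P) (τ : C(𝕏, ℝ≥0)) (X : ℕ → Ω → 𝕏) : MeasurableSpace Ω :=
  ⨆ n, M.obsSigma τ X n

/-- A (non-randomized) sequential design: each design point is a measurable function of the
previous design points and observations. -/
def IsSequentialDesign (M : ObsModel 𝕏 P) (τ : C(𝕏, ℝ≥0)) (X : ℕ → Ω → 𝕏) : Prop :=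
  ∀ n, Measurable[M.obsSigma τ X n] (X n)

theorem obsSigma_mono (M : ObsModel 𝕏 P) (τ : C(𝕏, ℝ≥0)) (X : ℕ → Ω → 𝕏) :
    Monotone (M.obsSigma τ X) := fun _ _ h =>
  iSup₂_le fun i hi => le_iSup₂_of_le i (hi.trans_le h) le_rfl

theorem obsSigma_le [BorelSpace 𝕏] (M : ObsModel 𝕏 P) {τ : C(𝕏, ℝ≥0)} {X : ℕ → Ω → 𝕏}
    (hX : M.IsSequentialDesign τ X) (n : ℕ) : M.obsSigma τ X n ≤ mΩ := by
  induction n using Nat.strong_induction_on with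
  | _ n ih =>
    refine iSup₂_le fun i hi => ?_
    have hXi : Measurable (X i) := (hX i).mono (ih i hi) le_rfl
    have hξ : Measurable M.ξ := measurable_of_measurable_eval M.measurable_ξ
    have hev : Measurable fun ω => M.ξ ω (X i ω) :=
      (continuous_eval (F := C(𝕏, ℝ))).measurable.comp (hξ.prodMk hXi)
    have hτ : Measurable fun ω => (τ (X i ω) : ℝ) :=
      (NNReal.continuous_coe.comp τ.continuous).measurable.comp hXi
    exact sup_le hXi.comap_le (hev.add (hτ.mul (M.measurable_U i))).comap_le

/-- The filtration `(ℱ_n)` of a sequential design. -/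
noncomputable def filtration [BorelSpace 𝕏] (M : ObsModel 𝕏 P) {τ : C(𝕏, ℝ≥0)} {X : ℕ → Ω → 𝕏}
    (hX : M.IsSequentialDesign τ X) : Filtration ℕ mΩ where
  seq := M.obsSigma τ X
  mono' := M.obsSigma_mono τ X
  le' := M.obsSigma_le hX

/-- The posterior distribution `P_n^ξ` of `ξ` after the first `n` observations. -/
noncomputable def posterior [IsProbabilityMeasure P] (M : ObsModel 𝕏 P) (τ : C(𝕏, ℝ≥0))
    (X : ℕ → Ω → 𝕏) : ℕ → Ω → GaussMeas 𝕏
  | 0, _ => M.prior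
  | n + 1, ω => cond τ (X n ω) (M.obs τ X n ω) (M.posterior τ X n ω)

/-- The sampling criterion `J_n(x) = 𝒥_x(P_n^ξ)`. -/
noncomputable def sampCrit [IsProbabilityMeasure P] (M : ObsModel 𝕏 P) (τ : C(𝕏, ℝ≥0))
    (H : GaussMeas 𝕏 → ℝ) (X : ℕ → Ω → 𝕏) (n : ℕ) (x : 𝕏) (ω : Ω) : ℝ≥0∞ :=
  stepCrit τ H x (M.posterior τ X n ω)

/-- `X` is a sequential design such that, from some `n₀` on, the point chosen after `n`
observations minimizes `J_n` up to `ε n`, almost surely. -/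
def IsEpsQuasiSUR [IsProbabilityMeasure P] (M : ObsModel 𝕏 P) (τ : C(𝕏, ℝ≥0))
    (H : GaussMeas 𝕏 → ℝ) (ε : ℕ → ℝ) (X : ℕ → Ω → 𝕏) : Prop :=
  M.IsSequentialDesign τ X ∧
  ∃ n₀ : ℕ, ∀ n ≥ n₀, ∀ᵐ ω ∂P,
    M.sampCrit τ H X n (X n ω) ω ≤ (⨅ x, M.sampCrit τ H X n x ω) + ENNReal.ofReal (ε n)

/-- `X` is an `ε`-quasi-SUR design for some positive sequence `ε` tending to zero. -/
def IsQuasiSUR [IsProbabilityMeasure P] (M : ObsModel 𝕏 P) (τ : C(𝕏, ℝ≥0))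
    (H : GaussMeas 𝕏 → ℝ) (X : ℕ → Ω → 𝕏) : Prop :=
  ∃ ε : ℕ → ℝ, (∀ n, 0 < ε n) ∧ Tendsto ε atTop (𝓝 0) ∧ M.IsEpsQuasiSUR τ H ε X

end ObsModel

/-! ### Supermartingale property and the assumptions of the general theorems -/

section Assumptions

variable {𝕏 : Type u} [MetricSpace 𝕏] [CompactSpace 𝕏] [MeasurableSpace 𝕏] [BorelSpace 𝕏]

/-- The supermartingale property of a measurable functional `H`: for every Gaussian prior and
every sequential design, `(H(P_n^ξ))` is an `(ℱ_n)`-supermartingale. -/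
def SupermartingaleProperty (τ : C(𝕏, ℝ≥0)) (H : GaussMeas 𝕏 → ℝ) : Prop :=
  Measurable H ∧
  ∀ (Ω : Type w) [MeasurableSpace Ω] (P : Measure Ω) [IsProbabilityMeasure P]
    (M : ObsModel 𝕏 P) (X : ℕ → Ω → 𝕏) (hX : M.IsSequentialDesign τ X),
    Supermartingale (fun n ω => H (M.posterior τ X n ω)) (M.filtration hX) P

/-- The assumptions of the existence theorem: `H` is a non-negative measurable functional and
`H = H₀ + H₁` where `H₀(ν) = ∫ L₀ dν` with `L₀` integrable for every Gaussian measure, and `H₁` is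
`𝔓`-uniformly integrable, `𝔓`-continuous and has the supermartingale property. -/
def ExistenceAssumptions (τ : C(𝕏, ℝ≥0)) (H : GaussMeas 𝕏 → ℝ) : Prop :=
  Measurable H ∧ (∀ ν, 0 ≤ H ν) ∧
  ∃ (L₀ : C(𝕏, ℝ) → ℝ) (H₁ : GaussMeas 𝕏 → ℝ),
    Measurable L₀ ∧ (∀ ν : GaussMeas 𝕏, Integrable L₀ ν.1) ∧
    PUniformlyIntegrable.{u, w} H₁ ∧ PContinuous.{u, w} H₁ ∧ SupermartingaleProperty.{u, w} τ H₁ ∧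
    ∀ ν, H ν = ∫ f, L₀ f ∂ν.1 + H₁ ν

/-- The assumptions of the general convergence theorem, for a design `X`. Here `P'` stands for
any version of the conditional distribution `P_∞^ξ` of `ξ` given `ℱ_∞`. -/
structure ConvergenceAssumptions {Ω : Type w} [MeasurableSpace Ω] {P : Measure Ω}
    [IsProbabilityMeasure P] (M : ObsModel 𝕏 P) (τ : C(𝕏, ℝ≥0)) (H : GaussMeas 𝕏 → ℝ)
    (X : ℕ → Ω → 𝕏) : Prop where
  measurable : Measurable H
  nonneg : ∀ ν, 0 ≤ H ν
  supermartingale : SupermartingaleProperty.{u, w} τ H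
  quasiSUR : M.IsQuasiSUR τ H X
  exists_limit : ∃ P', IsCondLaw (M.obsSigmaInf τ X) P M.ξ P'
  tendsto_H : ∀ P', IsCondLaw (M.obsSigmaInf τ X) P M.ξ P' →
    ∀ᵐ ω ∂P, Tendsto (fun n => H (M.posterior τ X n ω)) atTop (𝓝 (H (P' ω)))
  tendsto_maxGain : ∀ P', IsCondLaw (M.obsSigmaInf τ X) P M.ξ P' →
    ∀ᵐ ω ∂P, Tendsto (fun n => maxGain τ H (M.posterior τ X n ω)) atTop (𝓝 (maxGain τ H (P' ω)))
  maxGain_eq_zero : ∀ P', IsCondLaw (M.obsSigmaInf τ X) P M.ξ P' →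
    ∀ᵐ ω ∂P, maxGain τ H (P' ω) = 0
  zeros_eq : {ν | H ν = 0} = {ν | maxGain τ H ν = 0}

end Assumptions

/-! ### Functionals built on a loss function -/

section Loss

variable {𝕏 : Type u} [MetricSpace 𝕏] [CompactSpace 𝕏] {D : Type v}

/-- The average loss `∫ L(f, d) ν(df) ∈ [0, ∞]`. -/
noncomputable def avgLoss (L : C(𝕏, ℝ) → D → ℝ≥0) (ν : GaussMeas 𝕏) (d : D) : ℝ≥0∞ :=
  ∫⁻ f, L f d ∂ν.1

/-- The functional `H(ν) = inf_d ∫ L(f, d) ν(df)`, as a real number (the infimum is finite when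
`D` is non-empty and the average losses are finite). -/
noncomputable def lossFunctional (L : C(𝕏, ℝ) → D → ℝ≥0) (ν : GaussMeas 𝕏) : ℝ :=
  (⨅ d, avgLoss L ν d).toReal

/-- Regular non-negative loss functions. -/
structure IsRegularLoss [TopologicalSpace D] (τ : C(𝕏, ℝ≥0)) (L : C(𝕏, ℝ) → D → ℝ≥0) :
    Prop where
  separable : TopologicalSpace.SeparableSpace D
  measurable : ∀ d, Measurable fun f => L f d
  finite : ∀ ν d, avgLoss L ν d ≠ ∞
  continuous : ∀ ν, Continuous (avgLoss L ν)
  decomposition : ∃ (L₀ : C(𝕏, ℝ) → ℝ) (H₁ : GaussMeas 𝕏 → ℝ),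
    Measurable L₀ ∧ (∀ ν : GaussMeas 𝕏, Integrable L₀ ν.1) ∧
    PUniformlyIntegrable.{u, w} H₁ ∧ PContinuous.{u, w} H₁ ∧
    ∀ ν, lossFunctional L ν = ∫ f, L₀ f ∂ν.1 + H₁ ν
  zeros_eq : {ν | lossFunctional L ν = 0} = {ν | maxGain τ (lossFunctional L) ν = 0}

end Loss

end SUR

/-!
Write `γ` for the standard normal law. For `ν = GP(m, k)`, `Cond_{x,z}(ν)` is the law under `ν ⊗ γ`
of the linear residual `f - (f x + τ x * u - z) • k(·, x) / s²(x)` (`SUR.cond_spec`). The residual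
is independent of the observation `f x + τ x * u`, so `Cond` disintegrates `ν` along it
(`SUR.lintegral_cond`), and by induction the posteriors are conditional laws of `ξ` given the
observations (`SUR.IsCondLaw.cond`, `SUR.ObsModel.isCondLaw_posterior`).

*Limits of conditional laws.* Along a filtration, Lévy's upward theorem gives almost sure
convergence of conditional expectations of real functionals of `ξ`. A finite-rank approximation of
the identity of `C(𝕐, ℝ)` lifts this to continuous-function-valued functionals, hence to uniform
convergence of means and covariances (`SUR.IsCondLaw.gaussTendsto`). The limiting regular
conditional law is almost surely Gaussian because, given finite second moments, Gaussianity is a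
countable family of identities for characteristic functions, each of which passes to the limit
(`SUR.exists_isCondLaw_iSup`).

*Supermartingale property.* The average loss of a fixed decision is a martingale, and the Bayes
risk `H` is an infimum of these; the infimum runs over a countable set since the average losses are
continuous on a separable space. This gives measurability of `H`, the supermartingale property, and
`𝒥_x(ν) ≤ H(ν)`.

*Existence.* Uniform integrability together with `𝔓`-continuity yields convergence of expected
Bayes risks whenever Gaussian conditional laws of one random function converge
(`SUR.IsRegularLoss.tendsto_lintegral`). Applied to one observation at varying points this shows
that `x ↦ 𝒥_x(ν)` is continuous where `s_ν² > 0`; elsewhere `𝒥_x(ν) = H(ν)` is maximal. So the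
infimum of the criterion can be computed along a dense sequence
(`SUR.IsRegularLoss.iInf_stepCrit_eq`), and near-minimizers can be selected measurably as the first good point of that sequence.

*Convergence.* For any design the expectation of `J_n(X_{n+1})` is that of `H(P_{n+1})`, so the
expected decreases `Δ_n = H(P_n) - J_n(X_{n+1}) ≥ 0` telescope and are summable. Hence `Δ_n → 0`
almost surely, and for a quasi-SUR design `𝒢(P_n) ≤ Δ_n + ε_n → 0`
(`SUR.IsRegularLoss.tendsto_maxGain_posterior`). No continuity of `𝒢` is needed to identify the
limit: for a fixed point `x` the expectation of `𝒥_x(P_n)` is the expected Bayes risk after one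
fictitious observation at `x`, realized on `Ω × ℝ`, where the updated laws are again conditional
laws along a filtration. So `E 𝒥_x(P_n) → E 𝒥_x(P_∞)` and `E H(P_n) → E H(P_∞)`, and passing to the
limit in `H(P_n) ≤ Δ_n + 𝒥_x(P_n) + ε_n` forces `𝒥_x(P_∞) = H(P_∞)` almost surely for all `x` in a
countable dense set, that is `𝒢(P_∞) = 0` (`SUR.IsRegularLoss.maxGain_limit_eq_zero`). By
regularity `H(P_∞) = 0`, which is the limit of `H(P_n)`.
-/

set_option linter.unusedSectionVars false

namespace SUR

/-! ### Mean and covariance functions of Gaussian measures -/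

section GaussianFacts

variable {𝕏 : Type u} [MetricSpace 𝕏] [CompactSpace 𝕏]

instance (ν : GaussMeas 𝕏) : IsGaussian ν.1 := ν.2

theorem borel_eq_comap_coeFn :
    (instMeasurableSpaceC : MeasurableSpace C(𝕏, ℝ)) =
      MeasurableSpace.comap (fun f : C(𝕏, ℝ) => (f : 𝕏 → ℝ)) MeasurableSpace.pi := by
  apply le_antisymm
  · have h := @measurable_of_measurable_eval 𝕏 C(𝕏, ℝ) _ _
      (MeasurableSpace.comap (fun f : C(𝕏, ℝ) => (f : 𝕏 → ℝ)) MeasurableSpace.pi) id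
      (fun x => (measurable_pi_apply x).comp (comap_measurable _))
    exact fun s hs => h hs
  · exact (measurable_pi_lambda _ fun x => (continuous_eval_const x).measurable).comap_le

theorem measurable_eval_prod [MeasurableSpace 𝕏] [BorelSpace 𝕏] :
    Measurable fun p : C(𝕏, ℝ) × 𝕏 => p.1 p.2 :=
  (continuous_eval (F := C(𝕏, ℝ))).measurable

theorem integrable_norm_sq (ν : GaussMeas 𝕏) : Integrable (fun f : C(𝕏, ℝ) => ‖f‖ ^ 2) ν.1 := by
  have h := (IsGaussian.memLp_two_id (μ := ν.1)).integrable_norm_pow (by norm_num)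
  simpa using h

theorem integrable_norm (ν : GaussMeas 𝕏) : Integrable (fun f : C(𝕏, ℝ) => ‖f‖) ν.1 :=
  (IsGaussian.integrable_id (μ := ν.1)).norm

theorem memLp_eval (ν : GaussMeas 𝕏) (x : 𝕏) : MemLp (fun f : C(𝕏, ℝ) => f x) 2 ν.1 :=
  IsGaussian.memLp_dual ν.1 (ContinuousMap.evalCLM ℝ x) 2 (by simp)

theorem integrable_eval (ν : GaussMeas 𝕏) (x : 𝕏) : Integrable (fun f : C(𝕏, ℝ) => f x) ν.1 :=
  (memLp_eval ν x).integrable (by norm_num)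

theorem cov_eq (ν : GaussMeas 𝕏) (x y : 𝕏) :
    cov ν x y = (∫ f, f x * f y ∂ν.1) - mean ν x * mean ν y :=
  covariance_eq_sub (memLp_eval ν x) (memLp_eval ν y)

theorem cov_comm (ν : GaussMeas 𝕏) (x y : 𝕏) : cov ν x y = cov ν y x := covariance_comm _ _

theorem cov_self_nonneg (ν : GaussMeas 𝕏) (x : 𝕏) : 0 ≤ cov ν x x := by
  rw [cov, covariance_self (memLp_eval ν x).aestronglyMeasurable.aemeasurable]
  exact variance_nonneg _ _

theorem continuous_mean (ν : GaussMeas 𝕏) : Continuous (mean ν) :=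
  continuous_of_dominated (bound := fun f : C(𝕏, ℝ) => ‖f‖)
    (fun x => (integrable_eval ν x).aestronglyMeasurable)
    (fun x => Eventually.of_forall fun f => f.norm_coe_le_norm x)
    (integrable_norm ν) (Eventually.of_forall fun f => f.continuous)

theorem continuous_cov (ν : GaussMeas 𝕏) : Continuous fun p : 𝕏 × 𝕏 => cov ν p.1 p.2 := by
  simp_rw [cov_eq]
  refine Continuous.sub ?_ (((continuous_mean ν).comp continuous_fst).mul
    ((continuous_mean ν).comp continuous_snd))
  refine continuous_of_dominated (bound := fun f : C(𝕏, ℝ) => ‖f‖ ^ 2)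
    (fun p => ((integrable_eval ν p.1).aestronglyMeasurable.mul
      (integrable_eval ν p.2).aestronglyMeasurable))
    (fun p => Eventually.of_forall fun f => ?_)
    (integrable_norm_sq ν) (Eventually.of_forall fun f => by fun_prop)
  rw [norm_mul, sq]
  exact mul_le_mul (f.norm_coe_le_norm _) (f.norm_coe_le_norm _) (norm_nonneg _) (norm_nonneg _)

theorem continuous_obsVar (τ : C(𝕏, ℝ≥0)) (ν : GaussMeas 𝕏) : Continuous (obsVar τ ν) :=
  ((continuous_cov ν).comp (continuous_id.prodMk continuous_id)).add (by fun_prop)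

/-- A point with vanishing observation variance is uncorrelated with all others. -/
theorem cov_eq_zero_of_obsVar_eq_zero {τ : C(𝕏, ℝ≥0)} {ν : GaussMeas 𝕏} {x : 𝕏}
    (h : obsVar τ ν x = 0) (y : 𝕏) : cov ν y x = 0 := by
  have h0 : cov ν x x = 0 :=
    le_antisymm (by have := sq_nonneg (τ x : ℝ); unfold obsVar at h; linarith)
      (cov_self_nonneg ν x)
  have hv : Var[fun f : C(𝕏, ℝ) => f x; ν.1] = 0 := by
    rw [← covariance_self (memLp_eval ν x).aestronglyMeasurable.aemeasurable]; exact h0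
  have hae := ae_eq_integral_of_variance_eq_zero (memLp_eval ν x) hv
  have h1 : cov ν y x
      = cov[fun f : C(𝕏, ℝ) => f y, fun _ => ∫ f : C(𝕏, ℝ), f x ∂ν.1; ν.1] := by
    refine integral_congr_ae ?_
    filter_upwards [hae] with f hf
    simp only [integral_const, probReal_univ, one_smul] at hf ⊢
    rw [hf]
  rw [h1, covariance_const_right]

/-- A Gaussian measure on `C(𝕏, ℝ)` is determined by its mean and covariance functions. -/
theorem GaussMeas.ext_mean_cov {ν ν' : GaussMeas 𝕏} (hm : mean ν = mean ν')
    (hc : cov ν = cov ν') : ν = ν' := by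
  obtain ⟨s, ρ, hρ⟩ := exists_finite_rank_approx 𝕏
  have key : ∀ (μ : GaussMeas 𝕏) (L : StrongDual ℝ C(𝕏, ℝ)),
      Tendsto (fun n => Complex.exp (((∑ x ∈ s n, L (ρ n x) * mean μ x : ℝ) : ℂ) * Complex.I
        - ((∑ x ∈ s n, ∑ y ∈ s n, L (ρ n x) * L (ρ n y) * cov μ x y : ℝ) : ℂ) / 2))
        atTop (𝓝 (charFunDual μ.1 L)) := by
    intro μ L
    -- the finite-rank approximations of `L` are combinations of evaluations
    let Ln : ℕ → StrongDual ℝ C(𝕏, ℝ) := fun n =>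
      ∑ x ∈ s n, L (ρ n x) • ContinuousMap.evalCLM ℝ x
    have hLn : ∀ n f, Ln n f = L (∑ x ∈ s n, f x • ρ n x) := by
      intro n f
      simp [Ln, mul_comm]
    have hLn' : ∀ n f, Ln n f = ∑ x ∈ s n, L (ρ n x) * f x := by
      intro n f
      simp [Ln]
    have hval : ∀ n, charFunDual μ.1 (Ln n) = Complex.exp
        (((∑ x ∈ s n, L (ρ n x) * mean μ x : ℝ) : ℂ) * Complex.I
        - ((∑ x ∈ s n, ∑ y ∈ s n, L (ρ n x) * L (ρ n y) * cov μ x y : ℝ) : ℂ) / 2) := by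
      intro n
      rw [IsGaussian.charFunDual_eq]
      congr 3
      · rw [integral_complex_ofReal]
        congr 1
        simp_rw [hLn']
        rw [integral_finsetSum _ fun x _ => (integrable_eval μ x).const_mul _]
        simp_rw [integral_const_mul]
        rfl
      · congr 1
        have h1 : ⇑(Ln n) = ∑ x ∈ s n, fun f : C(𝕏, ℝ) => L (ρ n x) * f x := by
          ext f; rw [hLn']; simp
        have hmem : ∀ x, MemLp (fun f : C(𝕏, ℝ) => L (ρ n x) * f x) 2 μ.1 :=
          fun x => (memLp_eval μ x).const_mul _
        rw [← covariance_self (Ln n).continuous.measurable.aemeasurable, h1,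
          covariance_sum_sum' (fun x _ => hmem x) (fun x _ => hmem x)]
        refine Finset.sum_congr rfl fun x _ => Finset.sum_congr rfl fun y _ => ?_
        rw [covariance_const_mul_left, covariance_const_mul_right, cov]
        ring
    simp_rw [← hval, charFunDual_apply]
    refine tendsto_integral_of_dominated_convergence (fun _ => 1) (fun n => ?_)
      (integrable_const _) (fun n => ?_) ?_
    · exact Measurable.aestronglyMeasurable (by fun_prop)
    · exact Eventually.of_forall fun f => (Complex.norm_exp_ofReal_mul_I _).le
    · refine Eventually.of_forall fun f => ?_
      have h1 : Tendsto (fun n => Ln n f) atTop (𝓝 (L f)) := by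
        simp_rw [hLn]
        exact (L.continuous.tendsto _).comp (hρ f)
      have hc : Continuous fun t : ℝ => Complex.exp (t * Complex.I) := by fun_prop
      exact (hc.tendsto _).comp h1
  refine Subtype.ext (Measure.ext_of_charFunDual ?_)
  ext L
  refine tendsto_nhds_unique (key ν L) ?_
  rw [hm, hc]
  exact key ν' L

theorem gp_eq {m : 𝕏 → ℝ} {k : 𝕏 → 𝕏 → ℝ} {ν : GaussMeas 𝕏} (hm : mean ν = m)
    (hk : cov ν = k) : gp m k = ν := by
  have h : ∃ ν : GaussMeas 𝕏, mean ν = m ∧ cov ν = k := ⟨ν, hm, hk⟩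
  rw [gp, dif_pos h]
  exact GaussMeas.ext_mean_cov (h.choose_spec.1.trans hm.symm) (h.choose_spec.2.trans hk.symm)

end GaussianFacts

/-! ### Conditioning on a single noisy observation -/

section OneStep

variable {𝕏 : Type u} [MetricSpace 𝕏] [CompactSpace 𝕏]

/-- The kriging weight function `k_ν(·, x) / s_ν²(x)`; it is zero when `s_ν²(x) = 0`. -/
noncomputable def krigWeight (τ : C(𝕏, ℝ≥0)) (ν : GaussMeas 𝕏) (x : 𝕏) : C(𝕏, ℝ) where
  toFun y := cov ν y x / obsVar τ ν x
  continuous_toFun :=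
    ((continuous_cov ν).comp (continuous_id.prodMk continuous_const)).div_const _

/-- The noisy observation `(f, u) ↦ f x + u τ x`, as a continuous linear functional. -/
noncomputable def noisyObs (τ : C(𝕏, ℝ≥0)) (x : 𝕏) : C(𝕏, ℝ) × ℝ →L[ℝ] ℝ :=
  (ContinuousMap.evalCLM ℝ x).comp (ContinuousLinearMap.fst ℝ _ _) +
    (τ x : ℝ) • ContinuousLinearMap.snd ℝ _ _

theorem noisyObs_apply (τ : C(𝕏, ℝ≥0)) (x : 𝕏) (p : C(𝕏, ℝ) × ℝ) :
    noisyObs τ x p = p.1 x + p.2 * τ x := by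
  simp [noisyObs, mul_comm]

/-- The residual `f - (f x + u τ x) k_ν(·, x) / s_ν²(x)` of the linear regression of `f` on the
noisy observation. -/
noncomputable def residual (τ : C(𝕏, ℝ≥0)) (ν : GaussMeas 𝕏) (x : 𝕏) :
    C(𝕏, ℝ) × ℝ →L[ℝ] C(𝕏, ℝ) :=
  ContinuousLinearMap.fst ℝ _ _ - (noisyObs τ x).smulRight (krigWeight τ ν x)

theorem residual_apply (τ : C(𝕏, ℝ≥0)) (ν : GaussMeas 𝕏) (x : 𝕏) (p : C(𝕏, ℝ) × ℝ) :
    residual τ ν x p = p.1 - noisyObs τ x p • krigWeight τ ν x := rfl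

theorem residual_add (τ : C(𝕏, ℝ≥0)) (ν : GaussMeas 𝕏) (x : 𝕏) (p : C(𝕏, ℝ) × ℝ) :
    residual τ ν x p + noisyObs τ x p • krigWeight τ ν x = p.1 := by
  rw [residual_apply, sub_add_cancel]

/-- The joint law of a random function with law `ν` and of an independent standard normal
variable. -/
noncomputable abbrev withNoise (ν : GaussMeas 𝕏) : Measure (C(𝕏, ℝ) × ℝ) :=
  ν.1.prod (gaussianReal 0 1)

theorem memLp_dual_withNoise (ν : GaussMeas 𝕏) (L : C(𝕏, ℝ) × ℝ →L[ℝ] ℝ) :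
    MemLp L 2 (withNoise ν) :=
  IsGaussian.memLp_dual _ L 2 (by simp)

theorem memLp_fst_withNoise (ν : GaussMeas 𝕏) (y : 𝕏) :
    MemLp (fun p : C(𝕏, ℝ) × ℝ => p.1 y) 2 (withNoise ν) :=
  memLp_dual_withNoise ν ((ContinuousMap.evalCLM ℝ y).comp (ContinuousLinearMap.fst ℝ _ _))

theorem memLp_snd_withNoise (ν : GaussMeas 𝕏) :
    MemLp (fun p : C(𝕏, ℝ) × ℝ => p.2) 2 (withNoise ν) :=
  memLp_dual_withNoise ν (ContinuousLinearMap.snd ℝ _ _)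

theorem covariance_fst_fst_withNoise (ν : GaussMeas 𝕏) (y y' : 𝕏) :
    cov[fun p : C(𝕏, ℝ) × ℝ => p.1 y, fun p => p.1 y'; withNoise ν] = cov ν y y' := by
  have h : (withNoise ν).map Prod.fst = ν.1 := by simp [withNoise]
  rw [cov]
  conv_rhs => rw [← h]
  rw [covariance_map]
  · rfl
  · exact (continuous_eval_const y).aestronglyMeasurable
  · exact (continuous_eval_const y').aestronglyMeasurable
  · exact measurable_fst.aemeasurable

theorem covariance_fst_snd_withNoise (ν : GaussMeas 𝕏) (y : 𝕏) :
    cov[fun p : C(𝕏, ℝ) × ℝ => p.1 y, fun p => p.2; withNoise ν] = 0 := by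
  have h := indepFun_prod (μ := ν.1) (ν := gaussianReal 0 1)
    (X := fun f : C(𝕏, ℝ) => f y) (Y := fun u : ℝ => u)
    (continuous_eval_const y).measurable measurable_id
  exact h.covariance_eq_zero (memLp_fst_withNoise ν y) (memLp_snd_withNoise ν)

theorem covariance_snd_snd_withNoise (ν : GaussMeas 𝕏) :
    cov[fun p : C(𝕏, ℝ) × ℝ => p.2, fun p => p.2; withNoise ν] = 1 := by
  have h : (withNoise ν).map Prod.snd = gaussianReal 0 1 := by simp [withNoise]
  have h2 := covariance_map (μ := withNoise ν) (Z := Prod.snd) (X := fun u : ℝ => u)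
    (Y := fun u : ℝ => u) (by fun_prop) (by fun_prop) (by fun_prop)
  rw [h, covariance_self (by fun_prop), variance_fun_id_gaussianReal] at h2
  exact h2.symm

theorem noisyObs_eq (τ : C(𝕏, ℝ≥0)) (x : 𝕏) :
    (noisyObs τ x : C(𝕏, ℝ) × ℝ → ℝ) = (fun p => p.1 x) + fun p => (τ x : ℝ) * p.2 := by
  ext p; simp [noisyObs_apply, mul_comm]

theorem residual_eval_eq (τ : C(𝕏, ℝ≥0)) (ν : GaussMeas 𝕏) (x y : 𝕏) :
    (fun p : C(𝕏, ℝ) × ℝ => residual τ ν x p y)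
      = (fun p => p.1 y) - fun p => krigWeight τ ν x y * noisyObs τ x p := by
  ext p; simp [residual_apply, mul_comm]

theorem covariance_fst_noisyObs (τ : C(𝕏, ℝ≥0)) (ν : GaussMeas 𝕏) (x y : 𝕏) :
    cov[fun p : C(𝕏, ℝ) × ℝ => p.1 y, noisyObs τ x; withNoise ν] = cov ν y x := by
  rw [noisyObs_eq, covariance_add_right (memLp_fst_withNoise ν y) (memLp_fst_withNoise ν x)
    ((memLp_snd_withNoise ν).const_mul _), covariance_const_mul_right,
    covariance_fst_fst_withNoise, covariance_fst_snd_withNoise]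
  ring

theorem covariance_noisyObs (τ : C(𝕏, ℝ≥0)) (ν : GaussMeas 𝕏) (x : 𝕏) :
    cov[noisyObs τ x, noisyObs τ x; withNoise ν] = obsVar τ ν x := by
  have h := memLp_dual_withNoise ν (noisyObs τ x)
  have hs := memLp_snd_withNoise ν
  conv_lhs => enter [1]; rw [noisyObs_eq]
  rw [covariance_add_left (memLp_fst_withNoise ν x) (hs.const_mul _) h, covariance_fst_noisyObs,
    covariance_const_mul_left, covariance_comm, noisyObs_eq,
    covariance_add_left (memLp_fst_withNoise ν x) (hs.const_mul _) hs,
    covariance_fst_snd_withNoise, covariance_const_mul_left, covariance_snd_snd_withNoise, obsVar]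
  ring

theorem krigWeight_mul_obsVar (τ : C(𝕏, ℝ≥0)) (ν : GaussMeas 𝕏) (x y : 𝕏) :
    krigWeight τ ν x y * obsVar τ ν x = cov ν y x := by
  by_cases h : obsVar τ ν x = 0
  · rw [h, mul_zero, cov_eq_zero_of_obsVar_eq_zero h]
  · exact div_mul_cancel₀ _ h

/-- The residual is uncorrelated with the noisy observation. -/
theorem covariance_residual_noisyObs (τ : C(𝕏, ℝ≥0)) (ν : GaussMeas 𝕏) (x y : 𝕏) :
    cov[fun p => residual τ ν x p y, noisyObs τ x; withNoise ν] = 0 := by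
  have h := memLp_dual_withNoise ν (noisyObs τ x)
  rw [residual_eval_eq, covariance_sub_left (memLp_fst_withNoise ν y) (h.const_mul _) h,
    covariance_fst_noisyObs, covariance_const_mul_left, covariance_noisyObs,
    krigWeight_mul_obsVar, sub_self]

theorem memLp_residual (τ : C(𝕏, ℝ≥0)) (ν : GaussMeas 𝕏) (x y : 𝕏) :
    MemLp (fun p => residual τ ν x p y) 2 (withNoise ν) :=
  memLp_dual_withNoise ν ((ContinuousMap.evalCLM ℝ y).comp (residual τ ν x))

theorem covariance_residual (τ : C(𝕏, ℝ≥0)) (ν : GaussMeas 𝕏) (x y y' : 𝕏) :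
    cov[fun p => residual τ ν x p y, fun p => residual τ ν x p y'; withNoise ν]
      = cov ν y y' - cov ν y x * cov ν x y' / obsVar τ ν x := by
  have h := memLp_dual_withNoise ν (noisyObs τ x)
  conv_lhs => enter [2]; rw [residual_eval_eq]
  rw [covariance_sub_right (memLp_residual τ ν x y) (memLp_fst_withNoise ν y') (h.const_mul _),
    covariance_const_mul_right, covariance_residual_noisyObs, residual_eval_eq,
    covariance_sub_left (memLp_fst_withNoise ν y) (h.const_mul _) (memLp_fst_withNoise ν y'),
    covariance_fst_fst_withNoise, covariance_const_mul_left, covariance_comm (noisyObs τ x),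
    covariance_fst_noisyObs, cov_comm ν y' x]
  simp only [krigWeight, ContinuousMap.coe_mk]
  ring

/-- The residual, being jointly Gaussian and uncorrelated with the noisy observation, is
independent of it. -/
theorem indepFun_residual_noisyObs (τ : C(𝕏, ℝ≥0)) (ν : GaussMeas 𝕏) (x : 𝕏) :
    IndepFun (residual τ ν x) (noisyObs τ x) (withNoise ν) := by
  have hG : IsGaussianProcess (Sum.elim (fun (y : 𝕏) p => residual τ ν x p y)
      (fun (_ : Unit) p => noisyObs τ x p)) (withNoise ν) := by
    refine ⟨fun I => ?_⟩
    let Λ : (C(𝕏, ℝ) × ℝ) →L[ℝ] (I → ℝ) := ContinuousLinearMap.pi fun i =>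
      Sum.elim (fun y => (ContinuousMap.evalCLM ℝ y).comp (residual τ ν x))
        (fun _ : Unit => noisyObs τ x) i.1
    have h : HasGaussianLaw (fun p => Λ p) (withNoise ν) :=
      (IsGaussian.hasGaussianLaw_id (μ := withNoise ν)).map_fun Λ
    convert h using 2 with p
    ext ⟨i, hi⟩
    rcases i with y | _ <;> rfl
  have hind := hG.indepFun_of_covariance_eq_zero
    (fun y => (memLp_residual τ ν x y).aestronglyMeasurable.aemeasurable)
    (fun _ => (noisyObs τ x).continuous.measurable.aemeasurable)
    (fun y _ => covariance_residual_noisyObs τ ν x y)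
  have h2 := hind.comp (φ := id) (ψ := fun g : Unit → ℝ => g ()) measurable_id
    (measurable_pi_apply (X := fun _ : Unit => ℝ) ())
  rw [IndepFun_iff_Indep] at h2 ⊢
  have h3 : MeasurableSpace.comap (residual τ ν x) instMeasurableSpaceC = MeasurableSpace.comap
      (id ∘ fun p (y : 𝕏) => residual τ ν x p y) MeasurableSpace.pi := by
    rw [borel_eq_comap_coeFn, MeasurableSpace.comap_comp]
    rfl
  rw [h3]
  exact h2

/-- The parameters defining `Cond_{x,z}(ν)` are those of a Gaussian measure, namely of the law of
the regression residual shifted by the regression function at `z`. -/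
theorem cond_spec (τ : C(𝕏, ℝ≥0)) (x : 𝕏) (z : ℝ) (ν : GaussMeas 𝕏) :
    (mean (cond τ x z ν) = fun y => mean ν y + cov ν y x / obsVar τ ν x * (z - mean ν x)) ∧
    (cov (cond τ x z ν) = fun y y' => cov ν y y' - cov ν y x * cov ν x y' / obsVar τ ν x) ∧
    (cond τ x z ν).1 = (withNoise ν).map fun p => residual τ ν x p + z • krigWeight τ ν x := by
  have hm1 : Measurable (residual τ ν x) := (residual τ ν x).continuous.measurable
  have hm2 : Measurable fun p => residual τ ν x p + z • krigWeight τ ν x := hm1.add_const _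
  have hG : IsGaussian ((withNoise ν).map fun p => residual τ ν x p + z • krigWeight τ ν x) := by
    have h : (withNoise ν).map (fun p => residual τ ν x p + z • krigWeight τ ν x)
        = ((withNoise ν).map (residual τ ν x)).map (fun f => f + z • krigWeight τ ν x) := by
      rw [Measure.map_map (by fun_prop) hm1]; rfl
    rw [h]; infer_instance
  set ν' : GaussMeas 𝕏 := ⟨_, hG⟩ with hν'
  have hint : ∀ y, Integrable (fun p => residual τ ν x p y) (withNoise ν) := fun y =>
    (memLp_residual τ ν x y).integrable (by norm_num)
  have hmean : ∀ y, ∫ p : C(𝕏, ℝ) × ℝ, p.1 y ∂(withNoise ν) = mean ν y := fun y => by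
    have h := integral_map (μ := withNoise ν) measurable_fst.aemeasurable
      (f := fun f : C(𝕏, ℝ) => f y) (continuous_eval_const y).aestronglyMeasurable
    simp only [Measure.map_fst_prod, measure_univ, one_smul] at h
    exact h.symm
  have hsnd : ∫ p : C(𝕏, ℝ) × ℝ, p.2 ∂(withNoise ν) = 0 := by
    have h := integral_map (μ := withNoise ν) measurable_snd.aemeasurable
      (f := fun u : ℝ => u) (by fun_prop)
    simp only [Measure.map_snd_prod, measure_univ, one_smul] at h
    rw [← h]; exact integral_id_gaussianReal
  have h1 : mean ν' = fun y => mean ν y + cov ν y x / obsVar τ ν x * (z - mean ν x) := by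
    ext y
    rw [mean, hν', integral_map hm2.aemeasurable
      (continuous_eval_const y).aestronglyMeasurable]
    simp only [ContinuousMap.add_apply, ContinuousMap.smul_apply, smul_eq_mul]
    have hfst := (memLp_fst_withNoise ν x).integrable (by norm_num)
    have hfsty := (memLp_fst_withNoise ν y).integrable (by norm_num)
    have hsndi := (memLp_snd_withNoise ν).integrable (by norm_num)
    have ho : Integrable (noisyObs τ x) (withNoise ν) :=
      (memLp_dual_withNoise ν (noisyObs τ x)).integrable (by norm_num)
    have hoi : ∫ p, noisyObs τ x p ∂(withNoise ν) = mean ν x := by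
      simp_rw [noisyObs_apply]
      rw [integral_add hfst (hsndi.mul_const _), integral_mul_const, hsnd, hmean]
      ring
    rw [integral_add (hint y) (integrable_const _), residual_eval_eq,
      integral_sub' hfsty (ho.const_mul _), integral_const_mul, hmean, hoi]
    simp [krigWeight]
    ring
  have h2 : cov ν' = fun y y' => cov ν y y' - cov ν y x * cov ν x y' / obsVar τ ν x := by
    ext y y'
    rw [cov, hν', covariance_map (continuous_eval_const y).aestronglyMeasurable
      (continuous_eval_const y').aestronglyMeasurable hm2.aemeasurable]
    simp only [Function.comp_def, ContinuousMap.add_apply]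
    rw [covariance_add_const_left (hint y), covariance_add_const_right (hint y'),
      covariance_residual]
  have h : cond τ x z ν = ν' := gp_eq h1 h2
  rw [h]
  exact ⟨h1, h2, rfl⟩

/-- Conditioning on the value `z` of the noisy observation replaces the observation by `z` in the
regression of `f` on it. -/
theorem cond_val (τ : C(𝕏, ℝ≥0)) (x : 𝕏) (z : ℝ) (ν : GaussMeas 𝕏) :
    (cond τ x z ν).1 = (withNoise ν).map fun p => residual τ ν x p + z • krigWeight τ ν x :=
  (cond_spec τ x z ν).2.2

theorem cond_eq_self {τ : C(𝕏, ℝ≥0)} {x : 𝕏} {ν : GaussMeas 𝕏} (h : obsVar τ ν x = 0) (z : ℝ) :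
    cond τ x z ν = ν :=
  gp_eq (by ext y; simp [h]) (by ext y y'; simp [h])

/-- Disintegration of the joint law of `f` and of its noisy observation at `x`: the conditional
law of `f` given the observation is `Cond_{x, z}(ν)`. -/
theorem lintegral_cond (τ : C(𝕏, ℝ≥0)) (x : 𝕏) (ν : GaussMeas 𝕏) {F : C(𝕏, ℝ) × ℝ → ℝ≥0∞}
    (hF : Measurable F) :
    ∫⁻ p, F (p.1, noisyObs τ x p) ∂withNoise ν
      = ∫⁻ p, ∫⁻ g, F (g, noisyObs τ x p) ∂(cond τ x (noisyObs τ x p) ν).1 ∂withNoise ν := by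
  have hR : Measurable (residual τ ν x) := (residual τ ν x).continuous.measurable
  have hZ : Measurable (noisyObs τ x) := (noisyObs τ x).continuous.measurable
  have hind := (indepFun_iff_map_prod_eq_prod_map_map hR.aemeasurable hZ.aemeasurable).1
    (indepFun_residual_noisyObs τ ν x)
  have hΦ : Measurable fun q : C(𝕏, ℝ) × ℝ => F (q.1 + q.2 • krigWeight τ ν x, q.2) := by
    fun_prop
  calc ∫⁻ p, F (p.1, noisyObs τ x p) ∂withNoise ν
      = ∫⁻ p, (fun q : C(𝕏, ℝ) × ℝ => F (q.1 + q.2 • krigWeight τ ν x, q.2))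
          (residual τ ν x p, noisyObs τ x p) ∂withNoise ν := by
        simp only [residual_add]
    _ = ∫⁻ q, F (q.1 + q.2 • krigWeight τ ν x, q.2)
          ∂((withNoise ν).map (residual τ ν x)).prod ((withNoise ν).map (noisyObs τ x)) := by
        rw [← hind, lintegral_map hΦ (hR.prodMk hZ)]
    _ = ∫⁻ z, ∫⁻ p, F (residual τ ν x p + z • krigWeight τ ν x, z) ∂withNoise ν
          ∂((withNoise ν).map (noisyObs τ x)) := by
        have := Measure.isProbabilityMeasure_map (μ := withNoise ν) hR.aemeasurable
        rw [lintegral_prod_symm' _ hΦ]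
        refine lintegral_congr fun z => ?_
        rw [lintegral_map (by fun_prop) hR]
    _ = _ := by
        rw [lintegral_map _ hZ]
        · refine lintegral_congr fun p => ?_
          rw [cond_val, lintegral_map (by fun_prop) (by fun_prop)]
        · exact Measurable.lintegral_prod_left' (f := fun q : (C(𝕏, ℝ) × ℝ) × ℝ =>
            F (residual τ ν x q.1 + q.2 • krigWeight τ ν x, q.2)) (by fun_prop)

/-! ### Measurability in the Gaussian measure -/

/-- The tautological kernel from the space of Gaussian measures to `C(𝕏, ℝ)`. -/
noncomputable def gaussKernel : Kernel (GaussMeas 𝕏) C(𝕏, ℝ) :=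
  ⟨Subtype.val, measurable_subtype_coe⟩

theorem gaussKernel_apply (ν : GaussMeas 𝕏) : gaussKernel ν = ν.1 := rfl

instance : IsMarkovKernel (gaussKernel (𝕏 := 𝕏)) :=
  ⟨fun ν => inferInstanceAs (IsProbabilityMeasure ν.1)⟩

variable [MeasurableSpace 𝕏] [BorelSpace 𝕏]

theorem measurable_mean : Measurable fun p : GaussMeas 𝕏 × 𝕏 => mean p.1 p.2 := by
  have h : StronglyMeasurable fun q : (GaussMeas 𝕏 × 𝕏) × C(𝕏, ℝ) => q.2 q.1.2 :=
    (measurable_eval_prod.comp (measurable_snd.prodMk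
      (measurable_snd.comp measurable_fst))).stronglyMeasurable
  exact (h.integral_kernel_prod_right'
    (κ := gaussKernel.comap Prod.fst measurable_fst)).measurable

theorem measurable_cov : Measurable fun p : GaussMeas 𝕏 × 𝕏 × 𝕏 => cov p.1 p.2.1 p.2.2 := by
  simp_rw [cov_eq]
  have h : StronglyMeasurable fun q : (GaussMeas 𝕏 × 𝕏 × 𝕏) × C(𝕏, ℝ) =>
      q.2 q.1.2.1 * q.2 q.1.2.2 :=
    ((measurable_eval_prod.comp (measurable_snd.prodMk (by fun_prop))).mul
      (measurable_eval_prod.comp (measurable_snd.prodMk (by fun_prop)))).stronglyMeasurable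
  have h2 := (h.integral_kernel_prod_right'
    (κ := gaussKernel.comap Prod.fst measurable_fst)).measurable
  exact h2.sub ((measurable_mean.comp (by fun_prop : Measurable fun p : GaussMeas 𝕏 × 𝕏 × 𝕏 =>
    (p.1, p.2.1))).mul (measurable_mean.comp
      (by fun_prop : Measurable fun p : GaussMeas 𝕏 × 𝕏 × 𝕏 => (p.1, p.2.2))))

theorem measurable_noisyObs (τ : C(𝕏, ℝ≥0)) :
    Measurable fun q : 𝕏 × C(𝕏, ℝ) × ℝ => noisyObs τ q.1 q.2 := by
  simp_rw [noisyObs_apply]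
  have hτ : Measurable fun x : 𝕏 => (τ x : ℝ) :=
    (NNReal.continuous_coe.comp τ.continuous).measurable
  exact (measurable_eval_prod.comp (by fun_prop : Measurable fun q : 𝕏 × C(𝕏, ℝ) × ℝ =>
    (q.2.1, q.1))).add ((by fun_prop : Measurable fun q : 𝕏 × C(𝕏, ℝ) × ℝ => q.2.2).mul
      (hτ.comp measurable_fst))

theorem measurable_krigWeight (τ : C(𝕏, ℝ≥0)) :
    Measurable fun q : 𝕏 × GaussMeas 𝕏 => krigWeight τ q.2 q.1 := by
  refine measurable_of_measurable_eval fun y => ?_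
  have hτ : Measurable fun x : 𝕏 => (τ x : ℝ) :=
    (NNReal.continuous_coe.comp τ.continuous).measurable
  exact (measurable_cov.comp (by fun_prop : Measurable fun q : 𝕏 × GaussMeas 𝕏 =>
    (q.2, y, q.1))).div ((measurable_cov.comp (by fun_prop : Measurable fun q : 𝕏 × GaussMeas 𝕏 =>
    (q.2, q.1, q.1))).add ((hτ.comp measurable_fst).pow_const 2))

theorem measurable_cond (τ : C(𝕏, ℝ≥0)) :
    Measurable fun q : 𝕏 × ℝ × GaussMeas 𝕏 => cond τ q.1 q.2.1 q.2.2 := by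
  refine Measurable.subtype_mk (f := fun q : 𝕏 × ℝ × GaussMeas 𝕏 => (cond τ q.1 q.2.1 q.2.2).1) ?_
  refine Measure.measurable_of_measurable_coe _ fun A hA => ?_
  have hw : Measurable fun r : (𝕏 × ℝ × GaussMeas 𝕏) × C(𝕏, ℝ) × ℝ =>
      krigWeight τ r.1.2.2 r.1.1 :=
    (measurable_krigWeight τ).comp (f := fun r : (𝕏 × ℝ × GaussMeas 𝕏) × C(𝕏, ℝ) × ℝ =>
      (r.1.1, r.1.2.2)) (by fun_prop)
  have ho : Measurable fun r : (𝕏 × ℝ × GaussMeas 𝕏) × C(𝕏, ℝ) × ℝ => noisyObs τ r.1.1 r.2 :=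
    (measurable_noisyObs τ).comp (f := fun r : (𝕏 × ℝ × GaussMeas 𝕏) × C(𝕏, ℝ) × ℝ =>
      (r.1.1, r.2)) (by fun_prop)
  have hT : Measurable fun r : (𝕏 × ℝ × GaussMeas 𝕏) × C(𝕏, ℝ) × ℝ =>
      residual τ r.1.2.2 r.1.1 r.2 + r.1.2.1 • krigWeight τ r.1.2.2 r.1.1 := by
    simp_rw [residual_apply]
    exact (by fun_prop : Measurable fun r : (𝕏 × ℝ × GaussMeas 𝕏) × C(𝕏, ℝ) × ℝ => r.2.1).sub
      (ho.smul hw) |>.add ((by fun_prop : Measurable fun r :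
        (𝕏 × ℝ × GaussMeas 𝕏) × C(𝕏, ℝ) × ℝ => r.1.2.1).smul hw)
  have hval : ∀ q : 𝕏 × ℝ × GaussMeas 𝕏, (cond τ q.1 q.2.1 q.2.2).1 A
      = ∫⁻ p, A.indicator 1 (residual τ q.2.2 q.1 p + q.2.1 • krigWeight τ q.2.2 q.1)
        ∂withNoise q.2.2 := by
    intro q
    rw [← lintegral_indicator_one hA, cond_val, lintegral_map (measurable_one.indicator hA)]
    exact hT.comp (f := fun p => (q, p)) (by fun_prop)
  simp_rw [hval]
  have h := Measurable.lintegral_kernel_prod_right'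
    (κ := (gaussKernel.comap (fun q : 𝕏 × ℝ × GaussMeas 𝕏 => q.2.2) (by fun_prop)) ×ₖ
      Kernel.const _ (gaussianReal 0 1))
    ((measurable_one.indicator hA).comp hT)
  simpa only [Kernel.prod_apply, Kernel.const_apply, Kernel.comap_apply, gaussKernel_apply,
    Function.comp_apply] using h

end OneStep

/-! ### Conditional laws -/

section CondLaw

variable {𝕏 : Type u} [MetricSpace 𝕏] [CompactSpace 𝕏]
variable {Ω : Type w} [mΩ : MeasurableSpace Ω] {P : Measure Ω} [IsProbabilityMeasure P]
variable {E : Type*} [MeasurableSpace E]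

/-- A Gaussian conditional law given the σ-algebra of a random element `Y` disintegrates the joint
law of `Y` and `ξ`. -/
theorem IsCondLaw.map_prodMk {ξ : Ω → C(𝕏, ℝ)} (hξ : Measurable ξ) {Y : Ω → E}
    (hY : Measurable Y) {ν : E → GaussMeas 𝕏} (hν : Measurable ν)
    (h : IsCondLaw (MeasurableSpace.comap Y inferInstance) P ξ (fun ω => ν (Y ω))) :
    P.map (fun ω => (Y ω, ξ ω)) = P.map Y ⊗ₘ gaussKernel.comap ν hν := by
  have := Measure.isProbabilityMeasure_map (μ := P) hY.aemeasurable
  rw [← compProd_map_condDistrib hξ.aemeasurable]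
  refine Measure.ext_prod fun {B A} hB hA => ?_
  rw [Measure.compProd_apply_prod hB hA, Measure.compProd_apply_prod hB hA,
    setLIntegral_map hB (Kernel.measurable_coe _ hA) hY,
    setLIntegral_map hB (Kernel.measurable_coe _ hA) hY]
  refine setLIntegral_congr_fun_ae (hY hB) ?_
  filter_upwards [h.ae_eq A hA, condDistrib_ae_eq_condExp (μ := P) hY hξ hA] with ω h1 h2 _
  rw [← h2] at h1
  exact ((ENNReal.toReal_eq_toReal_iff' (measure_ne_top _ _) (measure_ne_top _ _)).1 h1).symm

theorem IsCondLaw.lintegral_comp {ξ : Ω → C(𝕏, ℝ)} (hξ : Measurable ξ) {Y : Ω → E}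
    (hY : Measurable Y) {ν : E → GaussMeas 𝕏} (hν : Measurable ν)
    (h : IsCondLaw (MeasurableSpace.comap Y inferInstance) P ξ (fun ω => ν (Y ω)))
    {F : E × C(𝕏, ℝ) → ℝ≥0∞} (hF : Measurable F) :
    ∫⁻ ω, F (Y ω, ξ ω) ∂P = ∫⁻ ω, ∫⁻ f, F (Y ω, f) ∂(ν (Y ω)).1 ∂P := by
  rw [← lintegral_map (f := F) hF (hY.prodMk hξ), h.map_prodMk hξ hY hν,
    Measure.lintegral_compProd hF, lintegral_map _ hY]
  · rfl
  · exact hF.lintegral_kernel_prod_right'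

/-- Given a Gaussian conditional law of `ξ` given `Y`, and standard normal noise `U` independent of
`(Y, ξ)`, the conditional law of `(ξ, U)` given `Y`. -/
theorem IsCondLaw.lintegral_withNoise_comp {ξ : Ω → C(𝕏, ℝ)} (hξ : Measurable ξ) {Y : Ω → E}
    (hY : Measurable Y) {ν : E → GaussMeas 𝕏} (hν : Measurable ν)
    (h : IsCondLaw (MeasurableSpace.comap Y inferInstance) P ξ (fun ω => ν (Y ω)))
    {U : Ω → ℝ} (hU : Measurable U) (hUl : P.map U = gaussianReal 0 1)
    (hind : IndepFun (fun ω => (Y ω, ξ ω)) U P)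
    {F : E × C(𝕏, ℝ) × ℝ → ℝ≥0∞} (hF : Measurable F) :
    ∫⁻ ω, F (Y ω, ξ ω, U ω) ∂P = ∫⁻ ω, ∫⁻ p, F (Y ω, p) ∂withNoise (ν (Y ω)) ∂P := by
  have hYξ := hY.prodMk hξ
  have hG : Measurable fun q : (E × C(𝕏, ℝ)) × ℝ => F (q.1.1, q.1.2, q.2) := by fun_prop
  have hmap := (indepFun_iff_map_prod_eq_prod_map_map hYξ.aemeasurable hU.aemeasurable).1 hind
  have := Measure.isProbabilityMeasure_map (μ := P) hYξ.aemeasurable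
  calc ∫⁻ ω, F (Y ω, ξ ω, U ω) ∂P
      = ∫⁻ q, F (q.1.1, q.1.2, q.2) ∂P.map (fun ω => ((Y ω, ξ ω), U ω)) := by
        rw [lintegral_map hG (hYξ.prodMk hU)]
    _ = ∫⁻ ω, ∫⁻ u, F (Y ω, ξ ω, u) ∂gaussianReal 0 1 ∂P := by
        rw [hmap, hUl, lintegral_prod _ hG.aemeasurable, lintegral_map _ hYξ]
        exact hG.lintegral_prod_right'
    _ = ∫⁻ ω, ∫⁻ f, ∫⁻ u, F (Y ω, f, u) ∂gaussianReal 0 1 ∂(ν (Y ω)).1 ∂P :=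
        h.lintegral_comp hξ hY hν (F := fun q => ∫⁻ u, F (q.1, q.2, u) ∂gaussianReal 0 1)
          hG.lintegral_prod_right'
    _ = _ := by
        refine lintegral_congr fun ω => ?_
        rw [lintegral_prod]
        exact (hF.comp (by fun_prop : Measurable fun p : C(𝕏, ℝ) × ℝ => (Y ω, p))).aemeasurable

/-- Conditional laws are characterized by their integrals over the events of the conditioning
σ-algebra. -/
theorem isCondLaw_of_measure_inter {Ω : Type w} {m' : MeasurableSpace Ω} [mΩ : MeasurableSpace Ω]
    {P : Measure Ω} [IsProbabilityMeasure P] {ξ : Ω → C(𝕏, ℝ)} (hξ : Measurable ξ) (hm : m' ≤ mΩ)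
    {ν : Ω → GaussMeas 𝕏} (hν : Measurable[m'] ν)
    (h : ∀ S, MeasurableSet[m'] S → ∀ A, MeasurableSet A →
      P (S ∩ ξ ⁻¹' A) = ∫⁻ ω in S, (ν ω).1 A ∂P) : IsCondLaw m' P ξ ν := by
  refine ⟨hm, hν, fun A hA => ?_⟩
  have hνA : Measurable[m'] fun ω => (ν ω).1 A :=
    (Measure.measurable_coe hA).comp (measurable_subtype_coe.comp hν)
  have hint : Integrable (fun ω => (ν ω).1.real A) P := by
    refine Integrable.of_bound (C := 1) ?_ (Eventually.of_forall fun ω => ?_)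
    · exact (hνA.mono hm le_rfl).ennreal_toReal.aestronglyMeasurable
    · rw [Real.norm_of_nonneg measureReal_nonneg]; exact measureReal_le_one
  refine ae_eq_condExp_of_forall_setIntegral_eq hm ((integrable_const _).indicator (hξ hA))
    (fun S _ _ => hint.integrableOn) (fun S hS _ => ?_) ?_
  · have hS' := hm S hS
    rw [setIntegral_indicator (hξ hA), setIntegral_const, smul_eq_mul, mul_one,
      measureReal_def, h S hS A hA]
    simp only [measureReal_def]
    rw [integral_toReal (hνA.mono hm le_rfl).aemeasurable
      (Eventually.of_forall fun ω => measure_lt_top _ _)]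
  · exact hνA.ennreal_toReal.stronglyMeasurable.aestronglyMeasurable

theorem IsCondLaw.condDistrib_comp_ae_eq {ξ : Ω → C(𝕏, ℝ)} (hξ : Measurable ξ) {Y : Ω → E}
    (hY : Measurable Y) {ν : E → GaussMeas 𝕏} (hν : Measurable ν)
    (h : IsCondLaw (MeasurableSpace.comap Y inferInstance) P ξ (fun ω => ν (Y ω))) :
    ∀ᵐ ω ∂P, condDistrib ξ Y P (Y ω) = (ν (Y ω)).1 :=
  ae_of_ae_map hY.aemeasurable (condDistrib_ae_eq_of_measure_eq_compProd Y hξ.aemeasurable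
    (h.map_prodMk hξ hY hν))

variable [MeasurableSpace 𝕏] [BorelSpace 𝕏]

theorem measurable_cond_comp (τ : C(𝕏, ℝ≥0)) {x : E → 𝕏} (hx : Measurable x) {ν : E → GaussMeas 𝕏}
    (hν : Measurable ν) : Measurable fun q : E × C(𝕏, ℝ) × ℝ =>
      cond τ (x q.1) (noisyObs τ (x q.1) q.2) (ν q.1) :=
  (measurable_cond τ).comp (f := fun q : E × C(𝕏, ℝ) × ℝ =>
    (x q.1, noisyObs τ (x q.1) q.2, ν q.1)) ((hx.comp measurable_fst).prodMk
      (((measurable_noisyObs τ).comp (f := fun q : E × C(𝕏, ℝ) × ℝ => (x q.1, q.2))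
        (by fun_prop)).prodMk (hν.comp measurable_fst)))

/-- One more observation, at a point chosen as a function of `Y`, updates the conditional law of `ξ`
given `Y` by `Cond`. -/
theorem IsCondLaw.cond_comp {ξ : Ω → C(𝕏, ℝ)} (hξ : Measurable ξ) {Y : Ω → E}
    (hY : Measurable Y) {ν : E → GaussMeas 𝕏} (hν : Measurable ν)
    (h : IsCondLaw (MeasurableSpace.comap Y inferInstance) P ξ (fun ω => ν (Y ω)))
    {U : Ω → ℝ} (hU : Measurable U) (hUl : P.map U = gaussianReal 0 1)
    (hind : IndepFun (fun ω => (Y ω, ξ ω)) U P) (τ : C(𝕏, ℝ≥0)) {x : E → 𝕏} (hx : Measurable x)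
    {Z : Ω → ℝ} (hZe : ∀ ω, Z ω = noisyObs τ (x (Y ω)) (ξ ω, U ω)) :
    IsCondLaw (MeasurableSpace.comap Y inferInstance ⊔
        MeasurableSpace.comap Z inferInstance) P ξ
      (fun ω => cond τ (x (Y ω)) (Z ω) (ν (Y ω))) := by
  have hobs : Measurable fun q : E × C(𝕏, ℝ) × ℝ => noisyObs τ (x q.1) q.2 :=
    (measurable_noisyObs τ).comp (f := fun q : E × C(𝕏, ℝ) × ℝ => (x q.1, q.2)) (by fun_prop)
  have hZ : Measurable Z := by
    have hZ' : Z = (fun q : E × C(𝕏, ℝ) × ℝ => noisyObs τ (x q.1) q.2) ∘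
        fun ω => (Y ω, ξ ω, U ω) := funext hZe
    rw [hZ']
    exact hobs.comp (hY.prodMk (hξ.prodMk hU))
  have hc : Measurable fun q : E × ℝ => cond τ (x q.1) q.2 (ν q.1) :=
    (measurable_cond τ).comp (f := fun q : E × ℝ => (x q.1, q.2, ν q.1)) (by fun_prop)
  have hYZ : Measurable fun ω => (Y ω, Z ω) := hY.prodMk hZ
  rw [← MeasurableSpace.comap_prodMk Y Z]
  refine isCondLaw_of_measure_inter hξ hYZ.comap_le
    (hc.comp (f := fun ω => (Y ω, Z ω)) (comap_measurable _)) ?_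
  rintro S ⟨T, hT, hST⟩ A hA
  rw [← hST]
  have hcA : Measurable fun q : E × ℝ => (cond τ (x q.1) q.2 (ν q.1)).1 A :=
    (Measure.measurable_coe hA).comp (measurable_subtype_coe.comp hc)
  have hF : Measurable fun q : E × ℝ × C(𝕏, ℝ) =>
      T.indicator (1 : E × ℝ → ℝ≥0∞) (q.1, q.2.1) * A.indicator (1 : C(𝕏, ℝ) → ℝ≥0∞) q.2.2 :=
    ((measurable_one.indicator hT).comp (by fun_prop)).mul
      ((measurable_one.indicator hA).comp (by fun_prop))
  calc P ((fun ω => (Y ω, Z ω)) ⁻¹' T ∩ ξ ⁻¹' A)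
      = ∫⁻ ω, T.indicator 1 (Y ω, Z ω) * A.indicator 1 (ξ ω) ∂P := by
        rw [← lintegral_indicator_one ((hY.prodMk hZ hT).inter (hξ hA))]
        refine lintegral_congr fun ω => ?_
        rw [Set.inter_indicator_one]
        rfl
    _ = ∫⁻ ω, ∫⁻ p, T.indicator 1 (Y ω, noisyObs τ (x (Y ω)) p) * A.indicator 1 p.1
          ∂withNoise (ν (Y ω)) ∂P := by
        simp_rw [hZe]
        exact h.lintegral_withNoise_comp hξ hY hν hU hUl hind
          (F := fun q => T.indicator 1 (q.1, noisyObs τ (x q.1) q.2) * A.indicator 1 q.2.1)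
          (hF.comp (f := fun q : E × C(𝕏, ℝ) × ℝ => (q.1, noisyObs τ (x q.1) q.2, q.2.1))
            (by fun_prop))
    _ = ∫⁻ ω, ∫⁻ p, T.indicator 1 (Y ω, noisyObs τ (x (Y ω)) p) *
          (cond τ (x (Y ω)) (noisyObs τ (x (Y ω)) p) (ν (Y ω))).1 A
          ∂withNoise (ν (Y ω)) ∂P := by
        refine lintegral_congr fun ω => ?_
        rw [lintegral_cond τ (x (Y ω)) (ν (Y ω)) (F := fun r =>
          T.indicator 1 (Y ω, r.2) * A.indicator 1 r.1) (hF.comp (f := fun r : C(𝕏, ℝ) × ℝ =>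
            (Y ω, r.2, r.1)) (by fun_prop))]
        refine lintegral_congr fun p => ?_
        dsimp only
        rw [lintegral_const_mul _ (measurable_one.indicator hA), lintegral_indicator_one hA]
    _ = ∫⁻ ω, T.indicator 1 (Y ω, Z ω) * (cond τ (x (Y ω)) (Z ω) (ν (Y ω))).1 A ∂P := by
        simp_rw [hZe]
        refine (h.lintegral_withNoise_comp hξ hY hν hU hUl hind
          (F := fun q => T.indicator 1 (q.1, noisyObs τ (x q.1) q.2) *
            (cond τ (x q.1) (noisyObs τ (x q.1) q.2) (ν q.1)).1 A) ?_).symm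
        exact ((measurable_one.indicator hT).mul hcA).comp
          (g := fun q : E × ℝ => T.indicator 1 q * (cond τ (x q.1) q.2 (ν q.1)).1 A)
          (f := fun q : E × C(𝕏, ℝ) × ℝ => (q.1, noisyObs τ (x q.1) q.2)) (by fun_prop)
    _ = ∫⁻ ω in (fun ω => (Y ω, Z ω)) ⁻¹' T, (cond τ (x (Y ω)) (Z ω) (ν (Y ω))).1 A ∂P := by
        rw [← lintegral_indicator (hY.prodMk hZ hT)]
        refine lintegral_congr fun ω => ?_
        by_cases hω : (Y ω, Z ω) ∈ T
        · simp [hω]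
        · simp [hω]

end CondLaw

section CondLawSigma

/-! An arbitrary sub-σ-algebra `m'` is generated by the identity, viewed as a map into `(Ω, m')`.
The explicit instance arguments below specialize the results on conditioning on a random element
to this case. -/

variable {𝕏 : Type u} [MetricSpace 𝕏] [CompactSpace 𝕏] {Ω : Type w} {m' : MeasurableSpace Ω}
  [mΩ : MeasurableSpace Ω] {P : Measure Ω} [IsProbabilityMeasure P]
  {ξ : Ω → C(𝕏, ℝ)} {ν : Ω → GaussMeas 𝕏}

theorem IsCondLaw.comap_id (h : IsCondLaw m' P ξ ν) :
    IsCondLaw (MeasurableSpace.comap (@id Ω) m') P ξ (fun ω => ν (id ω)) := by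
  rw [MeasurableSpace.comap_id]; exact h

theorem IsCondLaw.ae_eq_condDistrib (h : IsCondLaw m' P ξ ν) (hξ : Measurable ξ) :
    ∀ᵐ ω ∂P, @condDistrib Ω Ω C(𝕏, ℝ) _ _ _ mΩ m' ξ id P _ ω = (ν ω).1 :=
  @IsCondLaw.condDistrib_comp_ae_eq 𝕏 _ _ Ω mΩ P _ Ω m' ξ hξ id (measurable_id'' h.le) ν
    h.measurable h.comap_id

theorem condExp_comp_ae_eq_condDistrib (hm : m' ≤ mΩ) (hξ : Measurable ξ) {φ : C(𝕏, ℝ) → ℝ}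
    (hφ : Measurable φ) (hφi : Integrable (fun ω => φ (ξ ω)) P) :
    P[fun ω => φ (ξ ω) | m'] =ᵐ[P]
      fun ω => ∫ f, φ f ∂(@condDistrib Ω Ω C(𝕏, ℝ) _ _ _ mΩ m' ξ id P _ ω) := by
  have h := condExp_ae_eq_integral_condDistrib (mβ := m') (X := id) (measurable_id'' hm)
    hξ.aemeasurable hφ.stronglyMeasurable hφi
  rw [MeasurableSpace.comap_id] at h
  exact h

/-- Conditional expectations are integrals with respect to the conditional law. -/
theorem IsCondLaw.condExp_ae_eq (h : IsCondLaw m' P ξ ν) (hξ : Measurable ξ) {φ : C(𝕏, ℝ) → ℝ}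
    (hφ : Measurable φ) (hφi : Integrable (fun ω => φ (ξ ω)) P) :
    P[fun ω => φ (ξ ω) | m'] =ᵐ[P] fun ω => ∫ f, φ f ∂(ν ω).1 := by
  filter_upwards [condExp_comp_ae_eq_condDistrib h.le hξ hφ hφi, h.ae_eq_condDistrib hξ]
    with ω h1 h2
  rw [h1, h2]

theorem indepFun_prodMk_id_of_indep {U : Ω → ℝ}
    (hind : Indep (m' ⊔ MeasurableSpace.comap ξ inferInstance)
      (MeasurableSpace.comap U inferInstance) P) :
    @IndepFun Ω (Ω × C(𝕏, ℝ)) ℝ mΩ (@Prod.instMeasurableSpace _ _ m' _) _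
      (fun ω => (id ω, ξ ω)) U P := by
  have hc : MeasurableSpace.comap (fun ω => (id ω, ξ ω)) (m'.prod inferInstance) =
      m' ⊔ MeasurableSpace.comap ξ inferInstance := by
    rw [@MeasurableSpace.comap_prodMk Ω Ω C(𝕏, ℝ) m' _ id ξ, MeasurableSpace.comap_id]
  refine (@IndepFun_iff_Indep Ω (Ω × C(𝕏, ℝ)) ℝ mΩ (m'.prod inferInstance) _ _ _ _).2 ?_
  rw [hc]
  exact hind

variable [MeasurableSpace 𝕏] [BorelSpace 𝕏]

/-- One more observation, at a point chosen on the basis of the past `m'`, updates the conditional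
law of `ξ` by `Cond`. -/
theorem IsCondLaw.cond (h : IsCondLaw m' P ξ ν) (hξ : Measurable ξ) {U : Ω → ℝ}
    (hU : Measurable U) (hUl : P.map U = gaussianReal 0 1)
    (hind : Indep (m' ⊔ MeasurableSpace.comap ξ inferInstance)
      (MeasurableSpace.comap U inferInstance) P)
    (τ : C(𝕏, ℝ≥0)) {x : Ω → 𝕏} (hx : Measurable[m'] x)
    {Z : Ω → ℝ} (hZ : ∀ ω, Z ω = noisyObs τ (x ω) (ξ ω, U ω)) :
    IsCondLaw (m' ⊔ MeasurableSpace.comap Z inferInstance) P ξ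
      (fun ω => SUR.cond τ (x ω) (Z ω) (ν ω)) := by
  have h2 := @IsCondLaw.cond_comp 𝕏 _ _ Ω mΩ P _ Ω m' _ _ ξ hξ id (measurable_id'' h.le) ν
    h.measurable h.comap_id U hU hUl (indepFun_prodMk_id_of_indep hind) τ x hx Z hZ
  rw [MeasurableSpace.comap_id] at h2
  exact h2

/-- The expectation of a functional of the updated conditional law, by conditioning on the past. -/
theorem IsCondLaw.lintegral_cond_eq (h : IsCondLaw m' P ξ ν) (hξ : Measurable ξ) {U : Ω → ℝ}
    (hU : Measurable U) (hUl : P.map U = gaussianReal 0 1)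
    (hind : Indep (m' ⊔ MeasurableSpace.comap ξ inferInstance)
      (MeasurableSpace.comap U inferInstance) P)
    (τ : C(𝕏, ℝ≥0)) {x : Ω → 𝕏} (hx : Measurable[m'] x)
    {Z : Ω → ℝ} (hZ : ∀ ω, Z ω = noisyObs τ (x ω) (ξ ω, U ω)) {G : GaussMeas 𝕏 → ℝ≥0∞}
    (hG : Measurable G) :
    ∫⁻ ω, G (SUR.cond τ (x ω) (Z ω) (ν ω)) ∂P
      = ∫⁻ ω, ∫⁻ p, G (SUR.cond τ (x ω) (noisyObs τ (x ω) p) (ν ω)) ∂withNoise (ν ω) ∂P := by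
  have hF := hG.comp (@measurable_cond_comp 𝕏 _ _ Ω m' _ _ τ x hx ν h.measurable)
  have h2 := @IsCondLaw.lintegral_withNoise_comp 𝕏 _ _ Ω mΩ P _ Ω m' ξ hξ id
    (measurable_id'' h.le) ν h.measurable h.comap_id U hU hUl
    (indepFun_prodMk_id_of_indep hind) _ hF
  simp_rw [hZ]
  exact h2

end CondLawSigma

/-! ### Posterior distributions are conditional laws -/

theorem IndepFun.prodMk_left_of_prodMk_right {Ω α β γ : Type*} [MeasurableSpace Ω]
    [MeasurableSpace α] [MeasurableSpace β] [MeasurableSpace γ] {P : Measure Ω}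
    [IsProbabilityMeasure P] {X : Ω → α} {Y : Ω → β} {Z : Ω → γ} (hX : Measurable X)
    (hY : Measurable Y) (hZ : Measurable Z) (h : IndepFun X (fun ω => (Y ω, Z ω)) P)
    (hYZ : IndepFun Y Z P) : IndepFun (fun ω => (X ω, Y ω)) Z P := by
  have hXY : IndepFun X Y P := h.comp measurable_id measurable_fst
  have h1 := Measure.isProbabilityMeasure_map (μ := P) (hX.prodMk hY).aemeasurable
  have h2 := Measure.isProbabilityMeasure_map (μ := P) hZ.aemeasurable
  rw [indepFun_iff_map_prod_eq_prod_map_map (hX.prodMk hY).aemeasurable hZ.aemeasurable]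
  have h3 := Measure.isProbabilityMeasure_map (μ := P) ((hX.prodMk hY).prodMk hZ).aemeasurable
  refine Measure.ext_prod₃' fun {s t u} hs ht hu => ?_
  rw [Measure.map_apply ((hX.prodMk hY).prodMk hZ) ((hs.prod ht).prod hu), Measure.prod_prod,
    Measure.map_apply (hX.prodMk hY) (hs.prod ht), Measure.map_apply hZ hu]
  have e1 : (fun ω => ((X ω, Y ω), Z ω)) ⁻¹' ((s ×ˢ t) ×ˢ u)
      = X ⁻¹' s ∩ (fun ω => (Y ω, Z ω)) ⁻¹' (t ×ˢ u) := by
    ext ω; simp [and_assoc]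
  have e2 : (fun ω => (Y ω, Z ω)) ⁻¹' (t ×ˢ u) = Y ⁻¹' t ∩ Z ⁻¹' u := rfl
  have e3 : (fun ω => (X ω, Y ω)) ⁻¹' (s ×ˢ t) = X ⁻¹' s ∩ Y ⁻¹' t := rfl
  rw [e1, h.measure_inter_preimage_eq_mul _ _ hs (ht.prod hu), e2,
    hYZ.measure_inter_preimage_eq_mul _ _ ht hu, e3, hXY.measure_inter_preimage_eq_mul _ _ hs ht,
    mul_assoc]

theorem isCondLaw_bot {Ω : Type w} [MeasurableSpace Ω] {P : Measure Ω} [IsProbabilityMeasure P]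
    {𝕏 : Type u} [MetricSpace 𝕏] [CompactSpace 𝕏]
    {ξ : Ω → C(𝕏, ℝ)} (hξ : Measurable ξ) {ν : GaussMeas 𝕏} (h : P.map ξ = ν.1) :
    IsCondLaw ⊥ P ξ (fun _ => ν) := by
  refine isCondLaw_of_measure_inter hξ bot_le measurable_const fun S hS A hA => ?_
  have hA' : ν.1 A = P (ξ ⁻¹' A) := by rw [← h, Measure.map_apply hξ hA]
  rcases MeasurableSpace.measurableSet_bot_iff.1 hS with rfl | rfl <;> simp [hA']

namespace ObsModel

variable {𝕏 : Type u} [MetricSpace 𝕏] [CompactSpace 𝕏] [MeasurableSpace 𝕏] [BorelSpace 𝕏]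
  {Ω : Type w} [mΩ : MeasurableSpace Ω] {P : Measure Ω} [IsProbabilityMeasure P]

theorem measurable_path (M : ObsModel 𝕏 P) : Measurable M.ξ :=
  measurable_of_measurable_eval M.measurable_ξ

theorem isGaussian_map (M : ObsModel 𝕏 P) : IsGaussian (P.map M.ξ) := M.prior.2

theorem obs_eq_noisyObs (M : ObsModel 𝕏 P) (τ : C(𝕏, ℝ≥0)) (X : ℕ → Ω → 𝕏) (n : ℕ) (ω : Ω) :
    M.obs τ X n ω = noisyObs τ (X n ω) (M.ξ ω, M.U n ω) := by
  rw [obs, noisyObs_apply, mul_comm]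

/-- The design point `X n` is determined by the past, so only the observation adds information. -/
theorem obsSigma_succ (M : ObsModel 𝕏 P) (τ : C(𝕏, ℝ≥0)) {X : ℕ → Ω → 𝕏}
    (hX : M.IsSequentialDesign τ X) (n : ℕ) :
    M.obsSigma τ X (n + 1) =
      M.obsSigma τ X n ⊔ MeasurableSpace.comap (M.obs τ X n) inferInstance := by
  apply le_antisymm
  · refine iSup₂_le fun i hi => ?_
    rcases Nat.lt_succ_iff_lt_or_eq.1 hi with hi | rfl
    · exact le_sup_of_le_left (le_iSup₂_of_le i hi le_rfl)
    · exact sup_le (le_sup_of_le_left (hX i).comap_le) le_sup_right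
  · exact sup_le (M.obsSigma_mono τ X n.le_succ)
      (le_iSup₂_of_le n n.lt_succ_self le_sup_right)

/-- The path and the first `n` noise variables determine the first `n` observations. -/
theorem obsSigma_le_of_measurable {Ω : Type w} {𝒜 : MeasurableSpace Ω} [mΩ : MeasurableSpace Ω]
    {P : Measure Ω} [IsProbabilityMeasure P] (M : ObsModel 𝕏 P) {τ : C(𝕏, ℝ≥0)}
    {X : ℕ → Ω → 𝕏} (hX : M.IsSequentialDesign τ X) (hξ : Measurable[𝒜] M.ξ) {n : ℕ}
    (hU : ∀ i < n, Measurable[𝒜] (M.U i)) : M.obsSigma τ X n ≤ 𝒜 := by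
  induction n with
  | zero => exact iSup₂_le fun i hi => absurd hi (Nat.not_lt_zero i)
  | succ k ih =>
    have hle := ih fun i hi => hU i (hi.trans k.lt_succ_self)
    rw [obsSigma_succ M τ hX k]
    have hobs : Measurable[𝒜] (M.obs τ X k) := by
      have h := (measurable_noisyObs τ).comp
        (((hX k).mono hle le_rfl).prodMk (hξ.prodMk (hU k k.lt_succ_self)))
      rwa [show M.obs τ X k = _ from funext (M.obs_eq_noisyObs τ X k)]
    exact sup_le hle hobs.comap_le

/-- The noise of the next observation is independent of the path and of the past observations. -/
theorem indep_noise (M : ObsModel 𝕏 P) {τ : C(𝕏, ℝ≥0)} {X : ℕ → Ω → 𝕏}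
    (hX : M.IsSequentialDesign τ X) (n : ℕ) :
    Indep (M.obsSigma τ X n ⊔ MeasurableSpace.comap M.ξ inferInstance)
      (MeasurableSpace.comap (M.U n) inferInstance) P := by
  have hUm : Measurable fun ω (i : Finset.range n) => M.U i ω :=
    measurable_pi_lambda _ fun i => M.measurable_U i
  have hYZ : IndepFun (fun ω (i : Finset.range n) => M.U i ω) (M.U n) P := by
    have h := M.iIndep_U.indepFun_finset (Finset.range n) {n} (by simp) M.measurable_U
    exact h.comp measurable_id
      (measurable_pi_apply (X := fun _ : ({n} : Finset ℕ) => ℝ) ⟨n, Finset.mem_singleton_self n⟩)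
  have hX' : IndepFun M.ξ (fun ω => ((fun i : Finset.range n => M.U i ω), M.U n ω)) P :=
    M.indep.comp (ψ := fun g : ℕ → ℝ => ((fun i : Finset.range n => g i), g n)) measurable_id
      (by fun_prop)
  have h := IndepFun.prodMk_left_of_prodMk_right M.measurable_path hUm (M.measurable_U n) hX' hYZ
  rw [IndepFun_iff_Indep] at h
  have hpair := comap_measurable (m := inferInstance)
    (fun ω => (M.ξ ω, fun i : Finset.range n => M.U i ω))
  refine indep_of_indep_of_le_left h (sup_le (M.obsSigma_le_of_measurable hX
    (measurable_fst.comp hpair) fun i hi => ?_) (measurable_fst.comp hpair).comap_le)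
  exact (measurable_pi_apply (⟨i, Finset.mem_range.2 hi⟩ : Finset.range n)).comp
    (measurable_snd.comp hpair)

theorem isCondLaw_prior (M : ObsModel 𝕏 P) : IsCondLaw ⊥ P M.ξ (fun _ => M.prior) :=
  isCondLaw_bot M.measurable_path rfl

/-- The posterior distribution is the conditional law of the path given the observations. -/
theorem isCondLaw_posterior (M : ObsModel 𝕏 P) {τ : C(𝕏, ℝ≥0)} {X : ℕ → Ω → 𝕏}
    (hX : M.IsSequentialDesign τ X) (n : ℕ) :
    IsCondLaw (M.obsSigma τ X n) P M.ξ (M.posterior τ X n) := by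
  induction n with
  | zero =>
    have h : M.obsSigma τ X 0 = ⊥ := by simp [obsSigma]
    rw [h]
    exact M.isCondLaw_prior
  | succ n ih =>
    rw [M.obsSigma_succ τ hX n]
    exact ih.cond M.measurable_path (M.measurable_U n) (M.law_U n) (M.indep_noise hX n) τ (hX n)
      (M.obs_eq_noisyObs τ X n)

end ObsModel

/-! ### Lévy's upward theorem for conditional laws -/

section FiniteRank

variable (𝕏 : Type*) [MetricSpace 𝕏] [CompactSpace 𝕏]

/-- The identity of `C(𝕏, ℝ)` is a pointwise limit of uniformly bounded finite-rank operators which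
are combinations of evaluations. -/
theorem exists_finite_rank_operators :
    ∃ (s : ℕ → Finset 𝕏) (ρ : ℕ → 𝕏 → C(𝕏, ℝ)) (T : ℕ → C(𝕏, ℝ) →L[ℝ] C(𝕏, ℝ)) (C : ℝ),
      (∀ n f, T n f = ∑ x ∈ s n, f x • ρ n x) ∧ (∀ n f, ‖T n f‖ ≤ C * ‖f‖) ∧
      ∀ f, Tendsto (fun n => T n f) atTop (𝓝 f) := by
  obtain ⟨s, ρ, hρ⟩ := exists_finite_rank_approx 𝕏
  let T : ℕ → C(𝕏, ℝ) →L[ℝ] C(𝕏, ℝ) := fun n =>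
    ∑ x ∈ s n, (ContinuousMap.evalCLM ℝ x).smulRight (ρ n x)
  have hT : ∀ n f, T n f = ∑ x ∈ s n, f x • ρ n x := fun n f => by
    simp [T]
  obtain ⟨C, hC⟩ := banach_steinhaus (g := T) fun f => by
    obtain ⟨R, hR⟩ := ((hρ f).norm.bddAbove_range)
    exact ⟨R, fun n => hT n f ▸ hR ⟨n, rfl⟩⟩
  exact ⟨s, ρ, T, C, hT, fun n f => (T n).le_of_opNorm_le (hC n) f, fun f => by
    simpa only [hT] using hρ f⟩

end FiniteRank

section Levy

variable {𝕏 : Type u} [MetricSpace 𝕏] [CompactSpace 𝕏] {Ω : Type w}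
  [mΩ : MeasurableSpace Ω] {P : Measure Ω} [IsProbabilityMeasure P]
  {ξ : Ω → C(𝕏, ℝ)} {ν : ℕ → Ω → GaussMeas 𝕏} {ν' : Ω → GaussMeas 𝕏} {𝓕 : Filtration ℕ mΩ}

theorem iSup_filtration_le (𝓕 : Filtration ℕ mΩ) : ⨆ n, 𝓕 n ≤ mΩ := iSup_le fun n => 𝓕.le n

theorem tendsto_integral_condDistrib (hξ : Measurable ξ) (hν : ∀ n, IsCondLaw (𝓕 n) P ξ (ν n))
    {φ : C(𝕏, ℝ) → ℝ} (hφ : Measurable φ) (hφi : Integrable (fun ω => φ (ξ ω)) P) :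
    ∀ᵐ ω ∂P, Tendsto (fun n => ∫ f, φ f ∂(ν n ω).1) atTop
      (𝓝 (∫ f, φ f ∂(@condDistrib Ω Ω C(𝕏, ℝ) _ _ _ mΩ (⨆ n, 𝓕 n) ξ id P _ ω))) := by
  have h1 := tendsto_ae_condExp (μ := P) (ℱ := 𝓕) (fun ω => φ (ξ ω))
  have h2 := ae_all_iff.2 fun n => (hν n).condExp_ae_eq hξ hφ hφi
  filter_upwards [h1, h2, condExp_comp_ae_eq_condDistrib (iSup_filtration_le 𝓕) hξ hφ hφi]
    with ω h1 h2 h3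
  rw [← h3]
  exact h1.congr fun n => h2 n

theorem IsCondLaw.tendsto_integral (hξ : Measurable ξ) (hν : ∀ n, IsCondLaw (𝓕 n) P ξ (ν n))
    (hν' : IsCondLaw (⨆ n, 𝓕 n) P ξ ν')
    {φ : C(𝕏, ℝ) → ℝ} (hφ : Measurable φ) (hφi : Integrable (fun ω => φ (ξ ω)) P) :
    ∀ᵐ ω ∂P, Tendsto (fun n => ∫ f, φ f ∂(ν n ω).1) atTop (𝓝 (∫ f, φ f ∂(ν' ω).1)) := by
  filter_upwards [tendsto_integral_condDistrib hξ hν hφ hφi, hν'.ae_eq_condDistrib hξ] with ω h1 h2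
  rwa [← h2]

/-- Lévy's upward theorem for `C(𝕐, ℝ)`-valued functionals of the conditional laws. The error of the
finite-rank approximation is controlled by the scalar theorem, uniformly in time. -/
theorem IsCondLaw.tendsto_integral_continuousMap {𝕐 : Type*} [MetricSpace 𝕐] [CompactSpace 𝕐]
    (hξ : Measurable ξ) (hν : ∀ n, IsCondLaw (𝓕 n) P ξ (ν n)) (hν' : IsCondLaw (⨆ n, 𝓕 n) P ξ ν')
    {G : C(𝕏, ℝ) → C(𝕐, ℝ)} (hG : Measurable G) (hGξ : Integrable (fun ω => ‖G (ξ ω)‖) P)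
    (hGi : ∀ μ : GaussMeas 𝕏, Integrable G μ.1) :
    ∀ᵐ ω ∂P, Tendsto (fun n => ∫ f, G f ∂(ν n ω).1) atTop (𝓝 (∫ f, G f ∂(ν' ω).1)) := by
  obtain ⟨s, ρ, T, C, hT, hTC, hTlim⟩ := exists_finite_rank_operators 𝕐
  have hTm : ∀ j, Measurable fun f => T j (G f) := fun j => (T j).continuous.measurable.comp hG
  have hC : ∀ j f, ‖G f - T j (G f)‖ ≤ (1 + C) * ‖G f‖ := fun j f => by
    linarith [norm_sub_le (G f) (T j (G f)), hTC j (G f)]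
  have h1 : ∀ᵐ ω ∂P, ∀ j, ∀ x ∈ s j, Tendsto (fun n => ∫ f, G f x ∂(ν n ω).1) atTop
      (𝓝 (∫ f, G f x ∂(ν' ω).1)) := by
    refine ae_all_iff.2 fun j => (ae_ball_iff (s j).countable_toSet).2 fun x _ => ?_
    have hm : Measurable fun f => G f x := (continuous_eval_const x).measurable.comp hG
    exact IsCondLaw.tendsto_integral hξ hν hν' hm (hGξ.mono' (hm.comp hξ).aestronglyMeasurable
      (Eventually.of_forall fun ω => (G (ξ ω)).norm_coe_le_norm x))
  have h2 : ∀ᵐ ω ∂P, ∀ j, Tendsto (fun n => ∫ f, ‖G f - T j (G f)‖ ∂(ν n ω).1) atTop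
      (𝓝 (∫ f, ‖G f - T j (G f)‖ ∂(ν' ω).1)) := by
    refine ae_all_iff.2 fun j => ?_
    have hm : Measurable fun f => ‖G f - T j (G f)‖ := (hG.sub (hTm j)).norm
    refine IsCondLaw.tendsto_integral hξ hν hν' hm ((hGξ.const_mul (1 + C)).mono'
      (hm.comp hξ).aestronglyMeasurable (Eventually.of_forall fun ω => ?_))
    rw [norm_norm]
    exact hC j _
  filter_upwards [h1, h2] with ω h1 h2
  have hTi : ∀ (μ : GaussMeas 𝕏) j, ∫ f, T j (G f) ∂μ.1 = T j (∫ f, G f ∂μ.1) := fun μ j =>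
    (T j).integral_comp_comm (hGi μ)
  have hev : ∀ (μ : GaussMeas 𝕏) y, (∫ f, G f ∂μ.1) y = ∫ f, G f y ∂μ.1 := fun μ y =>
    ((ContinuousMap.evalCLM ℝ y).integral_comp_comm (hGi μ)).symm
  have herr : ∀ (μ : GaussMeas 𝕏) j, ‖(∫ f, G f ∂μ.1) - T j (∫ f, G f ∂μ.1)‖
      ≤ ∫ f, ‖G f - T j (G f)‖ ∂μ.1 := fun μ j => by
    rw [← hTi, ← integral_sub (hGi μ) ((T j).integrable_comp (hGi μ))]
    exact norm_integral_le_integral_norm _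
  have hr : Tendsto (fun j => ∫ f, ‖G f - T j (G f)‖ ∂(ν' ω).1) atTop (𝓝 0) := by
    rw [← integral_zero C(𝕏, ℝ) ℝ (μ := (ν' ω).1)]
    refine tendsto_integral_of_dominated_convergence (fun f => (1 + C) * ‖G f‖) (fun j => ?_)
      ((hGi _).norm.const_mul _) (fun j => Eventually.of_forall fun f => ?_)
      (Eventually.of_forall fun f => ?_)
    · exact (hG.sub (hTm j)).norm.aestronglyMeasurable
    · rw [norm_norm]; exact hC j f
    · have h := ((hTlim (G f)).const_sub (G f)).norm
      simpa using h
  rw [Metric.tendsto_atTop']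
  intro ε hε
  obtain ⟨j, hj⟩ := (hr.eventually (gt_mem_nhds (by positivity : (0 : ℝ) < ε / 3))).exists
  have h3 : Tendsto (fun n => T j (∫ f, G f ∂(ν n ω).1)) atTop
      (𝓝 (T j (∫ f, G f ∂(ν' ω).1))) := by
    simp_rw [hT, hev]
    exact tendsto_finsetSum _ fun x hx => (h1 j x hx).smul_const _
  obtain ⟨N, hN⟩ := eventually_atTop.1 (((h2 j).eventually (gt_mem_nhds hj)).and
    (Metric.tendsto_nhds.1 h3 (ε / 3) (by positivity)))
  refine ⟨N, fun n hn => ?_⟩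
  obtain ⟨h4, h5⟩ := hN n hn.le
  rw [dist_eq_norm] at h5 ⊢
  set a := ∫ f, G f ∂(ν n ω).1
  set b := ∫ f, G f ∂(ν' ω).1
  calc ‖a - b‖ = ‖(a - T j a) + (T j a - T j b) - (b - T j b)‖ := by congr 1; abel
    _ ≤ ‖a - T j a‖ + ‖T j a - T j b‖ + ‖b - T j b‖ :=
      (norm_sub_le _ _).trans (add_le_add_left (norm_add_le _ _) _)
    _ < ε / 3 + ε / 3 + ε / 3 := by
      linarith [herr (ν n ω) j, herr (ν' ω) j]
    _ = ε := by ring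

/-- The tensor square `(x, y) ↦ f x * f y` of `f`. -/
def tensorSquare (f : C(𝕏, ℝ)) : C(𝕏 × 𝕏, ℝ) :=
  f.comp ⟨Prod.fst, continuous_fst⟩ * f.comp ⟨Prod.snd, continuous_snd⟩

theorem tensorSquare_apply (f : C(𝕏, ℝ)) (p : 𝕏 × 𝕏) : tensorSquare f p = f p.1 * f p.2 := rfl

theorem continuous_tensorSquare : Continuous (tensorSquare (𝕏 := 𝕏)) :=
  (ContinuousMap.continuous_precomp _).mul (ContinuousMap.continuous_precomp _)

theorem norm_tensorSquare_le (f : C(𝕏, ℝ)) : ‖tensorSquare f‖ ≤ ‖f‖ ^ 2 := by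
  refine (ContinuousMap.norm_le _ (by positivity)).2 fun p => ?_
  rw [tensorSquare_apply, norm_mul, sq]
  exact mul_le_mul (f.norm_coe_le_norm _) (f.norm_coe_le_norm _) (norm_nonneg _) (norm_nonneg _)

theorem integrable_tensorSquare (μ : GaussMeas 𝕏) :
    Integrable (tensorSquare : C(𝕏, ℝ) → C(𝕏 × 𝕏, ℝ)) μ.1 :=
  (integrable_norm_sq μ).mono' continuous_tensorSquare.aestronglyMeasurable
    (Eventually.of_forall norm_tensorSquare_le)

theorem integrable_comp_path (hξ : Measurable ξ) (hg : IsGaussian (P.map ξ)) {φ : C(𝕏, ℝ) → ℝ}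
    (hφ : ∀ μ : GaussMeas 𝕏, Integrable φ μ.1) : Integrable (fun ω => φ (ξ ω)) P :=
  (hφ ⟨_, hg⟩).comp_measurable hξ

/-- Convergence of the Gaussian conditional laws along a filtration. -/
theorem IsCondLaw.gaussTendsto (hξ : Measurable ξ) (hg : IsGaussian (P.map ξ))
    (hν : ∀ n, IsCondLaw (𝓕 n) P ξ (ν n)) (hν' : IsCondLaw (⨆ n, 𝓕 n) P ξ ν') :
    ∀ᵐ ω ∂P, GaussTendsto (fun n => ν n ω) (ν' ω) := by
  have h1 := IsCondLaw.tendsto_integral_continuousMap hξ hν hν' measurable_id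
    (integrable_comp_path hξ hg integrable_norm) fun μ => IsGaussian.integrable_id (μ := μ.1)
  have h2 := IsCondLaw.tendsto_integral_continuousMap hξ hν hν'
    continuous_tensorSquare.measurable
    (integrable_comp_path hξ hg fun μ => (integrable_tensorSquare μ).norm) integrable_tensorSquare
  filter_upwards [h1, h2] with ω h1 h2
  have hm : ∀ (μ : GaussMeas 𝕏) x, mean μ x = (∫ f, f ∂μ.1) x := fun μ x => by
    have h : Integrable (fun f : C(𝕏, ℝ) => f) μ.1 := IsGaussian.integrable_id
    exact (ContinuousMap.evalCLM ℝ x).integral_comp_comm h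
  have hc : ∀ (μ : GaussMeas 𝕏) (p : 𝕏 × 𝕏),
      cov μ p.1 p.2 = ((∫ f, tensorSquare f ∂μ.1) - tensorSquare (∫ f, f ∂μ.1)) p := by
    intro μ p
    rw [cov_eq, ContinuousMap.sub_apply, tensorSquare_apply, ← hm, ← hm]
    congr 1
    exact (ContinuousMap.evalCLM ℝ p).integral_comp_comm (integrable_tensorSquare μ)
  constructor
  · simp_rw [funext (hm (ν' ω)), hm]
    exact ContinuousMap.tendsto_iff_tendstoUniformly.1 h1
  · simp_rw [hc]
    exact ContinuousMap.tendsto_iff_tendstoUniformly.1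
      (h2.sub ((continuous_tensorSquare.tendsto _).comp h1))

end Levy

/-! ### The limit conditional law is Gaussian -/

section GaussianLimit

variable {𝕏 : Type u} [MetricSpace 𝕏] [CompactSpace 𝕏]

/-- Continuous linear functionals on `C(𝕏, ℝ)` are pointwise limits of sequences from a countable
family: combinations with rational coefficients of evaluations at countably many points. -/
theorem exists_countable_dual_approx (𝕏 : Type u) [MetricSpace 𝕏] [CompactSpace 𝕏] :
    ∃ (ι : Type u) (_ : Countable ι) (Λ : ι → StrongDual ℝ C(𝕏, ℝ)),
      ∀ L : StrongDual ℝ C(𝕏, ℝ), ∃ i : ℕ → ι,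
        ∀ f, Tendsto (fun n => Λ (i n) f) atTop (𝓝 (L f)) := by
  obtain ⟨s, ρ, hρ⟩ := exists_finite_rank_approx 𝕏
  refine ⟨Σ n, (s n → ℚ), inferInstance,
    fun p => ∑ x : s p.1, (p.2 x : ℝ) • ContinuousMap.evalCLM ℝ (x : 𝕏), fun L => ?_⟩
  have hδ : ∀ n : ℕ, 0 < 1 / (((n : ℝ) + 1) * ((s n).card + 1)) := fun n => by positivity
  choose q hq using fun (n : ℕ) (x : s n) => exists_rat_near (L (ρ n x)) (hδ n)
  refine ⟨fun n => ⟨n, q n⟩, fun f => ?_⟩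
  have h1 : Tendsto (fun n => L (∑ x ∈ s n, f x • ρ n x)) atTop (𝓝 (L f)) :=
    (L.continuous.tendsto _).comp (hρ f)
  have h2 : Tendsto (fun n : ℕ => 1 / ((n : ℝ) + 1) * ‖f‖) atTop (𝓝 0) := by
    simpa using tendsto_one_div_add_atTop_nhds_zero_nat.mul_const ‖f‖
  have h3 : Tendsto (fun n => L (∑ x ∈ s n, f x • ρ n x) -
      ∑ x : s n, (q n x : ℝ) * f x) atTop (𝓝 0) := by
    refine squeeze_zero_norm (fun n => ?_) h2
    rw [map_sum, ← Finset.sum_coe_sort, ← Finset.sum_sub_distrib]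
    calc ‖∑ x : s n, (L (f x • ρ n x) - q n x * f x)‖
        ≤ ∑ x : s n, ‖L (f x • ρ n x) - q n x * f x‖ := norm_sum_le _ _
      _ ≤ ∑ _x : s n, 1 / (((n : ℝ) + 1) * ((s n).card + 1)) * ‖f‖ := by
          refine Finset.sum_le_sum fun x _ => ?_
          rw [map_smul, smul_eq_mul, mul_comm, ← sub_mul, norm_mul]
          exact mul_le_mul (hq n x).le (f.norm_coe_le_norm _) (norm_nonneg _) (hδ n).le
      _ = (s n).card / ((s n).card + 1 : ℝ) * (1 / ((n : ℝ) + 1) * ‖f‖) := by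
          rw [Finset.sum_const, Finset.card_univ, Fintype.card_coe, nsmul_eq_mul]
          field_simp
      _ ≤ 1 * (1 / ((n : ℝ) + 1) * ‖f‖) := by
          refine mul_le_mul_of_nonneg_right ?_ (by positivity)
          rw [div_le_one (by positivity)]
          linarith
      _ = _ := one_mul _
  simpa using h1.sub h3

/-- The Gaussian form of the characteristic function of a functional of `f ∼ μ`, written with the
first two moments. -/
def HasGaussianCharFun (μ : Measure C(𝕏, ℝ)) (L : StrongDual ℝ C(𝕏, ℝ)) : Prop :=
  ∫ f, Complex.exp (L f * Complex.I) ∂μ = Complex.exp (((∫ f, L f ∂μ : ℝ) : ℂ) * Complex.I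
    - (((∫ f, L f ^ 2 ∂μ) - (∫ f, L f ∂μ) ^ 2 : ℝ) : ℂ) / 2)

theorem hasGaussianCharFun_iff {μ : Measure C(𝕏, ℝ)} [IsProbabilityMeasure μ]
    (hμ : Integrable (fun f : C(𝕏, ℝ) => ‖f‖ ^ 2) μ) (L : StrongDual ℝ C(𝕏, ℝ)) :
    HasGaussianCharFun μ L ↔
      charFunDual μ L = Complex.exp ((∫ f, (L f : ℂ) ∂μ) * Complex.I - Var[L; μ] / 2) := by
  have hL : MemLp L 2 μ := by
    refine (memLp_two_iff_integrable_sq L.continuous.aestronglyMeasurable).2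
      ((hμ.const_mul (‖L‖ ^ 2)).mono' (L.continuous.pow 2).aestronglyMeasurable
        (Eventually.of_forall fun f => ?_))
    rw [Real.norm_of_nonneg (sq_nonneg _), ← mul_pow, ← sq_abs]
    exact pow_le_pow_left₀ (abs_nonneg _) (L.le_opNorm f) 2
  rw [HasGaussianCharFun, charFunDual_apply, variance_eq_sub hL, integral_complex_ofReal]
  rfl

/-- Gaussianity is tested by countably many functionals, provided that second moments are finite. -/
theorem isGaussian_iff_of_dual_approx {ι : Type*} {Λ : ι → StrongDual ℝ C(𝕏, ℝ)}
    (hΛ : ∀ L : StrongDual ℝ C(𝕏, ℝ), ∃ i : ℕ → ι,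
      ∀ f, Tendsto (fun n => Λ (i n) f) atTop (𝓝 (L f)))
    {μ : Measure C(𝕏, ℝ)} [IsProbabilityMeasure μ] :
    IsGaussian μ ↔ Integrable (fun f : C(𝕏, ℝ) => ‖f‖ ^ 2) μ ∧ ∀ i, HasGaussianCharFun μ (Λ i) := by
  constructor
  · intro h
    have hi := integrable_norm_sq (⟨μ, h⟩ : GaussMeas 𝕏)
    exact ⟨hi, fun i => (hasGaussianCharFun_iff hi _).2 (IsGaussian.charFunDual_eq _)⟩
  · rintro ⟨hi, h⟩
    refine isGaussian_of_charFunDual_eq fun L => (hasGaussianCharFun_iff hi L).1 ?_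
    obtain ⟨i, hL⟩ := hΛ L
    -- dominated convergence along the approximating functionals, which are uniformly bounded
    obtain ⟨C, hC⟩ := banach_steinhaus (g := fun n => Λ (i n)) fun f => by
      obtain ⟨R, hR⟩ := (hL f).norm.bddAbove_range
      exact ⟨R, fun n => hR ⟨n, rfl⟩⟩
    have hC' : ∀ n f, ‖Λ (i n) f‖ ≤ C * ‖f‖ := fun n f => (Λ (i n)).le_of_opNorm_le (hC n) f
    have hn : Integrable (fun f : C(𝕏, ℝ) => ‖f‖) μ := by
      have h2 : MemLp (fun f : C(𝕏, ℝ) => ‖f‖) 2 μ :=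
        (memLp_two_iff_integrable_sq continuous_norm.aestronglyMeasurable).2 hi
      exact h2.integrable (by norm_num)
    have e1 : Tendsto (fun n => ∫ f, Λ (i n) f ∂μ) atTop (𝓝 (∫ f, L f ∂μ)) :=
      tendsto_integral_of_dominated_convergence (fun f => C * ‖f‖)
        (fun n => (Λ (i n)).continuous.aestronglyMeasurable) (hn.const_mul C)
        (fun n => Eventually.of_forall (hC' n)) (Eventually.of_forall hL)
    have e2 : Tendsto (fun n => ∫ f, Λ (i n) f ^ 2 ∂μ) atTop (𝓝 (∫ f, L f ^ 2 ∂μ)) := by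
      refine tendsto_integral_of_dominated_convergence (fun f => C ^ 2 * ‖f‖ ^ 2)
        (fun n => ((Λ (i n)).continuous.pow 2).aestronglyMeasurable) (hi.const_mul _)
        (fun n => Eventually.of_forall fun f => ?_) (Eventually.of_forall fun f => (hL f).pow 2)
      rw [norm_pow, ← mul_pow]
      exact pow_le_pow_left₀ (norm_nonneg _) (hC' n f) 2
    have hcont : Continuous fun t : ℝ => Complex.exp (t * Complex.I) := by fun_prop
    have e3 : Tendsto (fun n => ∫ f, Complex.exp (Λ (i n) f * Complex.I) ∂μ) atTop
        (𝓝 (∫ f, Complex.exp (L f * Complex.I) ∂μ)) :=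
      tendsto_integral_of_dominated_convergence (fun _ => 1)
        (fun n => (hcont.comp (Λ (i n)).continuous).aestronglyMeasurable) (integrable_const _)
        (fun n => Eventually.of_forall fun f => (Complex.norm_exp_ofReal_mul_I _).le)
        (Eventually.of_forall fun f => (hcont.tendsto _).comp (hL f))
    refine tendsto_nhds_unique e3 (Tendsto.congr (fun n => (h (i n)).symm) ?_)
    exact (Complex.continuous_exp.tendsto _).comp
      ((((Complex.continuous_ofReal.tendsto _).comp e1).mul_const _).sub
        (((Complex.continuous_ofReal.tendsto _).comp (e2.sub (e1.pow 2))).div_const _))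

/-- The set of parameters at which a Markov kernel is Gaussian is measurable. -/
theorem measurableSet_isGaussian_kernel {E : Type*} [MeasurableSpace E] (κ : Kernel E C(𝕏, ℝ))
    [IsMarkovKernel κ] : MeasurableSet {e | IsGaussian (κ e)} := by
  obtain ⟨ι, _, Λ, hΛ⟩ := exists_countable_dual_approx 𝕏
  have hint : ∀ {F : Type} [NormedAddCommGroup F] [NormedSpace ℝ F] [SecondCountableTopology F]
      [MeasurableSpace F] [BorelSpace F] (g : C(𝕏, ℝ) → F), Continuous g →
      Measurable fun e => ∫ f, g f ∂κ e := by
    intro F _ _ _ _ _ g hg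
    exact ((hg.stronglyMeasurable.comp_measurable
      (measurable_snd (α := E))).integral_kernel_prod_right' (κ := κ)).measurable
  have hset : {e | IsGaussian (κ e)} = {e | ∫⁻ f, ‖f‖ₑ ^ 2 ∂κ e < ∞} ∩
      ⋂ i, {e | HasGaussianCharFun (κ e) (Λ i)} := by
    ext e
    simp only [Set.mem_ofPred_eq, Set.mem_inter_iff, Set.mem_iInter]
    rw [isGaussian_iff_of_dual_approx hΛ]
    refine and_congr_left fun _ => ⟨fun h => ?_, fun h => ⟨?_, ?_⟩⟩
    · have h2 := h.2
      simpa [HasFiniteIntegral] using h2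
    · exact (continuous_norm.pow 2).aestronglyMeasurable
    · simpa [HasFiniteIntegral] using h
  rw [hset]
  refine MeasurableSet.inter ?_ (MeasurableSet.iInter fun i => ?_)
  · refine measurableSet_lt ?_ measurable_const
    exact (Measurable.lintegral_kernel_prod_right' (κ := κ)
      (f := fun q : E × C(𝕏, ℝ) => ‖q.2‖ₑ ^ 2) (by fun_prop))
  · have h1 := hint (fun f => Λ i f) (Λ i).continuous
    have h2 := hint (fun f => Λ i f ^ 2) ((Λ i).continuous.pow 2)
    have h3 := hint (fun f => Complex.exp (Λ i f * Complex.I)) (by fun_prop)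
    exact measurableSet_eq_fun h3 (by fun_prop)

open Classical in
/-- A Markov kernel, with its non-Gaussian values replaced by the Dirac mass at zero. -/
noncomputable def gaussPart {E : Type*} [MeasurableSpace E] (κ : Kernel E C(𝕏, ℝ)) (e : E) :
    GaussMeas 𝕏 :=
  if h : IsGaussian (κ e) then ⟨κ e, h⟩ else ⟨Measure.dirac 0, inferInstance⟩

theorem gaussPart_val {E : Type*} [MeasurableSpace E] {κ : Kernel E C(𝕏, ℝ)} {e : E}
    (h : IsGaussian (κ e)) : (gaussPart κ e).1 = κ e := by
  rw [gaussPart, dif_pos h]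

theorem measurable_gaussPart {E : Type*} [MeasurableSpace E] (κ : Kernel E C(𝕏, ℝ))
    [IsMarkovKernel κ] : Measurable (gaussPart κ) := by
  classical
  refine measurable_comap_iff.2 ?_
  have h : Subtype.val ∘ gaussPart κ
      = fun e => if IsGaussian (κ e) then κ e else Measure.dirac 0 := by
    ext1 e
    rw [Function.comp_apply, gaussPart]
    split_ifs <;> rfl
  rw [h]
  exact Measurable.ite (measurableSet_isGaussian_kernel κ) κ.measurable measurable_const

theorem ae_integrable_condDistrib {Ω E : Type*} [MeasurableSpace Ω] [MeasurableSpace E]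
    {P : Measure Ω} [IsProbabilityMeasure P] {ξ : Ω → C(𝕏, ℝ)} (hξ : Measurable ξ) {Y : Ω → E}
    (hY : Measurable Y) {φ : C(𝕏, ℝ) → ℝ} (hφ : Measurable φ)
    (hφi : Integrable (fun ω => φ (ξ ω)) P) :
    ∀ᵐ ω ∂P, Integrable φ (condDistrib ξ Y P (Y ω)) :=
  Integrable.condDistrib_ae (f := fun q : E × C(𝕏, ℝ) => φ q.2) hY.aemeasurable hξ.aemeasurable
    ((integrable_map_measure (hφ.comp measurable_snd).aestronglyMeasurable
      (hY.prodMk hξ).aemeasurable).2 hφi)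

variable {Ω : Type w} [mΩ : MeasurableSpace Ω] {P : Measure Ω} [IsProbabilityMeasure P]
  {ξ : Ω → C(𝕏, ℝ)} {ν : ℕ → Ω → GaussMeas 𝕏} {𝓕 : Filtration ℕ mΩ}

/-- A limit of Gaussian conditional laws along a filtration is almost surely Gaussian. -/
theorem ae_isGaussian_condDistrib (hξ : Measurable ξ) (hg : IsGaussian (P.map ξ))
    (hν : ∀ n, IsCondLaw (𝓕 n) P ξ (ν n)) :
    ∀ᵐ ω ∂P, IsGaussian (@condDistrib Ω Ω C(𝕏, ℝ) _ _ _ mΩ (⨆ n, 𝓕 n) ξ id P _ ω) := by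
  obtain ⟨ι, _, Λ, hΛ⟩ := exists_countable_dual_approx 𝕏
  set κ := @condDistrib Ω Ω C(𝕏, ℝ) _ _ _ mΩ (⨆ n, 𝓕 n) ξ id P _ with hκ
  have hsq : ∀ᵐ ω ∂P, Integrable (fun f : C(𝕏, ℝ) => ‖f‖ ^ 2) (κ ω) := by
    exact @ae_integrable_condDistrib 𝕏 _ _ Ω Ω mΩ (⨆ n, 𝓕 n) P _ ξ hξ id
      (measurable_id'' (iSup_filtration_le 𝓕)) _ (measurable_norm.pow_const 2)
      (integrable_comp_path hξ hg integrable_norm_sq)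
  have hbdd : ∀ φ : C(𝕏, ℝ) → ℝ, Measurable φ → (∀ f, ‖φ f‖ ≤ 1) →
      Integrable (fun ω => φ (ξ ω)) P := fun φ hφ h1 =>
    Integrable.of_bound (hφ.comp hξ).aestronglyMeasurable 1 (Eventually.of_forall fun ω => h1 _)
  have hΛm : ∀ i, Measurable (Λ i) := fun i => (Λ i).continuous.measurable
  have h1 := ae_all_iff.2 fun i => tendsto_integral_condDistrib hξ hν (hΛm i)
    (integrable_comp_path hξ hg fun μ => IsGaussian.integrable_dual μ.1 (Λ i))
  have h2 := ae_all_iff.2 fun i => tendsto_integral_condDistrib hξ hν ((hΛm i).pow_const 2)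
    (integrable_comp_path hξ hg fun μ =>
      (IsGaussian.memLp_dual μ.1 (Λ i) 2 (by simp)).integrable_sq)
  have h3 := ae_all_iff.2 fun i => tendsto_integral_condDistrib hξ hν
    (Real.measurable_cos.comp (hΛm i))
    (hbdd _ (Real.measurable_cos.comp (hΛm i)) fun f => Real.abs_cos_le_one _)
  have h4 := ae_all_iff.2 fun i => tendsto_integral_condDistrib hξ hν
    (Real.measurable_sin.comp (hΛm i))
    (hbdd _ (Real.measurable_sin.comp (hΛm i)) fun f => Real.abs_sin_le_one _)
  have hexp : ∀ (μ : Measure C(𝕏, ℝ)) [IsProbabilityMeasure μ] i,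
      ∫ f, Complex.exp (Λ i f * Complex.I) ∂μ
        = ((∫ f, Real.cos (Λ i f) ∂μ : ℝ) : ℂ)
          + ((∫ f, Real.sin (Λ i f) ∂μ : ℝ) : ℂ) * Complex.I := by
    intro μ _ i
    have hc : Integrable (fun f => Real.cos (Λ i f)) μ :=
      Integrable.of_bound (Real.measurable_cos.comp (hΛm i)).aestronglyMeasurable 1
        (Eventually.of_forall fun f => Real.abs_cos_le_one _)
    have hs : Integrable (fun f => Real.sin (Λ i f)) μ :=
      Integrable.of_bound (Real.measurable_sin.comp (hΛm i)).aestronglyMeasurable 1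
        (Eventually.of_forall fun f => Real.abs_sin_le_one _)
    rw [← integral_complex_ofReal, ← integral_complex_ofReal, ← integral_mul_const,
      ← integral_add hc.ofReal (hs.ofReal.mul_const _)]
    refine integral_congr_ae (Eventually.of_forall fun f => ?_)
    simp only [Complex.exp_mul_I, Complex.ofReal_cos, Complex.ofReal_sin]
  filter_upwards [hsq, h1, h2, h3, h4] with ω hsq h1 h2 h3 h4
  refine (isGaussian_iff_of_dual_approx hΛ).2 ⟨hsq, fun i => ?_⟩
  have hcast := fun t : ℝ => Complex.continuous_ofReal.tendsto t
  have hn : ∀ n, HasGaussianCharFun (ν n ω).1 (Λ i) := fun n =>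
    ((isGaussian_iff_of_dual_approx hΛ).1 (ν n ω).2).2 i
  have e1 : Tendsto (fun n => ∫ f, Complex.exp (Λ i f * Complex.I) ∂(ν n ω).1) atTop
      (𝓝 (∫ f, Complex.exp (Λ i f * Complex.I) ∂κ ω)) := by
    simp_rw [hexp]
    exact ((hcast _).comp (h3 i)).add (((hcast _).comp (h4 i)).mul_const _)
  refine tendsto_nhds_unique e1 (Tendsto.congr (fun n => (hn n).symm) ?_)
  exact (Complex.continuous_exp.tendsto _).comp ((((hcast _).comp (h1 i)).mul_const _).sub
    (((hcast _).comp ((h2 i).sub ((h1 i).pow 2))).div_const _))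

/-- Existence of the limit conditional law as a random Gaussian measure. -/
theorem exists_isCondLaw_iSup (hξ : Measurable ξ) (hg : IsGaussian (P.map ξ))
    (hν : ∀ n, IsCondLaw (𝓕 n) P ξ (ν n)) : ∃ ν', IsCondLaw (⨆ n, 𝓕 n) P ξ ν' := by
  set κ := @condDistrib Ω Ω C(𝕏, ℝ) _ _ _ mΩ (⨆ n, 𝓕 n) ξ id P _ with hκ
  refine ⟨@gaussPart 𝕏 _ _ Ω (⨆ n, 𝓕 n) κ, iSup_filtration_le 𝓕,
    @measurable_gaussPart 𝕏 _ _ Ω (⨆ n, 𝓕 n) κ _, fun A hA => ?_⟩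
  have h := condDistrib_ae_eq_condExp (mβ := ⨆ n, 𝓕 n) (μ := P) (X := id) (Y := ξ) (s := A)
    (measurable_id'' (iSup_filtration_le 𝓕)) hξ hA
  rw [MeasurableSpace.comap_id] at h
  filter_upwards [h, ae_isGaussian_condDistrib hξ hg hν] with ω h1 h2
  rw [@gaussPart_val 𝕏 _ _ Ω (⨆ n, 𝓕 n) κ ω h2, ← h1]
  rfl

end GaussianLimit

/-! ### The Bayes risk functional of a loss function -/

section LossFunctional

variable {𝕏 : Type u} [MetricSpace 𝕏] [CompactSpace 𝕏] {D : Type v} [TopologicalSpace D]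
  {τ : C(𝕏, ℝ≥0)} {L : C(𝕏, ℝ) → D → ℝ≥0}

theorem IsRegularLoss.measurable_coe (hL : IsRegularLoss.{u, v, w} τ L) (d : D) :
    Measurable fun f => (L f d : ℝ≥0∞) := (hL.measurable d).coe_nnreal_ennreal

theorem IsRegularLoss.measurable_avgLoss (hL : IsRegularLoss.{u, v, w} τ L) (d : D) :
    Measurable fun ν => avgLoss L ν d :=
  (Measure.measurable_lintegral (hL.measurable_coe d)).comp measurable_subtype_coe

theorem IsRegularLoss.exists_seq_iInf_eq [Nonempty D] (hL : IsRegularLoss.{u, v, w} τ L) :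
    ∃ d : ℕ → D, ∀ ν, ⨅ d, avgLoss L ν d = ⨅ n, avgLoss L ν (d n) := by
  have := hL.separable
  refine ⟨TopologicalSpace.denseSeq D, fun ν => le_antisymm (le_iInf fun n => iInf_le _ _)
    (le_iInf fun d => ?_)⟩
  have hcl : IsClosed {d | ⨅ n, avgLoss L ν (TopologicalSpace.denseSeq D n) ≤ avgLoss L ν d} :=
    isClosed_le continuous_const (hL.continuous ν)
  have hsub : Set.range (TopologicalSpace.denseSeq D) ⊆
      {d | ⨅ n, avgLoss L ν (TopologicalSpace.denseSeq D n) ≤ avgLoss L ν d} := by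
    rintro _ ⟨n, rfl⟩
    exact iInf_le (fun n => avgLoss L ν (TopologicalSpace.denseSeq D n)) n
  exact hcl.closure_subset_iff.2 hsub (TopologicalSpace.denseRange_denseSeq D d)

theorem IsRegularLoss.iInf_ne_top [Nonempty D] (hL : IsRegularLoss.{u, v, w} τ L)
    (ν : GaussMeas 𝕏) : ⨅ d, avgLoss L ν d ≠ ∞ :=
  ne_top_of_le_ne_top (hL.finite ν (Classical.arbitrary D)) (iInf_le _ _)

theorem IsRegularLoss.ofReal_lossFunctional [Nonempty D] (hL : IsRegularLoss.{u, v, w} τ L)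
    (ν : GaussMeas 𝕏) : ENNReal.ofReal (lossFunctional L ν) = ⨅ d, avgLoss L ν d :=
  ENNReal.ofReal_toReal (hL.iInf_ne_top ν)

theorem lossFunctional_nonneg (L : C(𝕏, ℝ) → D → ℝ≥0) (ν : GaussMeas 𝕏) :
    0 ≤ lossFunctional L ν := ENNReal.toReal_nonneg

theorem IsRegularLoss.measurable_lossFunctional [Nonempty D] (hL : IsRegularLoss.{u, v, w} τ L) :
    Measurable (lossFunctional L) := by
  obtain ⟨d, hd⟩ := hL.exists_seq_iInf_eq
  unfold lossFunctional
  simp_rw [hd]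
  exact (Measurable.iInf fun n => hL.measurable_avgLoss (d n)).ennreal_toReal

theorem IsRegularLoss.toReal_avgLoss (hL : IsRegularLoss.{u, v, w} τ L)
    (ν : GaussMeas 𝕏) (d : D) : (avgLoss L ν d).toReal = ∫ f, (L f d : ℝ) ∂ν.1 := by
  exact (integral_toReal (hL.measurable_coe d).aemeasurable
    (Eventually.of_forall fun f => ENNReal.coe_lt_top)).symm

theorem IsRegularLoss.integrable (hL : IsRegularLoss.{u, v, w} τ L) (d : D) (ν : GaussMeas 𝕏) :
    Integrable (fun f => (L f d : ℝ)) ν.1 := by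
  refine ⟨(hL.measurable d).coe_nnreal_real.aestronglyMeasurable, ?_⟩
  have h := (hL.finite ν d).lt_top
  rw [avgLoss] at h
  simpa [HasFiniteIntegral] using h

theorem IsRegularLoss.lossFunctional_le [Nonempty D] (hL : IsRegularLoss.{u, v, w} τ L)
    (ν : GaussMeas 𝕏) (d : D) : lossFunctional L ν ≤ ∫ f, (L f d : ℝ) ∂ν.1 := by
  rw [← hL.toReal_avgLoss]
  exact ENNReal.toReal_mono (hL.finite ν d) (iInf_le _ d)

theorem stepCrit_eq [MeasurableSpace 𝕏] [BorelSpace 𝕏] {H : GaussMeas 𝕏 → ℝ} (hH : Measurable H)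
    (x : 𝕏) (ν : GaussMeas 𝕏) : stepCrit τ H x ν =
      ∫⁻ p, ENNReal.ofReal (H (cond τ x (noisyObs τ x p) ν)) ∂withNoise ν := by
  simp_rw [noisyObs_apply]
  rw [lintegral_prod]
  · rfl
  · refine (hH.comp ((measurable_cond τ).comp (f := fun p : C(𝕏, ℝ) × ℝ =>
      (x, p.1 x + p.2 * τ x, ν)) ?_)).ennreal_ofReal.aemeasurable
    have h : Measurable fun p : C(𝕏, ℝ) × ℝ => p.1 x :=
      (continuous_eval_const x).measurable.comp measurable_fst
    fun_prop

/-- One more observation cannot increase the expected Bayes risk: averaging the risk of a fixed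
decision over the observation gives back the prior risk of that decision. -/
theorem IsRegularLoss.stepCrit_le [MeasurableSpace 𝕏] [BorelSpace 𝕏] [Nonempty D]
    (hL : IsRegularLoss.{u, v, w} τ L) (x : 𝕏) (ν : GaussMeas 𝕏) :
    stepCrit τ (lossFunctional L) x ν ≤ ENNReal.ofReal (lossFunctional L ν) := by
  rw [hL.ofReal_lossFunctional, stepCrit_eq hL.measurable_lossFunctional]
  refine le_iInf fun d => ?_
  have h := lintegral_cond τ x ν (F := fun q => (L q.1 d : ℝ≥0∞))
    ((hL.measurable_coe d).comp measurable_fst)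
  have h2 : avgLoss L ν d = ∫⁻ p, (L p.1 d : ℝ≥0∞) ∂withNoise ν := by
    have h3 := lintegral_map (μ := withNoise ν) (hL.measurable_coe d) measurable_fst
    simpa [avgLoss] using h3
  rw [h2, h]
  refine lintegral_mono fun p => ?_
  rw [hL.ofReal_lossFunctional]
  exact iInf_le _ d

variable [MeasurableSpace 𝕏] [BorelSpace 𝕏]

theorem measurable_integral_gauss {φ : C(𝕏, ℝ) → ℝ} (hφ : Measurable φ) :
    Measurable fun ν : GaussMeas 𝕏 => ∫ f, φ f ∂ν.1 :=
  ((hφ.stronglyMeasurable.comp_measurable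
    (measurable_snd (α := GaussMeas 𝕏))).integral_kernel_prod_right' (κ := gaussKernel)).measurable

variable {Ω : Type w} {m' : MeasurableSpace Ω} [mΩ : MeasurableSpace Ω] {P : Measure Ω}
  [IsProbabilityMeasure P]

theorem IsCondLaw.integrable_integral {ξ : Ω → C(𝕏, ℝ)}
    {ν : Ω → GaussMeas 𝕏} (h : IsCondLaw m' P ξ ν) (hξ : Measurable ξ) {φ : C(𝕏, ℝ) → ℝ}
    (hφ : Measurable φ) (hφi : Integrable (fun ω => φ (ξ ω)) P) :
    Integrable (fun ω => ∫ f, φ f ∂(ν ω).1) P :=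
  integrable_condExp.congr (h.condExp_ae_eq hξ hφ hφi)

theorem IsCondLaw.integral_integral {ξ : Ω → C(𝕏, ℝ)}
    {ν : Ω → GaussMeas 𝕏} (h : IsCondLaw m' P ξ ν) (hξ : Measurable ξ) {φ : C(𝕏, ℝ) → ℝ}
    (hφ : Measurable φ) (hφi : Integrable (fun ω => φ (ξ ω)) P) :
    ∫ ω, ∫ f, φ f ∂(ν ω).1 ∂P = ∫ ω, φ (ξ ω) ∂P := by
  rw [← integral_congr_ae (h.condExp_ae_eq hξ hφ hφi), integral_condExp h.le]

theorem IsRegularLoss.integrable_comp_condLaw [Nonempty D] (hL : IsRegularLoss.{u, v, w} τ L)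
    {ξ : Ω → C(𝕏, ℝ)} {ν : Ω → GaussMeas 𝕏} (h : IsCondLaw m' P ξ ν)
    (hξ : Measurable ξ) (hg : IsGaussian (P.map ξ)) :
    Integrable (fun ω => lossFunctional L (ν ω)) P := by
  have d := Classical.arbitrary D
  refine (h.integrable_integral hξ (hL.measurable d).coe_nnreal_real
    (integrable_comp_path hξ hg (hL.integrable d))).mono' ?_ (Eventually.of_forall fun ω => ?_)
  · exact (hL.measurable_lossFunctional.comp (h.measurable.mono h.le le_rfl)).aestronglyMeasurable
  · rw [Real.norm_of_nonneg (lossFunctional_nonneg L _)]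
    exact hL.lossFunctional_le _ d

theorem ObsModel.stronglyAdapted_posterior (M : ObsModel 𝕏 P) {X : ℕ → Ω → 𝕏}
    (hX : M.IsSequentialDesign τ X) {H : GaussMeas 𝕏 → ℝ} (hH : Measurable H) :
    StronglyAdapted (M.filtration hX) (fun n ω => H (M.posterior τ X n ω)) := fun n =>
  (hH.comp (M.isCondLaw_posterior hX n).measurable).stronglyMeasurable

theorem ObsModel.martingale_integral_posterior (M : ObsModel 𝕏 P) {X : ℕ → Ω → 𝕏}
    (hX : M.IsSequentialDesign τ X) {φ : C(𝕏, ℝ) → ℝ} (hφ : Measurable φ)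
    (hφi : ∀ ν : GaussMeas 𝕏, Integrable φ ν.1) :
    Martingale (fun n ω => ∫ f, φ f ∂(M.posterior τ X n ω).1) (M.filtration hX) P := by
  have hi := integrable_comp_path M.measurable_path M.isGaussian_map hφi
  have he := fun n => (M.isCondLaw_posterior hX n).condExp_ae_eq M.measurable_path hφ hi
  refine ⟨M.stronglyAdapted_posterior hX (measurable_integral_gauss hφ), fun i j hij => ?_⟩
  refine (condExp_congr_ae (he j).symm).trans ?_
  exact (condExp_condExp_of_le (M.obsSigma_mono τ X hij) (M.obsSigma_le hX j)).trans (he i)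

/-- The average loss of a fixed decision is a martingale along the posteriors, and the Bayes risk is
a countable infimum of such martingales. -/
theorem IsRegularLoss.supermartingaleProperty [Nonempty D] (hL : IsRegularLoss.{u, v, w} τ L) :
    SupermartingaleProperty.{u, w} τ (lossFunctional L) := by
  refine ⟨hL.measurable_lossFunctional, fun Ω _ P _ M X hX => ?_⟩
  have hint : ∀ n, Integrable (fun ω => lossFunctional L (M.posterior τ X n ω)) P := fun n =>
    hL.integrable_comp_condLaw (M.isCondLaw_posterior hX n) M.measurable_path M.isGaussian_map
  refine supermartingale_nat (M.stronglyAdapted_posterior hX hL.measurable_lossFunctional) hint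
    fun n => ?_
  obtain ⟨d, hd⟩ := hL.exists_seq_iInf_eq
  have hmart := fun k => M.martingale_integral_posterior hX (hL.measurable (d k)).coe_nnreal_real
    (hL.integrable (d k))
  have h1 : ∀ᵐ ω ∂P, ∀ k, (P[fun ω => lossFunctional L (M.posterior τ X (n + 1) ω) |
      M.filtration hX n]) ω ≤ ∫ f, (L f (d k) : ℝ) ∂(M.posterior τ X n ω).1 := by
    refine ae_all_iff.2 fun k => ?_
    have h2 := condExp_mono (m := M.filtration hX n) (hint (n + 1)) ((hmart k).integrable (n + 1))
      (Eventually.of_forall fun ω => hL.lossFunctional_le (M.posterior τ X (n + 1) ω) (d k))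
    filter_upwards [h2, (hmart k).condExp_ae_eq n.le_succ] with ω h2 h3
    rwa [h3] at h2
  filter_upwards [h1] with ω h1
  rw [lossFunctional, ← ENNReal.ofReal_le_iff_le_toReal (hL.iInf_ne_top _), hd]
  refine le_iInf fun k => ?_
  rw [ENNReal.ofReal_le_iff_le_toReal (hL.finite _ _), hL.toReal_avgLoss]
  exact h1 k

/-- The part `H₁` of the Bayes risk is a supermartingale minus the martingale `∫ L₀`. -/
theorem IsRegularLoss.existenceAssumptions [Nonempty D] (hL : IsRegularLoss.{u, v, w} τ L) :
    ExistenceAssumptions.{u, w} τ (lossFunctional L) := by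
  refine ⟨hL.measurable_lossFunctional, lossFunctional_nonneg L, ?_⟩
  obtain ⟨L₀, H₁, hm, hi, hUI, hPC, heq⟩ := hL.decomposition
  refine ⟨L₀, H₁, hm, hi, hUI, hPC, ⟨hUI.1, fun Ω _ P _ M X hX => ?_⟩, heq⟩
  have h : (fun n ω => H₁ (M.posterior τ X n ω)) =
      (fun n ω => lossFunctional L (M.posterior τ X n ω)) -
        fun n ω => ∫ f, L₀ f ∂(M.posterior τ X n ω).1 := by
    funext n ω
    simp only [Pi.sub_apply, heq, add_sub_cancel_left]
  rw [h]
  exact (hL.supermartingaleProperty.2 Ω P M X hX).sub_martingale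
    (M.martingale_integral_posterior hX hm hi)

end LossFunctional

/-! ### Continuity of the Bayes risk in expectation and of the sampling criterion -/

section Continuity

variable {𝕏 : Type u} [MetricSpace 𝕏] [CompactSpace 𝕏] {D : Type v} [TopologicalSpace D]
  {τ : C(𝕏, ℝ≥0)} {L : C(𝕏, ℝ) → D → ℝ≥0}

theorem IsRegularLoss.integrable_comp_gaussCondLaws [Nonempty D] [MeasurableSpace 𝕏]
    [BorelSpace 𝕏] (hL : IsRegularLoss.{u, v, w} τ L)
    {Ω : Type w} [mΩ : MeasurableSpace Ω] {P : Measure Ω} [IsProbabilityMeasure P]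
    {ξ : Ω → C(𝕏, ℝ)} (hξ : Measurable ξ) (hg : IsGaussian (P.map ξ)) {μ : Ω → GaussMeas 𝕏}
    (hμ : μ ∈ gaussCondLaws P ξ) : Integrable (fun ω => lossFunctional L (μ ω)) P :=
  hμ.elim fun _ h => IsRegularLoss.integrable_comp_condLaw (mΩ := mΩ) hL h hξ hg

/-- Almost sure convergence of Gaussian conditional laws of the same random function implies
convergence of the expected Bayes risks. -/
theorem IsRegularLoss.tendsto_lintegral [Nonempty D] [MeasurableSpace 𝕏] [BorelSpace 𝕏]
    (hL : IsRegularLoss.{u, v, w} τ L)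
    {Ω : Type w} [mΩ : MeasurableSpace Ω] {P : Measure Ω} [IsProbabilityMeasure P]
    {ξ : Ω → C(𝕏, ℝ)} (hξ : Measurable ξ) (hg : IsGaussian (P.map ξ))
    {ν : ℕ → Ω → GaussMeas 𝕏} {ν' : Ω → GaussMeas 𝕏} (hν : ∀ n, ν n ∈ gaussCondLaws P ξ)
    (hν' : ν' ∈ gaussCondLaws P ξ) (hlim : ∀ᵐ ω ∂P, GaussTendsto (fun n => ν n ω) (ν' ω)) :
    Tendsto (fun n => ∫⁻ ω, ENNReal.ofReal (lossFunctional L (ν n ω)) ∂P) atTop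
      (𝓝 (∫⁻ ω, ENNReal.ofReal (lossFunctional L (ν' ω)) ∂P)) := by
  obtain ⟨L₀, H₁, hm, hi, hUI, hPC, heq⟩ := hL.decomposition
  have hui := hUI.2 Ω P ξ hξ hg
  have hint₁ : ∀ μ ∈ gaussCondLaws P ξ, Integrable (fun ω => H₁ (μ ω)) P := fun μ hμ =>
    memLp_one_iff_integrable.1 (hui.memLp ⟨μ, hμ⟩)
  have hL₀ := integrable_comp_path hξ hg hi
  -- the part `H₀` of the risk has the same expectation for all conditional laws of `ξ`
  have hval : ∀ μ ∈ gaussCondLaws P ξ, ∫⁻ ω, ENNReal.ofReal (lossFunctional L (μ ω)) ∂P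
      = ENNReal.ofReal (∫ ω, L₀ (ξ ω) ∂P + ∫ ω, H₁ (μ ω) ∂P) := by
    intro μ hμ
    rw [← ofReal_integral_eq_lintegral_ofReal (hL.integrable_comp_gaussCondLaws hξ hg hμ)
      (Eventually.of_forall fun ω => lossFunctional_nonneg L _)]
    simp_rw [heq]
    refine congrArg ENNReal.ofReal (hμ.elim fun _ h => ?_)
    rw [integral_add (IsCondLaw.integrable_integral (mΩ := mΩ) h hξ hm hL₀) (hint₁ μ hμ),
      IsCondLaw.integral_integral (mΩ := mΩ) h hξ hm hL₀]
  rw [hval ν' hν', funext fun n => hval (ν n) (hν n)]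
  refine (ENNReal.continuous_ofReal.tendsto _).comp (Tendsto.const_add _ ?_)
  have hLp := tendsto_Lp_finite_of_tendsto_ae (μ := P) le_rfl ENNReal.one_ne_top
    (f := fun n ω => H₁ (ν n ω)) (g := fun ω => H₁ (ν' ω))
    (fun n => (hint₁ _ (hν n)).aestronglyMeasurable) (memLp_one_iff_integrable.2 (hint₁ _ hν'))
    (fun ε hε => by
      obtain ⟨δ, hδ, h⟩ := hui.2.1 hε
      exact ⟨δ, hδ, fun n s hs => h ⟨ν n, hν n⟩ s hs⟩)
    (hPC.2 Ω P ξ hξ hg ν ν' hν hν' hlim)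
  exact tendsto_integral_of_L1' _ (hint₁ _ hν').aestronglyMeasurable
    (Eventually.of_forall fun n => hint₁ _ (hν n)) hLp

/-- A random function and an independent standard normal variable, on a probability space in a
prescribed universe. -/
theorem exists_model_withNoise (ν : GaussMeas 𝕏) :
    ∃ (Ω : Type w) (_ : MeasurableSpace Ω) (P : Measure Ω) (ξ : Ω → C(𝕏, ℝ)) (U : Ω → ℝ),
      IsProbabilityMeasure P ∧ Measurable ξ ∧ Measurable U ∧
      P.map (fun ω => (ξ ω, U ω)) = withNoise ν := by
  obtain ⟨e, he⟩ := exists_measurableEmbedding_real (C(𝕏, ℝ) × ℝ)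
  obtain ⟨g, hg, hge⟩ := he.exists_measurable_extend (measurable_id (α := C(𝕏, ℝ) × ℝ))
    (fun _ => inferInstance)
  have heup : Measurable fun p => ULift.up.{w} (e p) := measurable_up.comp he.measurable
  have hgd : Measurable fun ω : ULift.{w} ℝ => g ω.down := hg.comp measurable_down
  have hid : (fun ω : ULift.{w} ℝ => g ω.down) ∘ (fun p => ULift.up.{w} (e p)) = id := hge
  refine ⟨ULift.{w} ℝ, inferInstance, (withNoise ν).map fun p => ULift.up (e p),
    fun ω => (g ω.down).1, fun ω => (g ω.down).2,
    Measure.isProbabilityMeasure_map heup.aemeasurable, hgd.fst, hgd.snd, ?_⟩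
  rw [show (fun ω : ULift.{w} ℝ => ((g ω.down).1, (g ω.down).2)) = fun ω => g ω.down from rfl,
    Measure.map_map hgd heup, hid, Measure.map_id]

theorem tendsto_krigWeight {ν : GaussMeas 𝕏} {x : 𝕏} (hx : obsVar τ ν x ≠ 0) {y : ℕ → 𝕏}
    (hy : Tendsto y atTop (𝓝 x)) :
    Tendsto (fun n => krigWeight τ ν (y n)) atTop (𝓝 (krigWeight τ ν x)) := by
  let K : C(𝕏, C(𝕏, ℝ)) := ContinuousMap.curry
    ⟨fun p : 𝕏 × 𝕏 => cov ν p.2 p.1, (continuous_cov ν).comp continuous_swap⟩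
  have hK : ∀ z, krigWeight τ ν z = (obsVar τ ν z)⁻¹ • K z := fun z => by
    ext t
    simp [krigWeight, K, div_eq_inv_mul]
  simp_rw [hK]
  exact ((((continuous_obsVar τ ν).tendsto x).comp hy).inv₀ hx).smul
    ((K.continuous.tendsto x).comp hy)

/-- `Cond` is continuous in the observation point and the observed value, as long as the
observation has positive variance. -/
theorem gaussTendsto_cond {ν : GaussMeas 𝕏} {x : 𝕏} (hx : obsVar τ ν x ≠ 0) {y : ℕ → 𝕏}
    (hy : Tendsto y atTop (𝓝 x)) {z : ℕ → ℝ} {z' : ℝ} (hz : Tendsto z atTop (𝓝 z')) :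
    GaussTendsto (fun n => cond τ (y n) (z n) ν) (cond τ x z' ν) := by
  have hw := tendsto_krigWeight hx hy
  have hm : ∀ (a : 𝕏) (c : ℝ) b, mean (cond τ a c ν) b
      = ((⟨mean ν, continuous_mean ν⟩ : C(𝕏, ℝ)) + (c - mean ν a) • krigWeight τ ν a) b := by
    intro a c b
    rw [(cond_spec τ a c ν).1]
    simp [krigWeight, mul_comm]
  have hc : ∀ (a : 𝕏) (c : ℝ) (p : 𝕏 × 𝕏), cov (cond τ a c ν) p.1 p.2
      = ((⟨fun p => cov ν p.1 p.2, continuous_cov ν⟩ : C(𝕏 × 𝕏, ℝ)) -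
        obsVar τ ν a • tensorSquare (krigWeight τ ν a)) p := by
    intro a c p
    have h := krigWeight_mul_obsVar τ ν a p.1
    rw [(cond_spec τ a c ν).2.1]
    simp only [ContinuousMap.sub_apply, ContinuousMap.coe_mk, ContinuousMap.smul_apply,
      tensorSquare_apply, smul_eq_mul]
    rw [← mul_assoc, mul_comm (obsVar τ ν a), h, cov_comm ν a p.2]
    simp only [krigWeight, ContinuousMap.coe_mk, mul_div_assoc]
  have hmy := ((continuous_mean ν).tendsto x).comp hy
  have hvy := ((continuous_obsVar τ ν).tendsto x).comp hy
  constructor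
  · simp_rw [funext (hm x z'), hm]
    exact ContinuousMap.tendsto_iff_tendstoUniformly.1 (((hz.sub hmy).smul hw).const_add _)
  · simp_rw [hc]
    exact ContinuousMap.tendsto_iff_tendstoUniformly.1
      ((hvy.smul ((continuous_tensorSquare.tendsto _).comp hw)).const_sub _)

variable [MeasurableSpace 𝕏] [BorelSpace 𝕏]

theorem IsRegularLoss.tendsto_stepCrit [Nonempty D] (hL : IsRegularLoss.{u, v, w} τ L)
    {ν : GaussMeas 𝕏} {x : 𝕏} (hx : obsVar τ ν x ≠ 0) {y : ℕ → 𝕏} (hy : Tendsto y atTop (𝓝 x)) :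
    Tendsto (fun n => stepCrit τ (lossFunctional L) (y n) ν) atTop
      (𝓝 (stepCrit τ (lossFunctional L) x ν)) := by
  obtain ⟨Ω, _, P, ξ, U, _, hξ, hU, hmap⟩ := exists_model_withNoise.{u, w} ν
  have hξm : P.map ξ = ν.1 := by
    have h := congrArg (Measure.map Prod.fst) hmap
    rw [Measure.map_map measurable_fst (hξ.prodMk hU)] at h
    simpa [Function.comp_def] using h
  have hUm : P.map U = gaussianReal 0 1 := by
    have h := congrArg (Measure.map Prod.snd) hmap
    rw [Measure.map_map measurable_snd (hξ.prodMk hU)] at h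
    simpa [Function.comp_def] using h
  have hind : Indep (⊥ ⊔ MeasurableSpace.comap ξ inferInstance)
      (MeasurableSpace.comap U inferInstance) P := by
    rw [bot_sup_eq, ← IndepFun_iff_Indep, indepFun_iff_map_prod_eq_prod_map_map hξ.aemeasurable
      hU.aemeasurable, hmap, hξm, hUm]
  have hcond : ∀ a, (fun ω => cond τ a (noisyObs τ a (ξ ω, U ω)) ν) ∈ gaussCondLaws P ξ :=
    fun a => ⟨_, (isCondLaw_bot hξ hξm).cond hξ hU hUm hind τ (x := fun _ => a)
      measurable_const (fun _ => rfl)⟩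
  have hval : ∀ a, stepCrit τ (lossFunctional L) a ν
      = ∫⁻ ω, ENNReal.ofReal (lossFunctional L (cond τ a (noisyObs τ a (ξ ω, U ω)) ν)) ∂P := by
    intro a
    rw [stepCrit_eq hL.measurable_lossFunctional, ← hmap, lintegral_map _ (hξ.prodMk hU)]
    have h1 := measurable_cond_comp τ (E := Unit) (x := fun _ => a) measurable_const
      (ν := fun _ => ν) measurable_const
    exact (hL.measurable_lossFunctional.comp (h1.comp (f := fun p : C(𝕏, ℝ) × ℝ => ((), p))
      (by fun_prop))).ennreal_ofReal
  simp_rw [hval]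
  refine hL.tendsto_lintegral hξ (hξm ▸ ν.2) (fun n => hcond (y n)) (hcond x)
    (Eventually.of_forall fun ω => gaussTendsto_cond hx hy ?_)
  simp_rw [noisyObs_apply]
  exact (((ξ ω).continuous.tendsto x).comp hy).add
    ((((NNReal.continuous_coe.comp τ.continuous).tendsto x).comp hy).const_mul _)

/-- The infimum of the criterion may be computed on a dense sequence. At points where the
criterion may fail to be continuous, the observation is uninformative and the criterion takes its
maximal value. -/
theorem IsRegularLoss.iInf_stepCrit_eq [Nonempty 𝕏] [Nonempty D]
    (hL : IsRegularLoss.{u, v, w} τ L) (ν : GaussMeas 𝕏) :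
    ⨅ x, stepCrit τ (lossFunctional L) x ν
      = ⨅ n, stepCrit τ (lossFunctional L) (TopologicalSpace.denseSeq 𝕏 n) ν := by
  refine le_antisymm (le_iInf fun n => iInf_le _ _) (le_iInf fun x => ?_)
  by_cases hx : obsVar τ ν x = 0
  · have h : stepCrit τ (lossFunctional L) x ν = ENNReal.ofReal (lossFunctional L ν) := by
      simp [stepCrit, cond_eq_self hx]
    rw [h]
    exact (iInf_le _ 0).trans (hL.stepCrit_le _ ν)
  · obtain ⟨y, hy, hyx⟩ := mem_closure_iff_seq_limit.1 (TopologicalSpace.denseRange_denseSeq 𝕏 x)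
    refine ge_of_tendsto' (hL.tendsto_stepCrit hx hyx) fun n => ?_
    obtain ⟨k, hk⟩ := hy n
    rw [← hk]
    exact iInf_le (fun k => stepCrit τ (lossFunctional L) (TopologicalSpace.denseSeq 𝕏 k) ν) k

theorem measurable_stepCrit {H : GaussMeas 𝕏 → ℝ} (hH : Measurable H) :
    Measurable fun q : 𝕏 × GaussMeas 𝕏 => stepCrit τ H q.1 q.2 := by
  simp_rw [stepCrit_eq hH]
  have h := measurable_cond_comp τ (E := 𝕏 × GaussMeas 𝕏) measurable_fst measurable_snd
  have h2 := Measurable.lintegral_kernel_prod_right'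
    (κ := (gaussKernel.comap (fun q : 𝕏 × GaussMeas 𝕏 => q.2) measurable_snd) ×ₖ
      Kernel.const _ (gaussianReal 0 1)) (hH.comp h).ennreal_ofReal
  simpa only [Kernel.prod_apply, Kernel.const_apply, Kernel.comap_apply, gaussKernel_apply,
    Function.comp_apply] using h2

end Continuity

/-! ### Conditional laws on a larger probability space -/

section Extension

variable {𝕏 : Type u} [MetricSpace 𝕏] [CompactSpace 𝕏] {Ω : Type w}

theorem IsCondLaw.measure_preimage_inter {E : Type*} [MeasurableSpace E] [mΩ : MeasurableSpace Ω]
    {P : Measure Ω} [IsProbabilityMeasure P]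
    {ξ : Ω → C(𝕏, ℝ)} (hξ : Measurable ξ) {Y : Ω → E} (hY : Measurable Y) {ν : E → GaussMeas 𝕏}
    (hν : Measurable ν)
    (h : IsCondLaw (MeasurableSpace.comap Y inferInstance) P ξ (fun ω => ν (Y ω)))
    {S : Set E} (hS : MeasurableSet S) {A : Set C(𝕏, ℝ)} (hA : MeasurableSet A) :
    P (Y ⁻¹' S ∩ ξ ⁻¹' A) = ∫⁻ ω in Y ⁻¹' S, (ν (Y ω)).1 A ∂P := by
  have hSA : MeasurableSet (S ×ˢ A) := hS.prod hA
  have h1 := h.lintegral_comp hξ hY hν ((measurable_one (α := ℝ≥0∞)).indicator hSA)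
  have e1 : ∀ ω, (S ×ˢ A).indicator (1 : E × C(𝕏, ℝ) → ℝ≥0∞) (Y ω, ξ ω)
      = (Y ⁻¹' S ∩ ξ ⁻¹' A).indicator 1 ω := fun ω => rfl
  have e2 : ∀ ω, ∫⁻ f, (S ×ˢ A).indicator (1 : E × C(𝕏, ℝ) → ℝ≥0∞) (Y ω, f) ∂(ν (Y ω)).1
      = (Y ⁻¹' S).indicator (fun ω => (ν (Y ω)).1 A) ω := fun ω => by
    by_cases hω : Y ω ∈ S
    · have : ∀ f, (S ×ˢ A).indicator (1 : E × C(𝕏, ℝ) → ℝ≥0∞) (Y ω, f) = A.indicator 1 f :=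
        fun f => by
        by_cases hf : f ∈ A <;> simp [Set.indicator, hω, hf]
      simp_rw [this]
      rw [lintegral_indicator_one hA, Set.indicator_of_mem (show ω ∈ Y ⁻¹' S from hω)]
    · simp [Set.indicator, hω]
  simp_rw [e1, e2] at h1
  rwa [lintegral_indicator_one ((hY hS).inter (hξ hA)), lintegral_indicator (hY hS)] at h1

/-- Conditional laws can be pulled back along measure preserving maps. -/
theorem IsCondLaw.comp_measurePreserving {m' : MeasurableSpace Ω} [mΩ : MeasurableSpace Ω]
    {P : Measure Ω} [IsProbabilityMeasure P] {ξ : Ω → C(𝕏, ℝ)} {ν : Ω → GaussMeas 𝕏}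
    (h : IsCondLaw m' P ξ ν) (hξ : Measurable ξ) {Ω' : Type*} [MeasurableSpace Ω']
    {P' : Measure Ω'} [IsProbabilityMeasure P'] {π : Ω' → Ω} (hπ : MeasurePreserving π P' P) :
    IsCondLaw (m'.comap π) P' (fun ω => ξ (π ω)) (fun ω => ν (π ω)) := by
  have hle : m'.comap π ≤ ‹MeasurableSpace Ω'› :=
    (MeasurableSpace.comap_mono h.le).trans hπ.measurable.comap_le
  refine isCondLaw_of_measure_inter (hξ.comp hπ.measurable) hle
    (fun B hB => ⟨_, h.measurable hB, rfl⟩) ?_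
  rintro _ ⟨T, hT, rfl⟩ A hA
  have h1 := @IsCondLaw.measure_preimage_inter 𝕏 _ _ Ω Ω m' mΩ P _ ξ hξ id (measurable_id'' h.le)
    ν h.measurable h.comap_id T hT A hA
  have hνA : Measurable fun ω => (ν ω).1 A := (Measure.measurable_coe hA).comp
    (measurable_subtype_coe.comp (h.measurable.mono h.le le_rfl))
  rw [hπ.setLIntegral_comp_preimage (h.le _ hT) hνA]
  refine Eq.trans ?_ h1
  exact hπ.measure_preimage ((h.le _ hT).inter (hξ hA)).nullMeasurableSet

end Extension

/-! ### Convergence of the expected sampling criterion -/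

section Criterion

variable {𝕏 : Type u} [MetricSpace 𝕏] [CompactSpace 𝕏] [MeasurableSpace 𝕏] [BorelSpace 𝕏]
  {τ : C(𝕏, ℝ≥0)} {Ω : Type w}

theorem indep_comap_fst_snd {m' : MeasurableSpace Ω} [mΩ : MeasurableSpace Ω] {P : Measure Ω}
    [IsProbabilityMeasure P] {ξ : Ω → C(𝕏, ℝ)} (hξ : Measurable ξ) (hm : m' ≤ mΩ) :
    Indep (m'.comap Prod.fst ⊔ MeasurableSpace.comap (fun q : Ω × ℝ => ξ q.1) inferInstance)
      (MeasurableSpace.comap Prod.snd inferInstance) (P.prod (gaussianReal 0 1)) := by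
  have h := indepFun_prod (μ := P) (ν := gaussianReal 0 1) (X := id) (Y := id) measurable_id
    measurable_id
  rw [IndepFun_iff_Indep] at h
  refine indep_of_indep_of_le_left h (sup_le (MeasurableSpace.comap_mono hm) ?_)
  exact (hξ.comp (comap_measurable Prod.fst)).comap_le

theorem map_snd_prod_gaussianReal [mΩ : MeasurableSpace Ω] (P : Measure Ω)
    [IsProbabilityMeasure P] :
    (P.prod (gaussianReal 0 1)).map Prod.snd = gaussianReal 0 1 := by
  simp

/-- An additional observation at a fixed point `x`, with noise carried by an extra factor of the
probability space. -/
theorem IsCondLaw.cond_prod {m' : MeasurableSpace Ω} [mΩ : MeasurableSpace Ω]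
    {P : Measure Ω} [IsProbabilityMeasure P] {ξ : Ω → C(𝕏, ℝ)} {ν : Ω → GaussMeas 𝕏}
    (h : IsCondLaw m' P ξ ν) (hξ : Measurable ξ) (x : 𝕏) :
    IsCondLaw (m'.comap Prod.fst ⊔
        MeasurableSpace.comap (fun q : Ω × ℝ => noisyObs τ x (ξ q.1, q.2)) inferInstance)
      (P.prod (gaussianReal 0 1)) (fun q => ξ q.1)
      (fun q => SUR.cond τ x (noisyObs τ x (ξ q.1, q.2)) (ν q.1)) :=
  (h.comp_measurePreserving hξ (measurePreserving_fst (μ := P) (ν := gaussianReal 0 1))).cond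
    (hξ.comp measurable_fst) measurable_snd (map_snd_prod_gaussianReal P)
    (indep_comap_fst_snd hξ h.le) τ (x := fun _ => x) measurable_const fun _ => rfl

theorem IsCondLaw.lintegral_cond_prod {m' : MeasurableSpace Ω} [mΩ : MeasurableSpace Ω]
    {P : Measure Ω} [IsProbabilityMeasure P] {ξ : Ω → C(𝕏, ℝ)} {ν : Ω → GaussMeas 𝕏}
    (h : IsCondLaw m' P ξ ν) (hξ : Measurable ξ) (x : 𝕏) {H : GaussMeas 𝕏 → ℝ}
    (hH : Measurable H) :
    ∫⁻ q, ENNReal.ofReal (H (SUR.cond τ x (noisyObs τ x (ξ q.1, q.2)) (ν q.1)))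
        ∂P.prod (gaussianReal 0 1) = ∫⁻ ω, stepCrit τ H x (ν ω) ∂P := by
  have hfst := measurePreserving_fst (μ := P) (ν := gaussianReal 0 1)
  have h1 := (h.comp_measurePreserving hξ hfst).lintegral_cond_eq
    (hξ.comp measurable_fst) measurable_snd (map_snd_prod_gaussianReal P)
    (indep_comap_fst_snd hξ h.le) τ (x := fun _ => x) measurable_const (fun _ => rfl)
    hH.ennreal_ofReal
  refine h1.trans ?_
  simp_rw [← stepCrit_eq hH]
  have hm : Measurable fun ω => stepCrit τ H x (ν ω) :=
    (measurable_stepCrit hH).comp (measurable_const.prodMk (h.measurable.mono h.le le_rfl))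
  exact hfst.lintegral_comp hm

variable {D : Type v} [TopologicalSpace D] [Nonempty D] {L : C(𝕏, ℝ) → D → ℝ≥0}
  [mΩ : MeasurableSpace Ω] {P : Measure Ω} [IsProbabilityMeasure P]
  {ξ : Ω → C(𝕏, ℝ)} {𝓕 : Filtration ℕ mΩ} {ν : ℕ → Ω → GaussMeas 𝕏} {ν' : Ω → GaussMeas 𝕏}

theorem IsRegularLoss.tendsto_lintegral_lossFunctional (hL : IsRegularLoss.{u, v, w} τ L)
    (hξ : Measurable ξ) (hg : IsGaussian (P.map ξ)) (hν : ∀ n, IsCondLaw (𝓕 n) P ξ (ν n))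
    (hν' : IsCondLaw (⨆ n, 𝓕 n) P ξ ν') :
    Tendsto (fun n => ∫⁻ ω, ENNReal.ofReal (lossFunctional L (ν n ω)) ∂P) atTop
      (𝓝 (∫⁻ ω, ENNReal.ofReal (lossFunctional L (ν' ω)) ∂P)) :=
  hL.tendsto_lintegral hξ hg (fun n => ⟨_, hν n⟩) ⟨_, hν'⟩ (IsCondLaw.gaussTendsto hξ hg hν hν')

/-- The expected criterion at a fixed point `x` converges along conditional laws given increasing
σ-algebras. The criterion is the expected Bayes risk after one more observation, and the laws
updated by that observation are again conditional laws given increasing σ-algebras. -/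
theorem IsRegularLoss.tendsto_lintegral_stepCrit (hL : IsRegularLoss.{u, v, w} τ L)
    (hξ : Measurable ξ) (hg : IsGaussian (P.map ξ)) (hν : ∀ n, IsCondLaw (𝓕 n) P ξ (ν n))
    (hν' : IsCondLaw (⨆ n, 𝓕 n) P ξ ν') (x : 𝕏) :
    Tendsto (fun n => ∫⁻ ω, stepCrit τ (lossFunctional L) x (ν n ω) ∂P) atTop
      (𝓝 (∫⁻ ω, stepCrit τ (lossFunctional L) x (ν' ω) ∂P)) := by
  have hH := hL.measurable_lossFunctional
  let 𝓖 : Filtration ℕ (inferInstance : MeasurableSpace (Ω × ℝ)) :=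
    { seq := fun n => (𝓕 n).comap Prod.fst ⊔
        MeasurableSpace.comap (fun q : Ω × ℝ => noisyObs τ x (ξ q.1, q.2)) inferInstance
      mono' := fun i j hij => sup_le_sup_right (MeasurableSpace.comap_mono (𝓕.mono hij)) _
      le' := fun n => ((hν n).cond_prod (τ := τ) hξ x).le }
  have h𝓖 : ⨆ n, 𝓖 n = (⨆ n, 𝓕 n).comap Prod.fst ⊔
      MeasurableSpace.comap (fun q : Ω × ℝ => noisyObs τ x (ξ q.1, q.2)) inferInstance := by
    rw [MeasurableSpace.comap_iSup, iSup_sup]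
  simp_rw [← (hν _).lintegral_cond_prod hξ x hH]
  rw [← hν'.lintegral_cond_prod hξ x hH]
  have hlim := hν'.cond_prod (τ := τ) hξ x
  rw [← h𝓖] at hlim
  have hgauss : IsGaussian ((P.prod (gaussianReal 0 1)).map fun q : Ω × ℝ => ξ q.1) := by
    have h := Measure.map_map (μ := P.prod (gaussianReal 0 1)) hξ measurable_fst
    rw [(measurePreserving_fst (μ := P) (ν := gaussianReal 0 1)).map_eq] at h
    rw [h] at hg
    exact hg
  exact hL.tendsto_lintegral_lossFunctional (𝓕 := 𝓖) (hξ.comp measurable_fst) hgauss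
    (fun n => (hν n).cond_prod hξ x) hlim

end Criterion

/-! ### The maximal expected gain -/

section MaxGain

variable {𝕏 : Type u} [MetricSpace 𝕏] [CompactSpace 𝕏] [MeasurableSpace 𝕏] [BorelSpace 𝕏]
  {τ : C(𝕏, ℝ≥0)} {D : Type v} [TopologicalSpace D] [Nonempty D] {L : C(𝕏, ℝ) → D → ℝ≥0}

theorem IsRegularLoss.stepCrit_ne_top (hL : IsRegularLoss.{u, v, w} τ L) (x : 𝕏)
    (ν : GaussMeas 𝕏) : stepCrit τ (lossFunctional L) x ν ≠ ∞ :=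
  ne_top_of_le_ne_top ENNReal.ofReal_ne_top (hL.stepCrit_le x ν)

theorem IsRegularLoss.gain_eq (hL : IsRegularLoss.{u, v, w} τ L) (x : 𝕏) (ν : GaussMeas 𝕏) :
    gain τ (lossFunctional L) x ν = ((ENNReal.ofReal (lossFunctional L ν) -
      stepCrit τ (lossFunctional L) x ν : ℝ≥0∞) : EReal) := by
  rw [ENNReal.toEReal_sub (hL.stepCrit_ne_top x ν) (hL.stepCrit_le x ν), EReal.coe_ennreal_ofReal,
    max_eq_left (lossFunctional_nonneg L ν), gain]

theorem IsRegularLoss.maxGain_eq [Nonempty 𝕏] (hL : IsRegularLoss.{u, v, w} τ L)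
    (ν : GaussMeas 𝕏) :
    maxGain τ (lossFunctional L) ν = ((ENNReal.ofReal (lossFunctional L ν) -
      ⨅ x, stepCrit τ (lossFunctional L) x ν : ℝ≥0∞) : EReal) := by
  simp_rw [maxGain, hL.gain_eq, ENNReal.sub_iInf]
  exact (EReal.coe_ennreal_strictMono.monotone.map_ciSup_of_continuousAt
    continuous_coe_ennreal_ereal.continuousAt (OrderTop.bddAbove _)).symm

end MaxGain

/-! ### Existence of quasi-SUR designs -/

section Existence

variable {𝕏 : Type u} [MetricSpace 𝕏] [CompactSpace 𝕏] [MeasurableSpace 𝕏] [BorelSpace 𝕏]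
  {τ : C(𝕏, ℝ≥0)}

/-- A near-minimizer of the criterion, chosen as the first suitable point of a dense sequence, is a
measurable function of the Gaussian measure. -/
theorem IsRegularLoss.exists_measurable_near_minimizer [Nonempty 𝕏] {D : Type v}
    [TopologicalSpace D] [Nonempty D] {L : C(𝕏, ℝ) → D → ℝ≥0} (hL : IsRegularLoss.{u, v, w} τ L)
    {δ : ℝ} (hδ : 0 < δ) :
    ∃ σ : GaussMeas 𝕏 → 𝕏, Measurable σ ∧ ∀ ν, stepCrit τ (lossFunctional L) (σ ν) ν ≤
      (⨅ x, stepCrit τ (lossFunctional L) x ν) + ENNReal.ofReal δ := by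
  classical
  have hJ : ∀ k, Measurable fun ν =>
      stepCrit τ (lossFunctional L) (TopologicalSpace.denseSeq 𝕏 k) ν := fun k =>
    (measurable_stepCrit hL.measurable_lossFunctional).comp measurable_prodMk_left
  have hex : ∀ ν : GaussMeas 𝕏, ∃ k, stepCrit τ (lossFunctional L) (TopologicalSpace.denseSeq 𝕏 k) ν
      ≤ (⨅ n, stepCrit τ (lossFunctional L) (TopologicalSpace.denseSeq 𝕏 n) ν)
        + ENNReal.ofReal δ := fun ν => by
    have hlt : ⨅ n, stepCrit τ (lossFunctional L) (TopologicalSpace.denseSeq 𝕏 n) ν <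
        (⨅ n, stepCrit τ (lossFunctional L) (TopologicalSpace.denseSeq 𝕏 n) ν)
          + ENNReal.ofReal δ :=
      ENNReal.lt_add_right (ne_top_of_le_ne_top (hL.stepCrit_ne_top _ ν) (iInf_le _ 0))
        (ENNReal.ofReal_pos.2 hδ).ne'
    obtain ⟨k, hk⟩ := iInf_lt_iff.1 hlt
    exact ⟨k, hk.le⟩
  refine ⟨fun ν => TopologicalSpace.denseSeq 𝕏 (Nat.find (hex ν)),
    measurable_from_nat.comp (measurable_find hex fun k =>
      measurableSet_le (hJ k) ((Measurable.iInf hJ).add_const _)), fun ν => ?_⟩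
  rw [hL.iInf_stepCrit_eq]
  exact Nat.find_spec (hex ν)

variable {Ω : Type w} [mΩ : MeasurableSpace Ω] {P : Measure Ω} [IsProbabilityMeasure P]

/-- The posterior distributions when the `n`-th design point is chosen as a function `σ n` of the
current posterior. -/
noncomputable def ObsModel.feedbackPosterior (M : ObsModel 𝕏 P) (τ : C(𝕏, ℝ≥0))
    (σ : ℕ → GaussMeas 𝕏 → 𝕏) : ℕ → Ω → GaussMeas 𝕏
  | 0, _ => M.prior
  | n + 1, ω => cond τ (σ n (M.feedbackPosterior τ σ n ω))
      (noisyObs τ (σ n (M.feedbackPosterior τ σ n ω)) (M.ξ ω, M.U n ω))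
      (M.feedbackPosterior τ σ n ω)

/-- Choosing each design point as a measurable function of the current posterior defines a
sequential design. -/
theorem ObsModel.exists_feedback_design (M : ObsModel 𝕏 P) (τ : C(𝕏, ℝ≥0))
    {σ : ℕ → GaussMeas 𝕏 → 𝕏} (hσ : ∀ n, Measurable (σ n)) :
    ∃ X : ℕ → Ω → 𝕏, M.IsSequentialDesign τ X ∧
      ∀ n ω, X n ω = σ n (M.posterior τ X n ω) := by
  set X : ℕ → Ω → 𝕏 := fun n ω => σ n (M.feedbackPosterior τ σ n ω) with hX
  have hpost : ∀ n, M.posterior τ X n = M.feedbackPosterior τ σ n := fun n => by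
    induction n with
    | zero => rfl
    | succ n ih =>
      funext ω
      rw [ObsModel.posterior, ih, M.obs_eq_noisyObs, ObsModel.feedbackPosterior]
  have hmeas : ∀ n, Measurable[M.obsSigma τ X n] (M.feedbackPosterior τ σ n) := fun n => by
    induction n with
    | zero => exact measurable_const
    | succ n ih =>
      have hQ := ih.mono (M.obsSigma_mono τ X n.le_succ) le_rfl
      have hobs : Measurable[M.obsSigma τ X (n + 1)] (M.obs τ X n) :=
        (comap_measurable _).mono (le_iSup₂_of_le n n.lt_succ_self le_sup_right) le_rfl
      have h := (measurable_cond τ).comp (((hσ n).comp hQ).prodMk (hobs.prodMk hQ))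
      convert h using 1
      funext ω
      simp only [Function.comp_apply, M.obs_eq_noisyObs, ObsModel.feedbackPosterior, hX]
  refine ⟨X, fun n => (hσ n).comp (hmeas n), fun n ω => ?_⟩
  rw [hpost]

theorem IsRegularLoss.exists_isEpsQuasiSUR [Nonempty 𝕏] {D : Type v}
    [TopologicalSpace D] [Nonempty D] {L : C(𝕏, ℝ) → D → ℝ≥0} (hL : IsRegularLoss.{u, v, w} τ L)
    (M : ObsModel 𝕏 P) {ε : ℕ → ℝ} (hε : ∀ n, 0 < ε n) :
    ∃ X : ℕ → Ω → 𝕏, M.IsEpsQuasiSUR τ (lossFunctional L) ε X := by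
  choose σ hσ hσle using fun n => hL.exists_measurable_near_minimizer (hε n)
  obtain ⟨X, hX, hXσ⟩ := M.exists_feedback_design τ hσ
  refine ⟨X, hX, 0, fun n _ => Eventually.of_forall fun ω => ?_⟩
  simp only [ObsModel.sampCrit]
  rw [hXσ n ω]
  exact hσle n _

end Existence

/-! ### Convergence of quasi-SUR designs -/

section Convergence

variable {𝕏 : Type u} [MetricSpace 𝕏] [CompactSpace 𝕏] [MeasurableSpace 𝕏] [BorelSpace 𝕏]
  {τ : C(𝕏, ℝ≥0)} {Ω : Type w} [mΩ : MeasurableSpace Ω] {P : Measure Ω} [IsProbabilityMeasure P]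
  {M : ObsModel 𝕏 P} {X : ℕ → Ω → 𝕏}

/-- The criterion at the chosen point is, on average, the functional after the next observation. -/
theorem ObsModel.lintegral_sampCrit (hX : M.IsSequentialDesign τ X) {H : GaussMeas 𝕏 → ℝ}
    (hH : Measurable H) (n : ℕ) :
    ∫⁻ ω, M.sampCrit τ H X n (X n ω) ω ∂P
      = ∫⁻ ω, ENNReal.ofReal (H (M.posterior τ X (n + 1) ω)) ∂P := by
  simp only [ObsModel.sampCrit, stepCrit_eq hH]
  exact ((M.isCondLaw_posterior hX n).lintegral_cond_eq M.measurable_path (M.measurable_U n)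
    (M.law_U n) (M.indep_noise hX n) τ (hX n) (M.obs_eq_noisyObs τ X n) hH.ennreal_ofReal).symm

theorem ObsModel.measurable_posterior (hX : M.IsSequentialDesign τ X) (n : ℕ) :
    Measurable (M.posterior τ X n) :=
  (M.isCondLaw_posterior hX n).measurable.mono (M.obsSigma_le hX n) le_rfl

theorem ObsModel.measurable_sampCrit (hX : M.IsSequentialDesign τ X) {H : GaussMeas 𝕏 → ℝ}
    (hH : Measurable H) (n : ℕ) : Measurable fun ω => M.sampCrit τ H X n (X n ω) ω :=
  (measurable_stepCrit hH).comp
    (((hX n).mono (M.obsSigma_le hX n) le_rfl).prodMk (M.measurable_posterior hX n))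

variable {D : Type v} [TopologicalSpace D] [Nonempty D] {L : C(𝕏, ℝ) → D → ℝ≥0}

theorem IsRegularLoss.lintegral_ne_top (hL : IsRegularLoss.{u, v, w} τ L) 
    {ν : Ω → GaussMeas 𝕏} (hν : ν ∈ gaussCondLaws P M.ξ) :
    ∫⁻ ω, ENNReal.ofReal (lossFunctional L (ν ω)) ∂P ≠ ∞ :=
  (hL.integrable_comp_gaussCondLaws M.measurable_path M.isGaussian_map hν).lintegral_lt_top.ne

/-- The expected one-step decreases of the Bayes risk telescope, so they are summable. -/
theorem IsRegularLoss.tsum_lintegral_decrease_ne_top (hL : IsRegularLoss.{u, v, w} τ L)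
    (hX : M.IsSequentialDesign τ X) :
    ∑' n, ∫⁻ ω, (ENNReal.ofReal (lossFunctional L (M.posterior τ X n ω)) -
      M.sampCrit τ (lossFunctional L) X n (X n ω) ω) ∂P ≠ ∞ := by
  have hH := hL.measurable_lossFunctional
  set a : ℕ → ℝ≥0∞ := fun n => ∫⁻ ω, ENNReal.ofReal (lossFunctional L (M.posterior τ X n ω)) ∂P
    with ha
  have hfin : ∀ n, a n ≠ ∞ := fun n => hL.lintegral_ne_top ⟨_, M.isCondLaw_posterior hX n⟩
  have hle : ∀ n ω, M.sampCrit τ (lossFunctional L) X n (X n ω) ω ≤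
      ENNReal.ofReal (lossFunctional L (M.posterior τ X n ω)) := fun n ω => hL.stepCrit_le _ _
  have hJ : ∀ n, ∫⁻ ω, M.sampCrit τ (lossFunctional L) X n (X n ω) ω ∂P = a (n + 1) :=
    M.lintegral_sampCrit hX hH
  have hstep : ∀ n, ∫⁻ ω, (ENNReal.ofReal (lossFunctional L (M.posterior τ X n ω)) -
      M.sampCrit τ (lossFunctional L) X n (X n ω) ω) ∂P = a n - a (n + 1) := fun n => by
    rw [lintegral_sub (M.measurable_sampCrit hX hH n) (by rw [hJ]; exact hfin _)
      (Eventually.of_forall (hle n)), hJ]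
  have hanti : ∀ n, a (n + 1) ≤ a n := fun n => by
    rw [← hJ]; exact lintegral_mono (hle n)
  have hsum : ∀ n, ∑ i ∈ Finset.range n, (a i - a (i + 1)) + a n = a 0 := fun n => by
    induction n with
    | zero => simp
    | succ n ih => rw [Finset.sum_range_succ, add_assoc, tsub_add_cancel_of_le (hanti n), ih]
  simp_rw [hstep]
  refine ne_top_of_le_ne_top (hfin 0) (ENNReal.tsum_le_of_sum_range_le fun n => ?_)
  rw [← hsum n]
  exact le_self_add

variable [Nonempty 𝕏]

/-- Along a quasi-SUR design the maximal expected gain of the posterior vanishes in the limit: it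
exceeds the actual decrease of the Bayes risk by at most `ε n`. -/
theorem IsRegularLoss.tendsto_maxGain_posterior (hL : IsRegularLoss.{u, v, w} τ L)
    (hX : M.IsQuasiSUR τ (lossFunctional L) X) :
    ∀ᵐ ω ∂P, Tendsto (fun n => maxGain τ (lossFunctional L) (M.posterior τ X n ω)) atTop (𝓝 0) := by
  obtain ⟨ε, -, hε, hX, n₀, hn₀⟩ := hX
  have hH := hL.measurable_lossFunctional
  have hsum := hL.tsum_lintegral_decrease_ne_top hX
  have hm : ∀ n, Measurable fun ω => ENNReal.ofReal (lossFunctional L (M.posterior τ X n ω)) -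
      M.sampCrit τ (lossFunctional L) X n (X n ω) ω := fun n =>
    (hH.comp (M.measurable_posterior hX n)).ennreal_ofReal.sub (M.measurable_sampCrit hX hH n)
  rw [← lintegral_tsum fun n => (hm n).aemeasurable] at hsum
  have hfin := ae_lt_top (Measurable.tsum hm) hsum
  have hε' : Tendsto (fun n => ENNReal.ofReal (ε n)) atTop (𝓝 0) := by
    simpa using ENNReal.tendsto_ofReal hε
  filter_upwards [hfin, ae_all_iff.2 fun n => eventually_imp_distrib_left.2 (hn₀ n)] with ω h1 h2
  have h3 := ENNReal.tendsto_atTop_zero_of_tsum_ne_top h1.ne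
  simp_rw [hL.maxGain_eq]
  have h4 : Tendsto (fun n => ENNReal.ofReal (lossFunctional L (M.posterior τ X n ω)) -
      ⨅ x, stepCrit τ (lossFunctional L) x (M.posterior τ X n ω)) atTop (𝓝 0) := by
    refine tendsto_of_tendsto_of_tendsto_of_le_of_le' tendsto_const_nhds
      (by simpa using h3.add hε') (Eventually.of_forall fun _ => zero_le)
      (eventually_atTop.2 ⟨n₀, fun n hn => ?_⟩)
    rw [tsub_le_iff_right, add_assoc, add_comm (ENNReal.ofReal (ε n))]
    exact le_tsub_add.trans (add_le_add_right (h2 n hn) _)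
  exact (continuous_coe_ennreal_ereal.tendsto 0).comp h4

/-- In the limit of a quasi-SUR design, no further observation is expected to decrease the Bayes
risk. -/
theorem IsRegularLoss.maxGain_limit_eq_zero (hL : IsRegularLoss.{u, v, w} τ L)
    (hX : M.IsQuasiSUR τ (lossFunctional L) X) {P' : Ω → GaussMeas 𝕏}
    (hP' : IsCondLaw (M.obsSigmaInf τ X) P M.ξ P') :
    ∀ᵐ ω ∂P, maxGain τ (lossFunctional L) (P' ω) = 0 := by
  obtain ⟨ε, -, hε, hX, n₀, hn₀⟩ := hX
  have hH := hL.measurable_lossFunctional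
  have hε' : Tendsto (fun n => ENNReal.ofReal (ε n)) atTop (𝓝 0) := by
    simpa using ENNReal.tendsto_ofReal hε
  have hΔ := ENNReal.tendsto_atTop_zero_of_tsum_ne_top (hL.tsum_lintegral_decrease_ne_top hX)
  have hν : ∀ n, IsCondLaw (M.filtration hX n) P M.ξ (M.posterior τ X n) :=
    M.isCondLaw_posterior hX
  have hν' : IsCondLaw (⨆ n, M.filtration hX n) P M.ξ P' := hP'
  have hP'm : Measurable P' := hP'.measurable.mono hP'.le le_rfl
  have hJm : ∀ x {ν : Ω → GaussMeas 𝕏}, Measurable ν →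
      Measurable fun ω => stepCrit τ (lossFunctional L) x (ν ω) := fun x ν h =>
    (measurable_stepCrit hH).comp (measurable_const.prodMk h)
  have hx : ∀ x, ∀ᵐ ω ∂P, stepCrit τ (lossFunctional L) x (P' ω)
      = ENNReal.ofReal (lossFunctional L (P' ω)) := by
    intro x
    have hfin := hL.lintegral_ne_top ⟨_, hP'⟩
    refine ae_eq_of_ae_le_of_lintegral_le (Eventually.of_forall fun ω => hL.stepCrit_le x _)
      (ne_top_of_le_ne_top hfin (lintegral_mono fun ω => hL.stepCrit_le x _))
      (hH.comp hP'm).ennreal_ofReal.aemeasurable ?_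
    have h1 := hL.tendsto_lintegral_lossFunctional M.measurable_path M.isGaussian_map hν hν'
    have h2 := (hΔ.add (hL.tendsto_lintegral_stepCrit M.measurable_path M.isGaussian_map hν hν'
      x)).add hε'
    rw [zero_add, add_zero] at h2
    refine le_of_tendsto_of_tendsto h1 h2 (eventually_atTop.2 ⟨n₀, fun n hn => ?_⟩)
    have hm := M.measurable_posterior hX n
    beta_reduce
    rw [← lintegral_add_right _ (hJm x hm)]
    calc ∫⁻ ω, ENNReal.ofReal (lossFunctional L (M.posterior τ X n ω)) ∂P
        ≤ ∫⁻ ω, ((ENNReal.ofReal (lossFunctional L (M.posterior τ X n ω)) -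
            M.sampCrit τ (lossFunctional L) X n (X n ω) ω)
            + stepCrit τ (lossFunctional L) x (M.posterior τ X n ω)) + ENNReal.ofReal (ε n) ∂P := by
          refine lintegral_mono_ae ?_
          filter_upwards [hn₀ n hn] with ω h
          rw [add_assoc]
          refine le_tsub_add.trans (add_le_add_right (h.trans ?_) _)
          exact add_le_add_left (iInf_le _ x) _
      _ = _ := by
          rw [lintegral_add_right _ measurable_const, lintegral_const, measure_univ, mul_one]
  filter_upwards [ae_all_iff.2 fun k => hx (TopologicalSpace.denseSeq 𝕏 k)] with ω h
  rw [hL.maxGain_eq, hL.iInf_stepCrit_eq]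
  simp [h]

/-- The part `H₀` converges by Lévy's upward theorem, the part `H₁` by `𝔓`-continuity. -/
theorem IsRegularLoss.tendsto_lossFunctional_posterior (hL : IsRegularLoss.{u, v, w} τ L)
    (hX : M.IsSequentialDesign τ X) {P' : Ω → GaussMeas 𝕏}
    (hP' : IsCondLaw (M.obsSigmaInf τ X) P M.ξ P') :
    ∀ᵐ ω ∂P, Tendsto (fun n => lossFunctional L (M.posterior τ X n ω)) atTop
      (𝓝 (lossFunctional L (P' ω))) := by
  obtain ⟨L₀, H₁, hm, hi, -, hPC, heq⟩ := hL.decomposition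
  have hν : ∀ n, IsCondLaw (M.filtration hX n) P M.ξ (M.posterior τ X n) :=
    M.isCondLaw_posterior hX
  have hν' : IsCondLaw (⨆ n, M.filtration hX n) P M.ξ P' := hP'
  have h1 := IsCondLaw.tendsto_integral M.measurable_path hν hν' hm
    (integrable_comp_path M.measurable_path M.isGaussian_map hi)
  have h2 := hPC.2 Ω P M.ξ M.measurable_path M.isGaussian_map _ _ (fun n => ⟨_, hν n⟩) ⟨_, hν'⟩
    (IsCondLaw.gaussTendsto M.measurable_path M.isGaussian_map hν hν')
  filter_upwards [h1, h2] with ω h1 h2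
  simp_rw [heq]
  exact h1.add h2

theorem IsRegularLoss.convergenceAssumptions (hL : IsRegularLoss.{u, v, w} τ L)
    (hX : M.IsQuasiSUR τ (lossFunctional L) X) :
    ConvergenceAssumptions M τ (lossFunctional L) X where
  measurable := hL.measurable_lossFunctional
  nonneg := lossFunctional_nonneg L
  supermartingale := hL.supermartingaleProperty
  quasiSUR := hX
  exists_limit := by
    obtain ⟨ε, -, -, hX, -⟩ := hX
    exact exists_isCondLaw_iSup (𝓕 := M.filtration hX) M.measurable_path M.isGaussian_map
      (M.isCondLaw_posterior hX)
  tendsto_H := fun P' hP' => by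
    obtain ⟨ε, -, -, hX, -⟩ := hX
    exact hL.tendsto_lossFunctional_posterior hX hP'
  tendsto_maxGain := fun P' hP' => by
    filter_upwards [hL.tendsto_maxGain_posterior hX, hL.maxGain_limit_eq_zero hX hP'] with ω h1 h2
    rwa [h2]
  maxGain_eq_zero := fun P' hP' => hL.maxGain_limit_eq_zero hX hP'
  zeros_eq := hL.zeros_eq

theorem IsRegularLoss.tendsto_lossFunctional_zero (hL : IsRegularLoss.{u, v, w} τ L)
    (hX : M.IsQuasiSUR τ (lossFunctional L) X) :
    ∀ᵐ ω ∂P, Tendsto (fun n => lossFunctional L (M.posterior τ X n ω)) atTop (𝓝 0) := by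
  have h := hL.convergenceAssumptions hX
  obtain ⟨P', hP'⟩ := h.exists_limit
  filter_upwards [h.tendsto_H P' hP', h.maxGain_eq_zero P' hP'] with ω h1 h2
  have h3 : P' ω ∈ {ν | lossFunctional L ν = 0} := h.zeros_eq ▸ h2
  have h4 : lossFunctional L (P' ω) = 0 := h3
  rwa [h4] at h1

end Convergence

end SUR

theorem mainTheorem4 {𝕏 : Type u} [MetricSpace 𝕏] [CompactSpace 𝕏] [Nonempty 𝕏]
    [MeasurableSpace 𝕏] [BorelSpace 𝕏] {D : Type v} [TopologicalSpace D] [Nonempty D]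
    (τ : C(𝕏, ℝ≥0)) (L : C(𝕏, ℝ) → D → ℝ≥0) (hL : SUR.IsRegularLoss.{u, v, w} τ L)
    (H : SUR.GaussMeas 𝕏 → ℝ) (hH : H = SUR.lossFunctional L) :
    -- `H` satisfies the assumptions of the existence and convergence theorems
    Measurable H ∧
    SUR.ExistenceAssumptions.{u, w} τ H ∧
    SUR.SupermartingaleProperty.{u, w} τ H ∧
    {ν | H ν = 0} = {ν | SUR.maxGain τ H ν = 0} ∧
    (∀ (Ω : Type w) [MeasurableSpace Ω] (P : Measure Ω) [IsProbabilityMeasure P]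
      (M : SUR.ObsModel 𝕏 P) (X : ℕ → Ω → 𝕏), M.IsQuasiSUR τ H X →
      SUR.ConvergenceAssumptions M τ H X) ∧
    -- existence of `ε`-quasi-SUR designs
    (∀ (Ω : Type w) [MeasurableSpace Ω] (P : Measure Ω) [IsProbabilityMeasure P]
      (M : SUR.ObsModel 𝕏 P) (ε : ℕ → ℝ), (∀ n, 0 < ε n) →
      ∃ X : ℕ → Ω → 𝕏, M.IsEpsQuasiSUR τ H ε X) ∧
    -- convergence of quasi-SUR designs
    (∀ (Ω : Type w) [MeasurableSpace Ω] (P : Measure Ω) [IsProbabilityMeasure P]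
      (M : SUR.ObsModel 𝕏 P) (X : ℕ → Ω → 𝕏), M.IsQuasiSUR τ H X →
      ∀ᵐ ω ∂P, Tendsto (fun n => H (M.posterior τ X n ω)) atTop (𝓝 0)) := by
  subst hH
  exact ⟨hL.measurable_lossFunctional, hL.existenceAssumptions, hL.supermartingaleProperty,
    hL.zeros_eq, fun Ω _ P _ M X hX => hL.convergenceAssumptions hX,
    fun Ω _ P _ M ε hε => hL.exists_isEpsQuasiSUR M hε,
    fun Ω _ P _ M X hX => hL.tendsto_lossFunctional_zero hX⟩
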